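/- **Conventions.** A quantum polynomial-time (QPT) algorithm is a single uniform quantum algorithm (a classical random access machine that controls a quantum memory through Hadamard, $T$, $\mathsf{CNOT}$ gates and computational-basis measurements) that takes a security parameter $n$, given as $1^n$, a classical input string, and possibly a quantum input, and whose number of steps is bounded, on every input and for all measurement outcomes, by a polynomial in $n$ and the length of the classical input. An advice ensemble is a family $|\tau\rangle=\{|\tau_n\rangle\}_{n\in\mathbb N}$ of arbitrary pure states, where $|\tau_n\rangle$ consists of polynomially many (in $n$) qubits. $\mathsf{SD}(P,Q)=\frac12\sum_x|P(x)-Q(x)|$ is statistical distance. Polynomials have coefficients in $\mathbb N$. **Distributional one-way puzzles.** For $\varepsilon:\mathbb N\to\mathbb R$, an $\varepsilon$-distributional one-way puzzle is a QPT algorithm $\mathsf{Samp}(1^n)$ that outputs a pair $(s,k)$ of classical strings (puzzle and key) such that for every QPT algorithm $\mathcal A$ and every advice ensemble $|\tau\rangle$, for all large enough $n$, $$\mathsf{SD}\big(\{s,k\},\{s,\mathcal A(|\tau_n\rangle,s)\}\big)\ \ge\ \varepsilon(n),\qquad (s,k)\leftarrow\mathsf{Samp}(1^n).$$ Distributional one-way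 puzzles are said to exist if $1/q(n)$-distributional one-way puzzles exist for some non-zero polynomial $q$. **Native approximation hardness.** A family $\mathcal D=\{\mathcal D_n\}_{n\in\mathbb N}$ of distributions over classical strings that some QPT algorithm samples from (on input $1^n$ it outputs a string with distribution exactly $\mathcal D_n$) has native approximation hardness if there is a non-zero polynomial $p$ such that for every QPT algorithm $\mathcal A$ that outputs a non-negative rational number (as numerator and denominator) and every advice ensemble $|\tau\rangle$, for all large enough $n$, $$\Pr_{x\leftarrow\mathcal D_n}\left[\ \Big|\mathcal A(|\tau_n\rangle,x)-\Pr_{\mathcal D_n}[x]\Big|\le\frac{\Pr_{\mathcal D_n}[x]}{p(n)}\ \right]\ \le\ 1-\frac1{p(n)},$$ the probability being over $x$ and the randomness of $\mathcal A$. **Theorem.** If distributional one-way puzzles exist, then there exists an efficiently sampleable family of distributions over classical strings that has native approximation hardness. -/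

import Mathlib

noncomputable section

namespace QuantumPuzzle

/-! ## Classical strings -/

/-- Classical (bit) strings of arbitrary length. -/
abbrev Str : Type := List Bool

/-- The number that represents a string in a register: bijective base-two numeration, the first
bit of the string being the least significant digit.  It has as many digits as the string
has bits. -/
def code : Str → ℕ
  | [] => 0
  | b :: l => 2 * code l + (if b then 2 else 1)

/-- The string represented by a number; the inverse of `code`. -/
def decode : ℕ → Str
  | 0 => []
  | n + 1 => (n % 2 == 1) :: decode (n / 2)
decreasing_by omega

theorem decode_code (l : Str) : decode (code l) = l := by
  induction l with
  | nil => simp [code, decode]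
  | cons b l ih =>
    cases b
    · have h1 : (2 * code l) % 2 = 0 := by omega
      have h2 : 2 * code l / 2 = code l := by omega
      simp [code, decode, h2, ih]
    · have h1 : (2 * code l + 1) % 2 = 1 := by omega
      have h2 : (2 * code l + 1) / 2 = code l := by omega
      simp [code, decode, h1, h2, ih]

theorem code_decode (n : ℕ) : code (decode n) = n := by
  induction n using Nat.strong_induction_on with
  | _ n ih =>
    cases n with
    | zero => simp [code, decode]
    | succ n =>
      have h := ih (n / 2) (by omega)
      rw [decode, code, h]
      by_cases hn : n % 2 = 1
      · simp [hn]; omega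
      · simp [hn]; omega

/-! ## Quantum states and gates -/

/-- (Unnormalised) states of a quantum memory whose qubits are numbered `0, 1, 2, …`.
The basis vector labelled by a finite set `x` is the computational basis state in which
exactly the qubits in `x` are `1`. -/
abbrev QState : Type := Finset ℕ →₀ ℂ

/-- The squared norm of a state. -/
def weight (ψ : QState) : ℝ := ψ.sum fun _ a => ‖a‖ ^ 2

/-- Hadamard gate on qubit `q`. -/
def hGate (q : ℕ) : QState →ₗ[ℂ] QState :=
  Finsupp.linearCombination ℂ fun x : Finset ℕ =>
    ((Real.sqrt 2 : ℂ)⁻¹) • (Finsupp.single (x.erase q) 1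
      + Finsupp.single (insert q x) (if q ∈ x then (-1 : ℂ) else 1))

/-- The `T` gate `diag (1, exp (i π / 4))` on qubit `q`. -/
def tGate (q : ℕ) : QState →ₗ[ℂ] QState :=
  Finsupp.linearCombination ℂ fun x : Finset ℕ =>
    Finsupp.single x (if q ∈ x then Complex.exp (Complex.I * (Real.pi / 4)) else 1)

/-- Flip the value of qubit `q` in a computational basis state. -/
def flip (q : ℕ) (x : Finset ℕ) : Finset ℕ := if q ∈ x then x.erase q else insert q x

/-- `CNOT` with control qubit `c` and target qubit `t` (no operation if `c = t`). -/
def cnotGate (c t : ℕ) : QState →ₗ[ℂ] QState :=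
  Finsupp.linearCombination ℂ fun x : Finset ℕ =>
    Finsupp.single (if c ∈ x ∧ c ≠ t then flip t x else x) 1

/-- The projection onto the subspace where qubit `q` has the value `v`. -/
def proj (q : ℕ) (v : Bool) (ψ : QState) : QState := ψ.filter fun x => (q ∈ x ↔ v = true)

/-- Unit vectors, i.e. pure states. -/
abbrev PureState : Type := {ψ : QState // weight ψ = 1}

/-- All qubits are `0`. -/
def zeroState : PureState :=
  ⟨Finsupp.single ∅ 1, by simp [weight]⟩

/-! ## Quantum programs -/

/-- Programs for a classical random access machine that controls a quantum memory.
The machine has registers `0, 1, 2, …` holding natural numbers (a program mentions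
finitely many of them); register operands of quantum instructions contain the *addresses* of
the qubits that are acted upon. Loops are of the form "repeat as often as the number that
register `r` contains on entry"; a machine with a polynomial time bound can be written in
this form, the bound serving as the number of repetitions of its single step. Each instruction
lengthens the numbers by at most one bit beyond a constant, so that polynomially many
instructions amount to polynomial time on a Turing machine that controls a quantum memory,
i.e. to uniform polynomial-size circuits over the universal gate set Hadamard, `T`, `CNOT`. -/
inductive Prog : Type
  | skip : Prog
  /-- `r := k` -/
  | const (r k : ℕ) : Prog
  /-- `r := a + b` -/
  | add (r a b : ℕ) : Prog
  /-- `r := max (a - b) 0` -/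
  | sub (r a b : ℕ) : Prog
  /-- `r := ⌊a / 2⌋` -/
  | half (r a : ℕ) : Prog
  /-- `r :=` the number of binary digits of `a` -/
  | size (r a : ℕ) : Prog
  /-- Hadamard gate on the qubit whose address is in register `a` -/
  | had (a : ℕ) : Prog
  /-- `T` gate on the qubit whose address is in register `a` -/
  | phase (a : ℕ) : Prog
  /-- `CNOT`; the addresses of control and target are in registers `a` and `b` -/
  | cnot (a b : ℕ) : Prog
  /-- measure the qubit whose address is in register `a` in the computational basis and write
  the outcome to register `r` -/
  | measure (r a : ℕ) : Prog
  | seq (c d : Prog) : Prog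
  /-- if register `r` contains `0` run `c`, otherwise run `d` -/
  | ifZero (r : ℕ) (c d : Prog) : Prog
  | loop (r : ℕ) (c : Prog) : Prog

/-- One branch of an execution, i.e. one sequence of measurement outcomes: the contents of
the registers, the unnormalised state of the quantum memory (its squared norm is the probability
of the branch), and the number of steps carried out. -/
structure Branch : Type where
  store : ℕ → ℕ
  state : QState
  steps : ℕ

/-- Carry out one classical step that writes `v` to register `r`. -/
def Branch.write (b : Branch) (r v : ℕ) : Branch :=
  ⟨Function.update b.store r v, b.state, b.steps + 1⟩

/-- Carry out one step that changes the state of the quantum memory to `ψ`. -/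
def Branch.evolve (b : Branch) (ψ : QState) : Branch := ⟨b.store, ψ, b.steps + 1⟩

/-- Execution of a program: the list of all branches that arise. Every instruction, every
test and every entry to a loop is one step. -/
def Prog.exec : Prog → Branch → List Branch
  | .skip, b => [b.evolve b.state]
  | .const r k, b => [b.write r k]
  | .add r x y, b => [b.write r (b.store x + b.store y)]
  | .sub r x y, b => [b.write r (b.store x - b.store y)]
  | .half r x, b => [b.write r (b.store x / 2)]
  | .size r x, b => [b.write r (Nat.size (b.store x))]
  | .had x, b => [b.evolve (hGate (b.store x) b.state)]
  | .phase x, b => [b.evolve (tGate (b.store x) b.state)]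
  | .cnot x y, b => [b.evolve (cnotGate (b.store x) (b.store y) b.state)]
  | .measure r x, b =>
      [⟨Function.update b.store r 0, proj (b.store x) false b.state, b.steps + 1⟩,
       ⟨Function.update b.store r 1, proj (b.store x) true b.state, b.steps + 1⟩]
  | .seq c d, b => (c.exec b).flatMap d.exec
  | .ifZero r c d, b =>
      if b.store r = 0 then c.exec (b.evolve b.state) else d.exec (b.evolve b.state)
  | .loop r c, b => (fun l : List Branch => l.flatMap c.exec)^[b.store r] [b.evolve b.state]

/-! ### Probabilities add up to one -/

theorem summable_weight (ψ : QState) : Summable fun x => ‖ψ x‖ ^ 2 :=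
  summable_of_hasFiniteSupport <| ψ.support.finite_toSet.subset fun x hx => by
    simp only [Function.mem_support] at hx
    simp only [Finset.mem_coe, Finsupp.mem_support_iff]
    intro h; simp [h] at hx

theorem weight_eq_tsum (ψ : QState) : weight ψ = ∑' x, ‖ψ x‖ ^ 2 := by
  rw [weight, Finsupp.sum, tsum_eq_sum]
  intro x hx
  simp [Finsupp.notMem_support_iff.mp hx]

theorem weight_nonneg (ψ : QState) : 0 ≤ weight ψ := by
  rw [weight_eq_tsum]; exact tsum_nonneg fun _ => by positivity

theorem flip_flip (q : ℕ) (x : Finset ℕ) : flip q (flip q x) = x := by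
  by_cases h : q ∈ x <;> simp [flip, h]

theorem mem_flip_of_ne {c t : ℕ} (h : c ≠ t) (x : Finset ℕ) : c ∈ flip t x ↔ c ∈ x := by
  by_cases ht : t ∈ x <;> simp [flip, ht, h]

theorem hGate_apply (q : ℕ) (ψ : QState) (y : Finset ℕ) :
    hGate q ψ y = (Real.sqrt 2 : ℂ)⁻¹ *
      ((if q ∈ y then -ψ y else ψ y) + ψ (flip q y)) := by
  induction ψ using Finsupp.induction_linear with
  | zero => simp
  | add f g hf hg =>
    rw [map_add, Finsupp.add_apply, hf, hg]
    split_ifs <;> simp <;> ring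
  | single x a =>
    simp only [hGate, Finsupp.linearCombination_single, Finsupp.smul_apply, Finsupp.add_apply,
      smul_eq_mul, Finsupp.single_apply, flip]
    by_cases hy : q ∈ y
    · have e1 : ¬ (x.erase q = y) := by rintro rfl; simp at hy
      by_cases hx : q ∈ x
      · have e2 : ¬ (x = y.erase q) := by rintro rfl; simp at hx
        by_cases e : x = y
        · subst e; simp [hy, e1, e2]; ring
        · simp [hx, hy, e1, e2, e]
      · have e2 : ¬ (x = y) := by rintro rfl; exact hx hy
        have e3 : insert q x = y ↔ x = y.erase q := by
          constructor
          · rintro rfl; simp [hx]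
          · rintro rfl; simp [hy]
        by_cases e : x = y.erase q
        · simp [hy, e]; ring
        · simp [hx, hy, e2, e3, e]
    · have e1 : ¬ (insert q x = y) := by rintro rfl; simp at hy
      by_cases hx : q ∈ x
      · have e2 : ¬ (x = y) := by rintro rfl; exact hy hx
        have e3 : x.erase q = y ↔ x = insert q y := by
          constructor
          · rintro rfl; simp [hx]
          · rintro rfl; simp [hy]
        by_cases e : x = insert q y
        · have : ¬ (insert q y = y) := by intro h; exact hy (h ▸ Finset.mem_insert_self q y)
          simp [hy, e, this]; ring
        · simp [hx, hy, e2, e3, e]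
      · have e2 : ¬ (x = insert q y) := by rintro rfl; simp at hx
        by_cases e : x = y
        · subst e; simp [hy, e2]; ring
        · simp [hx, hy, e1, e2, e]

theorem weight_hGate (q : ℕ) (ψ : QState) : weight (hGate q ψ) = weight ψ := by
  have key : ∀ φ : QState, 2 * weight φ = ∑' x, (‖φ x‖ ^ 2 + ‖φ (flip q x)‖ ^ 2) := by
    intro φ
    have inv : Function.Involutive (flip q) := flip_flip q
    have h2 := Equiv.tsum_eq inv.toPerm (fun x : Finset ℕ => (‖φ x‖ ^ 2 : ℝ))
    have hs := (Equiv.summable_iff inv.toPerm (f := fun x : Finset ℕ => (‖φ x‖ ^ 2 : ℝ))).mpr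
      (summable_weight φ)
    simp only [Function.Involutive.coe_toPerm, Function.comp_def] at h2 hs
    rw [(summable_weight φ).tsum_add hs, h2, weight_eq_tsum]; ring
  have h : 2 * weight (hGate q ψ) = 2 * weight ψ := by
    rw [key, key]
    refine tsum_congr fun x => ?_
    have par := parallelogram_law_with_norm ℝ (ψ x) (ψ (flip q x))
    have hn : ‖((Real.sqrt 2 : ℂ)⁻¹)‖ ^ 2 = 1 / 2 := by
      rw [norm_inv, Complex.norm_real, inv_pow, Real.norm_eq_abs, sq_abs,
        Real.sq_sqrt (by norm_num)]
      norm_num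
    rw [hGate_apply, hGate_apply, flip_flip, norm_mul, norm_mul, mul_pow, mul_pow, hn]
    by_cases hx : q ∈ x
    · have hf : q ∉ flip q x := by simp [flip, hx]
      rw [if_pos hx, if_neg hf]
      have h1 : ‖-ψ x + ψ (flip q x)‖ = ‖ψ x - ψ (flip q x)‖ := by
        rw [← norm_neg]; congr 1; ring
      rw [h1, add_comm (ψ (flip q x))]
      nlinarith
    · have hf : q ∈ flip q x := by simp [flip, hx]
      rw [if_neg hx, if_pos hf]
      have h1 : ‖-ψ (flip q x) + ψ x‖ = ‖ψ x - ψ (flip q x)‖ := by congr 1; ring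
      rw [h1]
      nlinarith
  linarith

theorem tGate_apply (q : ℕ) (ψ : QState) (y : Finset ℕ) :
    tGate q ψ y = (if q ∈ y then Complex.exp (Complex.I * (Real.pi / 4)) else 1) * ψ y := by
  induction ψ using Finsupp.induction_linear with
  | zero => simp
  | add f g hf hg => rw [map_add, Finsupp.add_apply, hf, hg, Finsupp.add_apply]; ring
  | single x a =>
    simp only [tGate, Finsupp.linearCombination_single, Finsupp.smul_apply, smul_eq_mul,
      Finsupp.single_apply]
    by_cases e : x = y
    · subst e; simp [mul_comm]
    · simp [e]

theorem weight_tGate (q : ℕ) (ψ : QState) : weight (tGate q ψ) = weight ψ := by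
  rw [weight_eq_tsum, weight_eq_tsum]
  refine tsum_congr fun x => ?_
  have h : ‖Complex.exp (Complex.I * (Real.pi / 4))‖ = 1 := by
    have := Complex.norm_exp_I_mul_ofReal (Real.pi / 4)
    push_cast at this
    exact this
  rw [tGate_apply, norm_mul]
  split_ifs <;> simp [h]

theorem cnotGate_apply (c t : ℕ) (ψ : QState) (y : Finset ℕ) :
    cnotGate c t ψ y = ψ (if c ∈ y ∧ c ≠ t then flip t y else y) := by
  induction ψ using Finsupp.induction_linear with
  | zero => simp
  | add f g hf hg => rw [map_add, Finsupp.add_apply, hf, hg, Finsupp.add_apply]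
  | single x a =>
    simp only [cnotGate, Finsupp.linearCombination_single, Finsupp.smul_apply, smul_eq_mul,
      Finsupp.single_apply]
    have h : ((if c ∈ x ∧ c ≠ t then flip t x else x) = y) ↔
        (x = if c ∈ y ∧ c ≠ t then flip t y else y) := by
      constructor
      · rintro rfl
        by_cases h : c ∈ x ∧ c ≠ t
        · rw [if_pos h, if_pos ⟨(mem_flip_of_ne h.2 x).mpr h.1, h.2⟩, flip_flip]
        · simp only [if_neg h]
      · rintro rfl
        by_cases h : c ∈ y ∧ c ≠ t
        · rw [if_pos h, if_pos ⟨(mem_flip_of_ne h.2 y).mpr h.1, h.2⟩, flip_flip]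
        · simp only [if_neg h]
    simp [h]

theorem weight_cnotGate (c t : ℕ) (ψ : QState) : weight (cnotGate c t ψ) = weight ψ := by
  have inv : Function.Involutive
      (fun x : Finset ℕ => if c ∈ x ∧ c ≠ t then flip t x else x) := by
    intro x
    by_cases h : c ∈ x ∧ c ≠ t
    · simp only [if_pos h]
      rw [if_pos ⟨(mem_flip_of_ne h.2 x).mpr h.1, h.2⟩, flip_flip]
    · simp only [if_neg h]
  rw [weight_eq_tsum, weight_eq_tsum, ← inv.toPerm.tsum_eq (fun x => ‖ψ x‖ ^ 2)]
  exact tsum_congr fun x => by rw [cnotGate_apply]; rfl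

theorem weight_proj (q : ℕ) (ψ : QState) :
    weight (proj q false ψ) + weight (proj q true ψ) = weight ψ := by
  rw [weight_eq_tsum, weight_eq_tsum, weight_eq_tsum,
    ← (summable_weight _).tsum_add (summable_weight _)]
  refine tsum_congr fun x => ?_
  by_cases h : q ∈ x <;> simp [proj, h]

/-- The sum of the probabilities of a list of branches. -/
def totalWeight (l : List Branch) : ℝ := (l.map fun b => weight b.state).sum

theorem totalWeight_flatMap (f : Branch → List Branch)
    (hf : ∀ b, totalWeight (f b) = weight b.state) (l : List Branch) :
    totalWeight (l.flatMap f) = totalWeight l := by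
  induction l with
  | nil => rfl
  | cons b l ih =>
    have h := hf b
    simp only [totalWeight] at h ih ⊢
    simp only [List.flatMap_cons, List.map_append, List.sum_append, List.map_cons,
      List.sum_cons, h, ih]

theorem totalWeight_exec (c : Prog) : ∀ b, totalWeight (c.exec b) = weight b.state := by
  induction c with
  | had x => intro b; simp [Prog.exec, totalWeight, Branch.evolve, weight_hGate]
  | phase x => intro b; simp [Prog.exec, totalWeight, Branch.evolve, weight_tGate]
  | cnot x y => intro b; simp [Prog.exec, totalWeight, Branch.evolve, weight_cnotGate]
  | measure r x => intro b; simp [Prog.exec, totalWeight, weight_proj]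
  | seq c d hc hd =>
    intro b
    rw [Prog.exec, totalWeight_flatMap _ hd, hc]
  | ifZero r c d hc hd =>
    intro b
    rw [Prog.exec]
    split_ifs
    · exact hc _
    · exact hd _
  | loop r c hc =>
    intro b
    rw [Prog.exec]
    have h : ∀ (k : ℕ) (l : List Branch),
        totalWeight ((fun l : List Branch => l.flatMap c.exec)^[k] l) = totalWeight l := by
      intro k
      induction k with
      | zero => intro l; rfl
      | succ k ih => intro l; rw [Function.iterate_succ_apply, ih, totalWeight_flatMap _ hc]
    rw [h]
    simp [totalWeight, Branch.evolve]
  | _ => intro b; simp [Prog.exec, totalWeight, Branch.write, Branch.evolve]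

theorem sum_branches (c : Prog) (σ : ℕ → ℕ) (ψ : PureState) :
    ∑ i : Fin (c.exec ⟨σ, ψ.1, 0⟩).length,
      ENNReal.ofReal (weight (c.exec ⟨σ, ψ.1, 0⟩)[i].state) = 1 := by
  rw [← ENNReal.ofReal_sum_of_nonneg fun i _ => weight_nonneg _]
  have h := totalWeight_exec c ⟨σ, ψ.1, 0⟩
  rw [totalWeight, ψ.2] at h
  rw [← Fin.sum_univ_fun_getElem] at h
  simpa using congrArg ENNReal.ofReal h

/-! ### Running a program -/

/-- The registers at the start: register `0` contains `n` (the security parameter), register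
`1` the input string `x`, all others contain `0`. -/
def inputStore (n : ℕ) (x : Str) : ℕ → ℕ := fun r =>
  if r = 0 then n else if r = 1 then code x else 0

/-- The distribution of the final contents of the registers when `c` is run with parameter `n`
on the classical input `x` and with quantum memory initially in the state `ψ`. -/
def Prog.run (c : Prog) (n : ℕ) (x : Str) (ψ : PureState) : PMF (ℕ → ℕ) :=
  (PMF.ofFintype (fun i : Fin (c.exec ⟨inputStore n x, ψ.1, 0⟩).length =>
      ENNReal.ofReal (weight (c.exec ⟨inputStore n x, ψ.1, 0⟩)[i].state))
    (sum_branches c (inputStore n x) ψ)).map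
    fun i => (c.exec ⟨inputStore n x, ψ.1, 0⟩)[i].store

/-- Quantum polynomial time: the number of steps is bounded by a polynomial in the security
parameter (as a number, not in its binary length) and the length of the classical input. -/
def Prog.IsQPT (c : Prog) : Prop :=
  ∃ P : Polynomial ℕ, ∀ (n : ℕ) (x : Str) (ψ : PureState),
    ∀ b ∈ c.exec ⟨inputStore n x, ψ.1, 0⟩, b.steps ≤ P.eval (n + x.length)

/-- Output one string: the one in register `0`. -/
def Prog.outStr (c : Prog) (n : ℕ) (x : Str) (ψ : PureState) : PMF Str :=
  (c.run n x ψ).map fun σ => decode (σ 0)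

/-- Output a pair of strings: those in registers `0` and `1`. -/
def Prog.outPair (c : Prog) (n : ℕ) (x : Str) (ψ : PureState) : PMF (Str × Str) :=
  (c.run n x ψ).map fun σ => (decode (σ 0), decode (σ 1))

/-- Output a non-negative rational number: numerator in register `0`, denominator in
register `1`. -/
def Prog.outNum (c : Prog) (n : ℕ) (x : Str) (ψ : PureState) : PMF ℚ :=
  (c.run n x ψ).map fun σ => (σ 0 : ℚ) / (σ 1 : ℚ)

/-- Advice ensembles `(|τ_n⟩)_n`: the `n`-th state is a state of polynomially many qubits
(all other qubits of the memory are `0`). -/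
def IsAdvice (τ : ℕ → PureState) : Prop :=
  ∃ m : Polynomial ℕ, ∀ n, ∀ x ∈ (τ n).1.support, ∀ q ∈ x, q < m.eval n

/-! ## Puzzles and hardness of approximating probabilities -/

/-- Statistical distance. -/
def statDist {α : Type} (p q : PMF α) : ℝ := (1 / 2) * ∑' a, |(p a).toReal - (q a).toReal|

/-- `Samp` is an `ε`-distributional one-way puzzle. -/
def IsDistributionalOneWayPuzzle (ε : ℕ → ℝ) (Samp : ℕ → PMF (Str × Str)) : Prop :=
  (∃ c : Prog, c.IsQPT ∧ ∀ n, Samp n = c.outPair n [] zeroState) ∧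
  ∀ A : Prog, A.IsQPT → ∀ τ : ℕ → PureState, IsAdvice τ →
    ∀ᶠ n in Filter.atTop,
      statDist (Samp n)
        ((Samp n).bind fun sk => (A.outStr n sk.1 (τ n)).map fun k => (sk.1, k)) ≥ ε n

/-- `D` is a uniformly efficiently sampleable family of distributions over strings. -/
def EfficientlySampleable (D : ℕ → PMF Str) : Prop :=
  ∃ c : Prog, c.IsQPT ∧ ∀ n, D n = c.outStr n [] zeroState

/-- The probability, over `x ← D n` and the randomness of the algorithm `A` with advice
`ψ`, that the number output by `A` on `x` differs from `Pr[D n = x]` by at most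
`Pr[D n = x] / t`. -/
def approxProb (D : ℕ → PMF Str) (A : Prog) (ψ : PureState) (n : ℕ) (t : ℝ) : ℝ :=
  (((D n).bind fun x => (A.outNum n x ψ).map fun y => (x, y)).toOuterMeasure
    {xy : Str × ℚ | |(xy.2 : ℝ) - (D n xy.1).toReal| ≤ (D n xy.1).toReal / t}).toReal

/-- `D` is an efficiently sampleable family with native approximation hardness. -/
def NativeApproximationHard (D : ℕ → PMF Str) : Prop :=
  EfficientlySampleable D ∧
  ∃ p : Polynomial ℕ, p ≠ 0 ∧
    ∀ A : Prog, A.IsQPT → ∀ τ : ℕ → PureState, IsAdvice τ →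
      ∀ᶠ n in Filter.atTop,
        approxProb D A (τ n) n ((p.eval n : ℕ) : ℝ) ≤ 1 - 1 / ((p.eval n : ℕ) : ℝ)

end QuantumPuzzle

end

/-! The idea is self-reduction of sampling to probability estimation, made robust by noise. A puzzle
and its key are read as numbers `s` and `k`, the key as a string of `R = keyLen d n` bits, where `R`
is a power of two of polynomial size. The hard distribution (`samplerDist`) consists of `s` and a
prefix of `k` of uniformly random length between 1 and `R`, whose last bit is flipped with
probability 1/4. A leading 1 in front of the key marks the length of the prefix.

Suppose that an algorithm with advice approximates these probabilities well. Given `s`, an adversary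
builds a key bit by bit: for the current prefix `w` it estimates the probabilities of `(s, 2w)` and
`(s, 2w+1)` and draws the next bit accordingly. If `m₀`, `m₁` are the probabilities of the two
unflipped extensions, the sampled strings have probabilities `(m₁ + 3m₀)/(4R)` and `(m₀ + 3m₁)/(4R)`
(`samplerDist_apply`). The share of the second is `1/4 + x/2` with `x = m₁/(m₀+m₁)`, so `x` can be
recovered from it, and relative errors `1/p` in the estimates become an additive error at most `2/p`
in `x` (`le_mul_card_nextBit`).

The noise is there because the approximation may fail on rare strings. Without it, an improbable
extension could be badly overestimated at no cost in average success. With it, both extensions of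
`w` are sampled with probability at least `1/(4R)` times that of `w` (`prefixDist_le_samplerDist`),
so failures on either are charged to the average failure probability. This bounds the error of one
bit (`tv_prefixDist_succ_le`); a hybrid argument over `R` bits (`tv_advDist_le`) and the choice of
`p` of order `R³` (`error_lt`) give statistical distance below `1/q`, which contradicts the puzzle.

The rest of the work is to realise sampler and adversary as programs. An estimation may destroy its
advice, so the adversary receives `2R` copies. Qubit addresses are split by residue modulo `2R + 1`:
part 0 holds a coin qubit and each call runs on its own part (`exec_embed`, `yields_callProg`).
`Yields` is a program logic that tracks output distributions and step counts, and `Fresh` says which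
copies are still unspent. -/

noncomputable section
namespace QuantumPuzzle
open scoped ENNReal

/-! ## Splitting the quantum memory into parts -/

/-- The qubits of `x` with addresses `N * q + j`, renumbered by `q`. -/
def part (N j : ℕ) (x : Finset ℕ) : Finset ℕ := (x.filter fun a => a % N = j).image (· / N)

/-- The qubits of `x` outside the `j`-th part. -/
def rest (N j : ℕ) (x : Finset ℕ) : Finset ℕ := x.filter fun a => a % N ≠ j

theorem mem_part {N j : ℕ} (hj : j < N) (x : Finset ℕ) (q : ℕ) :
    q ∈ part N j x ↔ N * q + j ∈ x := by
  simp only [part, Finset.mem_image, Finset.mem_filter]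
  constructor
  · rintro ⟨a, ⟨h, h1⟩, rfl⟩
    rwa [← h1, Nat.div_add_mod]
  · intro h
    refine ⟨_, ⟨h, ?_⟩, ?_⟩
    · rw [Nat.mul_add_mod, Nat.mod_eq_of_lt hj]
    · rw [Nat.mul_add_div (by omega), Nat.div_eq_of_lt hj, add_zero]

theorem mem_rest {N j : ℕ} (x : Finset ℕ) (a : ℕ) : a ∈ rest N j x ↔ a ∈ x ∧ a % N ≠ j := by
  simp [rest]

theorem mem_flip (q r : ℕ) (x : Finset ℕ) :
    r ∈ flip q x ↔ if r = q then q ∉ x else r ∈ x := by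
  unfold flip
  by_cases h : q ∈ x <;> by_cases e : r = q <;> simp_all

theorem part_flip {N j : ℕ} (hj : j < N) (a : ℕ) (x : Finset ℕ) :
    part N j (flip (N * a + j) x) = flip a (part N j x) := by
  ext q
  have : N * q + j = N * a + j ↔ q = a := by
    have hN : 0 < N := by omega
    simp [hN.ne']
  simp only [mem_part hj, mem_flip, this]

theorem part_flip_of_ne {N j : ℕ} (hj : j < N) {a : ℕ} (ha : a % N ≠ j) (x : Finset ℕ) :
    part N j (flip a x) = part N j x := by
  ext q
  have : N * q + j ≠ a := by
    rintro rfl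
    rw [Nat.mul_add_mod, Nat.mod_eq_of_lt hj] at ha
    exact ha rfl
  simp only [mem_part hj, mem_flip, this, if_false]

theorem rest_flip {N j : ℕ} (hj : j < N) (a : ℕ) (x : Finset ℕ) :
    rest N j (flip (N * a + j) x) = rest N j x := by
  ext q
  simp only [mem_rest, mem_flip]
  by_cases e : q = N * a + j
  · subst e
    simp [Nat.mod_eq_of_lt hj]
  · simp [e]

theorem part_rest {N i j : ℕ} (hi : i < N) (h : i ≠ j) (x : Finset ℕ) :
    part N i (rest N j x) = part N i x := by
  ext q
  simp [mem_part hi, mem_rest, Nat.mod_eq_of_lt hi, h]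

/-- A set of qubits is given by its `j`-th part and the rest. -/
def partEquiv {N j : ℕ} (hj : j < N) :
    Finset ℕ ≃ Finset ℕ × {y : Finset ℕ // rest N j y = y} where
  toFun x := (part N j x, ⟨rest N j x, by simp [rest]⟩)
  invFun p := p.1.image (fun q => N * q + j) ∪ p.2.1
  left_inv x := by
    ext a
    simp only [Finset.mem_union, Finset.mem_image, mem_part hj, mem_rest]
    constructor
    · rintro (⟨q, h, rfl⟩ | h)
      exacts [h, h.1]
    · intro h
      by_cases e : a % N = j
      · exact Or.inl ⟨a / N, by rw [← e, Nat.div_add_mod]; exact ⟨h, rfl⟩⟩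
      · exact Or.inr ⟨h, e⟩
  right_inv := by
    rintro ⟨a, y, hy⟩
    have hmod : ∀ q, (N * q + j) % N = j := fun q => by
      rw [Nat.mul_add_mod, Nat.mod_eq_of_lt hj]
    have hN : N ≠ 0 := by omega
    have hy' : ∀ r ∈ y, r % N ≠ j := fun r hr => by
      rw [← hy, mem_rest] at hr
      exact hr.2
    refine Prod.ext ?_ (Subtype.ext ?_)
    · ext q
      simp only [mem_part hj, Finset.mem_union, Finset.mem_image]
      constructor
      · rintro (⟨q', h, e⟩ | h)
        · have : q' = q := by simpa [hN] using e
          exact this ▸ h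
        · exact absurd (hmod q) (hy' _ h)
      · exact fun h => Or.inl ⟨q, h, rfl⟩
    · ext r
      simp only [mem_rest, Finset.mem_union, Finset.mem_image]
      constructor
      · rintro ⟨⟨q', h, rfl⟩ | h, h2⟩
        · exact absurd (hmod q') h2
        · exact h
      · exact fun h => ⟨Or.inr h, hy' r h⟩

/-- Tonelli along `partEquiv`. The second sum runs only over sets that avoid part `j`, so that each
value of `rest` is counted once. -/
theorem tsum_part_mul_rest {N j : ℕ} (hj : j < N) (f g : Finset ℕ → ℝ≥0∞) :
    ∑' x, f (part N j x) * g (rest N j x)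
      = (∑' a, f a) * ∑' y : {y : Finset ℕ // rest N j y = y}, g y := by
  rw [← (partEquiv hj).symm.tsum_eq, ENNReal.tsum_prod', ← ENNReal.tsum_mul_right]
  refine tsum_congr fun a => ?_
  rw [← ENNReal.tsum_mul_left]
  refine tsum_congr fun y => ?_
  have h := (partEquiv hj).right_inv (a, y)
  have h1 : part N j ((partEquiv hj).symm (a, y)) = a := congrArg Prod.fst h
  have h2 : rest N j ((partEquiv hj).symm (a, y)) = y.1 :=
    congrArg (fun p => (Prod.snd p).1) h
  rw [h1, h2]

/-- The squared norm of a state as an extended non-negative number. -/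
def wt (ψ : QState) : ℝ≥0∞ := ENNReal.ofReal (weight ψ)

theorem wt_eq_tsum (ψ : QState) : wt ψ = ∑' x, ‖ψ x‖ₑ ^ 2 := by
  rw [wt, weight_eq_tsum, ENNReal.ofReal_tsum_of_nonneg (fun _ => by positivity)
    (summable_weight ψ)]
  refine tsum_congr fun x => ?_
  rw [ENNReal.ofReal_pow (norm_nonneg _), ofReal_norm]

theorem wt_coe (ψ : PureState) : wt ψ.1 = 1 := by simp [wt, ψ.2]

/-- Both product states share the factor `G`, whose squared norm is the weight of `ψ` because `τ` is
normalised. Hence a branch on one part occurs with the same conditional probability inside the whole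
memory. -/
theorem wt_product {N j : ℕ} (hj : j < N) {τ φ ψ ψ' : QState} {G : Finset ℕ → ℂ}
    (hτ : wt τ = 1) (hψ : ∀ x, ψ x = τ (part N j x) * G (rest N j x))
    (hψ' : ∀ x, ψ' x = φ (part N j x) * G (rest N j x)) :
    wt ψ' = wt φ * wt ψ := by
  have key : ∀ α β : QState, (∀ x, β x = α (part N j x) * G (rest N j x)) →
      wt β = wt α * ∑' y : {y : Finset ℕ // rest N j y = y}, ‖G y‖ₑ ^ 2 := by
    intro α β h
    rw [wt_eq_tsum, wt_eq_tsum, ← tsum_part_mul_rest hj (fun a => ‖α a‖ₑ ^ 2)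
      (fun y => ‖G y‖ₑ ^ 2)]
    refine tsum_congr fun x => ?_
    rw [h, enorm_mul, mul_pow]
  rw [key φ ψ' hψ', key τ ψ hψ, hτ, one_mul]

/-! ## Unused copies of a state -/

/-- The parts `j, …, N - 1` of the memory are in the product state `τ ⊗ ⋯ ⊗ τ`. -/
def Fresh (N j : ℕ) (τ ψ : QState) : Prop :=
  ∃ g : Finset ℕ → ℂ, ∀ x, ψ x =
    g (x.filter fun a => a % N < j) * ∏ i ∈ Finset.Ico j N, τ (part N i x)

/-- The next unused copy is a tensor factor, and whatever it is turned into, the copies after it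
stay unused. This is what allows one call per copy. -/
theorem Fresh.split {N j : ℕ} {τ ψ : QState} (h : Fresh N j τ ψ) (hj : j < N) :
    ∃ G : Finset ℕ → ℂ, (∀ x, ψ x = τ (part N j x) * G (rest N j x)) ∧
      ∀ φ ψ' : QState, (∀ x, ψ' x = φ (part N j x) * G (rest N j x)) →
        Fresh N (j + 1) τ ψ' := by
  obtain ⟨g, hg⟩ := h
  have h1 : ∀ x : Finset ℕ, (rest N j x).filter (fun a => a % N < j)
      = x.filter fun a => a % N < j := by
    intro x
    ext a
    simp only [Finset.mem_filter, mem_rest]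
    constructor
    · exact fun h => ⟨h.1.1, h.2⟩
    · exact fun h => ⟨⟨h.1, by omega⟩, h.2⟩
  have h2 : ∀ x : Finset ℕ, ∏ i ∈ Finset.Ico (j + 1) N, τ (part N i (rest N j x))
      = ∏ i ∈ Finset.Ico (j + 1) N, τ (part N i x) := by
    intro x
    refine Finset.prod_congr rfl fun i hi => ?_
    rw [Finset.mem_Ico] at hi
    rw [part_rest hi.2 (by omega)]
  refine ⟨fun y => g (y.filter fun a => a % N < j)
    * ∏ i ∈ Finset.Ico (j + 1) N, τ (part N i y), fun x => ?_, fun φ ψ' h => ?_⟩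
  · beta_reduce
    rw [h1, h2, hg, ← Finset.prod_Ioo_mul_eq_prod_Ico hj]
    have : Finset.Ioo j N = Finset.Ico (j + 1) N := by ext; simp
    rw [this]
    ring
  -- The spent part `j` joins the arbitrary factor on the parts below `j + 1`.
  · refine ⟨fun y => φ (part N j y) * g (y.filter fun a => a % N < j), fun x => ?_⟩
    have h3 : part N j (x.filter fun a => a % N < j + 1) = part N j x := by
      ext q
      simp [mem_part hj, Nat.mod_eq_of_lt hj]
    have h4 : (x.filter fun a => a % N < j + 1).filter (fun a => a % N < j)
        = x.filter fun a => a % N < j := by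
      ext a
      simp only [Finset.mem_filter]
      constructor
      · exact fun h => ⟨h.1.1, h.2⟩
      · exact fun h => ⟨⟨h.1, by omega⟩, h.2⟩
    rw [h]
    beta_reduce
    rw [h1, h2, h3, h4]
    ring

theorem filter_flip_eq {N j a : ℕ} (x : Finset ℕ) (ha : a % N < j) :
    (flip a x).filter (fun a => a % N < j) = flip a (x.filter fun a => a % N < j) := by
  ext r
  simp only [Finset.mem_filter, mem_flip]
  by_cases e : r = a
  · subst e; simp [ha]
  · simp [e]

theorem prod_part_flip {N j a : ℕ} (τ : QState) (x : Finset ℕ) (ha : a % N < j) :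
    ∏ i ∈ Finset.Ico j N, τ (part N i (flip a x)) = ∏ i ∈ Finset.Ico j N, τ (part N i x) := by
  refine Finset.prod_congr rfl fun i hi => ?_
  rw [Finset.mem_Ico] at hi
  rw [part_flip_of_ne hi.2 (by omega)]

/-- A gate on a qubit below part `j` acts on the arbitrary factor `g` alone, since flipping that
qubit leaves the parts from `j` on unchanged. -/
theorem Fresh.hGate {N j a : ℕ} {τ ψ : QState} (h : Fresh N j τ ψ) (ha : a % N < j) :
    Fresh N j τ (hGate a ψ) := by
  obtain ⟨g, hg⟩ := h
  refine ⟨fun y => (Real.sqrt 2 : ℂ)⁻¹ * ((if a ∈ y then -g y else g y) + g (flip a y)),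
    fun x => ?_⟩
  rw [hGate_apply, hg, hg, filter_flip_eq x ha, prod_part_flip τ x ha]
  simp only [Finset.mem_filter, ha, and_true]
  split_ifs <;> ring

theorem proj_apply (q : ℕ) (v : Bool) (ψ : QState) (x : Finset ℕ) :
    proj q v ψ x = if (q ∈ x ↔ v = true) then ψ x else 0 := by
  simp [proj, Finsupp.filter_apply]

theorem Fresh.proj {N j a : ℕ} {τ ψ : QState} (h : Fresh N j τ ψ) (ha : a % N < j) (v : Bool) :
    Fresh N j τ (proj a v ψ) := by
  obtain ⟨g, hg⟩ := h
  refine ⟨fun y => if (a ∈ y ↔ v = true) then g y else 0, fun x => ?_⟩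
  rw [proj_apply, hg]
  simp only [Finset.mem_filter, ha, and_true]
  split_ifs <;> simp

/-- After a measurement, a Hadamard gate makes the qubit uniformly random. -/
theorem wt_proj_hGate_proj (q : ℕ) (u v : Bool) (ψ : QState) :
    wt (proj q v (hGate q (proj q u ψ))) = 2⁻¹ * wt (proj q u ψ) := by
  have hn : ‖((Real.sqrt 2 : ℂ)⁻¹)‖ₑ ^ 2 = 2⁻¹ := by
    rw [← ofReal_norm, ← ENNReal.ofReal_pow (norm_nonneg _), norm_inv,
      Complex.norm_real, inv_pow, Real.norm_eq_abs, sq_abs, Real.sq_sqrt (by norm_num),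
      ENNReal.ofReal_inv_of_pos (by norm_num)]
    simp
  have inv : Function.Involutive (flip q) := flip_flip q
  have hf : ∀ x, (q ∈ flip q x) ↔ q ∉ x := fun x => by simp [mem_flip]
  rw [wt_eq_tsum, wt_eq_tsum, ← ENNReal.tsum_mul_left]
  -- After the projection only one of the amplitudes at `x` and `flip q x` can be nonzero, so
  -- nothing interferes and the Hadamard gate merely contributes a factor of modulus `1/√2`.
  have key : ∀ x, ‖proj q v (hGate q (proj q u ψ)) x‖ₑ ^ 2
      = if (q ∈ x ↔ v = true) then 2⁻¹ * ‖proj q u ψ (if u = v then x else flip q x)‖ₑ ^ 2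
        else 0 := by
    intro x
    rw [proj_apply]
    split_ifs with h1 h2
    · subst h2
      rw [hGate_apply, enorm_mul, mul_pow, hn, proj_apply q u ψ (flip q x)]
      simp only [hf]
      congr 2
      by_cases hq : q ∈ x <;> cases u <;> simp_all
    · rw [hGate_apply, enorm_mul, mul_pow, hn, proj_apply q u ψ x]
      congr 2
      by_cases hq : q ∈ x <;> cases u <;> cases v <;> simp_all
    · simp
  rw [tsum_congr key]
  by_cases h2 : u = v
  · subst h2
    refine tsum_congr fun x => ?_
    simp only [if_true, proj_apply q u ψ x]
    split_ifs <;> simp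
  · rw [← inv.toPerm.tsum_eq]
    refine tsum_congr fun x => ?_
    simp only [Function.Involutive.coe_toPerm, if_neg h2, flip_flip, hf, proj_apply]
    by_cases hq : q ∈ x <;> cases u <;> cases v <;> simp_all

/-! ### Existence of the state with many copies of the advice -/

/-- A function supported on the sets of qubits in the parts `j, …, N - 1`. -/
def copiesFun (N j : ℕ) (τ : QState) (x : Finset ℕ) : ℂ :=
  (if (x.filter fun a => a % N < j) = ∅ then 1 else 0) * ∏ i ∈ Finset.Ico j N, τ (part N i x)

/-- Downward induction on `j`: part `j` splits off as a factor of norm 1, and for `j = N` only the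
empty set contributes. -/
theorem tsum_copiesFun {N : ℕ} {τ : QState} (hτ : wt τ = 1) {j : ℕ} (hj : j ≤ N) (hN : 0 < N) :
    ∑' x, ‖copiesFun N j τ x‖ₑ ^ 2 = 1 := by
  induction hj using Nat.decreasingInduction with
  | self =>
    rw [tsum_eq_single ∅]
    · simp [copiesFun]
    · intro x hx
      have : x.filter (fun a => a % N < N) = x :=
        Finset.filter_true_of_mem fun a _ => Nat.mod_lt _ hN
      simp [copiesFun, this, hx]
  | of_succ j hj ih =>
    have h : ∀ x, ‖copiesFun N j τ x‖ₑ ^ 2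
        = ‖τ (part N j x)‖ₑ ^ 2 * ‖copiesFun N (j + 1) τ (rest N j x)‖ₑ ^ 2 := by
      intro x
      rw [← mul_pow, ← enorm_mul]
      congr 2
      have h1 : (rest N j x).filter (fun a => a % N < j + 1)
          = x.filter fun a => a % N < j := by
        ext a
        simp only [Finset.mem_filter, mem_rest]
        constructor
        · exact fun h => ⟨h.1.1, by omega⟩
        · exact fun h => ⟨⟨h.1, by omega⟩, by omega⟩
      have h2 : ∏ i ∈ Finset.Ico (j + 1) N, τ (part N i (rest N j x))
          = ∏ i ∈ Finset.Ico (j + 1) N, τ (part N i x) := by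
        refine Finset.prod_congr rfl fun i hi => ?_
        rw [Finset.mem_Ico] at hi
        rw [part_rest hi.2 (by omega)]
      have : Finset.Ioo j N = Finset.Ico (j + 1) N := by ext; simp
      rw [copiesFun, copiesFun, h1, h2, ← Finset.prod_Ioo_mul_eq_prod_Ico hj, this]
      ring
    rw [tsum_congr h, tsum_part_mul_rest hj (fun a => ‖τ a‖ₑ ^ 2)
      (fun y => ‖copiesFun N (j + 1) τ y‖ₑ ^ 2), ← wt_eq_tsum, hτ, one_mul, ← ih]
    -- The restriction to sets that avoid part `j` costs nothing, because the function vanishes on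
    -- sets that meet a part below `j + 1`.
    refine tsum_subtype_eq_of_support_subset (f := fun y => ‖copiesFun N (j + 1) τ y‖ₑ ^ 2)
      (s := {y | rest N j y = y}) ?_
    intro y hy
    rw [Function.mem_support, copiesFun] at hy
    have h3 : (y.filter fun a => a % N < j + 1) = ∅ := by
      by_contra h
      rw [if_neg h] at hy
      simp at hy
    rw [Finset.filter_eq_empty_iff] at h3
    refine Finset.filter_true_of_mem fun a ha => ?_
    have := h3 ha
    omega

/-- Address `a` is qubit `a / N` of part `a % N`, so `a / N < m`. Interleaving thus keeps the number
of qubits polynomial. -/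
theorem copiesFun_ne_zero {N j m : ℕ} {τ : QState} (hm : ∀ x ∈ τ.support, ∀ q ∈ x, q < m)
    (hN : 0 < N) {x : Finset ℕ} (h : copiesFun N j τ x ≠ 0) : ∀ a ∈ x, a < N * m := by
  intro a ha
  have h1 := left_ne_zero_of_mul h
  have h2 := right_ne_zero_of_mul h
  have h3 : (x.filter fun a => a % N < j) = ∅ := by
    by_contra h
    simp [h] at h1
  rw [Finset.filter_eq_empty_iff] at h3
  have h4 := h3 ha
  have hlt := Nat.mod_lt a hN
  have h5 := Finset.prod_ne_zero_iff.mp h2 (a % N) (Finset.mem_Ico.mpr ⟨by omega, hlt⟩)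
  have h6 := hm _ (Finsupp.mem_support_iff.mpr h5) (a / N) (by
    rw [mem_part hlt, Nat.div_add_mod]; exact ha)
  exact (Nat.div_lt_iff_lt_mul hN).mp h6 |>.trans_eq (mul_comm _ _)

theorem exists_forall_mem_lt (τ : QState) : ∃ m, ∀ x ∈ τ.support, ∀ q ∈ x, q < m :=
  ⟨(τ.support.sup fun x => x.sup id) + 1, fun _ hx _ hq => Nat.lt_succ_of_le <|
    (Finset.le_sup (f := id) hq).trans (Finset.le_sup (f := fun x => x.sup id) hx)⟩

/-- Copies of a state in the parts `1, …, N - 1` of the memory. -/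
theorem exists_copies (N : ℕ) (hN : 0 < N) (τ : PureState) : ∃ Ψ : PureState,
    Fresh N 1 τ.1 Ψ.1 ∧
      ∀ m, (∀ x ∈ τ.1.support, ∀ q ∈ x, q < m) → ∀ x ∈ Ψ.1.support, ∀ q ∈ x, q < N * m := by
  obtain ⟨m, hm⟩ := exists_forall_mem_lt τ.1
  let Ψ : QState := Finsupp.onFinset (Finset.range (N * m)).powerset (copiesFun N 1 τ.1)
    fun x hx => by
      rw [Finset.mem_powerset]
      exact fun a ha => Finset.mem_range.mpr (copiesFun_ne_zero hm hN hx a ha)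
  have hΨ : ∀ x, Ψ x = copiesFun N 1 τ.1 x := fun x => rfl
  have hw : wt Ψ = 1 := by
    rw [wt_eq_tsum, ← tsum_copiesFun (wt_coe τ) (show 1 ≤ N by omega) hN]
    exact tsum_congr fun x => by rw [hΨ]
  refine ⟨⟨Ψ, ?_⟩, ⟨fun y => if y = ∅ then 1 else 0, fun x => hΨ x⟩, fun m hm x hx => ?_⟩
  · rw [wt, ENNReal.ofReal_eq_one] at hw
    exact hw
  · rw [Finsupp.mem_support_iff, hΨ] at hx
    exact copiesFun_ne_zero hm hN hx

/-! ## Expectations -/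

/-- The expectation of a non-negative function. -/
def ev {α : Type} (κ : PMF α) (f : α → ℝ≥0∞) : ℝ≥0∞ := ∑' a, κ a * f a

theorem ev_pure {α : Type} (a : α) (f : α → ℝ≥0∞) : ev (PMF.pure a) f = f a := by
  rw [ev, tsum_eq_single a]
  · simp
  · intro b hb
    simp [hb]

theorem ev_bind {α β : Type} (κ : PMF α) (g : α → PMF β) (f : β → ℝ≥0∞) :
    ev (κ.bind g) f = ev κ fun a => ev (g a) f := by
  simp only [ev, PMF.bind_apply, ← ENNReal.tsum_mul_right, ← ENNReal.tsum_mul_left, mul_assoc]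
  rw [ENNReal.tsum_comm]

theorem ev_map {α β : Type} (κ : PMF α) (g : α → β) (f : β → ℝ≥0∞) :
    ev (κ.map g) f = ev κ fun a => f (g a) := by
  rw [← PMF.bind_pure_comp, ev_bind]
  simp [ev_pure]

theorem ev_const {α : Type} (κ : PMF α) (c : ℝ≥0∞) : ev κ (fun _ => c) = c := by
  rw [ev, ENNReal.tsum_mul_right, κ.tsum_coe, one_mul]

theorem ev_add {α : Type} (κ : PMF α) (f g : α → ℝ≥0∞) :
    ev κ (fun a => f a + g a) = ev κ f + ev κ g := by
  simp only [ev, mul_add, ENNReal.tsum_add]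

theorem ev_mul_left {α : Type} (κ : PMF α) (c : ℝ≥0∞) (f : α → ℝ≥0∞) :
    ev κ (fun a => c * f a) = c * ev κ f := by
  simp only [ev, ← ENNReal.tsum_mul_left]
  exact tsum_congr fun a => by ring

theorem ev_mono {α : Type} (κ : PMF α) {f g : α → ℝ≥0∞} (h : ∀ a, f a ≤ g a) :
    ev κ f ≤ ev κ g :=
  ENNReal.tsum_le_tsum fun a => by gcongr; exact h a

theorem ev_congr {α : Type} (κ : PMF α) {f g : α → ℝ≥0∞} (h : ∀ a, κ a ≠ 0 → f a = g a) :
    ev κ f = ev κ g :=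
  tsum_congr fun a => by
    by_cases ha : κ a = 0
    · simp [ha]
    · rw [h a ha]

theorem ev_single {α : Type} [DecidableEq α] (κ : PMF α) (a : α) :
    ev κ (fun x => if x = a then 1 else 0) = κ a := by
  rw [ev, tsum_eq_single a]
  · simp
  · intro b hb
    simp [hb]

theorem PMF_ext_ev {α : Type} {κ κ' : PMF α} (h : ∀ f, ev κ f = ev κ' f) : κ = κ' := by
  classical
  ext a
  rw [← ev_single κ a, h, ev_single]

/-! ## Outcomes of an execution -/

/-- The branches of `c` started in `b` can be labelled with outcomes such that the labels have the
distribution `κ` and every branch satisfies the postcondition `Q` for its label. -/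
def Yields {α : Type} (c : Prog) (b : Branch) (κ : PMF α) (Q : α → Branch → Prop) : Prop :=
  ∃ L : List (α × Branch), L.map Prod.snd = c.exec b ∧ (∀ p ∈ L, Q p.1 p.2) ∧
    ∀ f : α → ℝ≥0∞, (L.map fun p => wt p.2.state * f p.1).sum = wt b.state * ev κ f

theorem Yields.of_exec {α : Type} {c : Prog} {b b' : Branch} {y : α} {Q : α → Branch → Prop}
    (h : c.exec b = [b']) (hs : b'.state = b.state) (hQ : Q y b') :
    Yields c b (PMF.pure y) Q :=
  ⟨[(y, b')], by simp [h], by simpa using hQ, fun f => by simp [ev_pure, hs]⟩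

theorem Yields.forall {α : Type} {c : Prog} {b : Branch} {κ : PMF α} {Q : α → Branch → Prop}
    (h : Yields c b κ Q) : ∀ b' ∈ c.exec b, ∃ y, Q y b' := by
  obtain ⟨L, h1, h2, -⟩ := h
  intro b' hb'
  rw [← h1] at hb'
  obtain ⟨p, hp, rfl⟩ := List.mem_map.mp hb'
  exact ⟨_, h2 p hp⟩

/-- The common core of sequencing and looping: every branch is relabelled by the continuation, and
its weight multiplies the expectation that the continuation has from its label. -/
theorem yields_flatMap {α β : Type} {d : Prog} {κ : α → PMF β} {Q : α → Branch → Prop}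
    {Q' : β → Branch → Prop} (hd : ∀ y b, Q y b → Yields d b (κ y) Q') :
    ∀ L : List (α × Branch), (∀ p ∈ L, Q p.1 p.2) → ∃ L' : List (β × Branch),
      L'.map Prod.snd = (L.map Prod.snd).flatMap d.exec ∧ (∀ p ∈ L', Q' p.1 p.2) ∧
      ∀ f : β → ℝ≥0∞, (L'.map fun p => wt p.2.state * f p.1).sum
        = (L.map fun p => wt p.2.state * ev (κ p.1) f).sum := by
  intro L
  induction L with
  | nil => exact fun _ => ⟨[], by simp⟩
  | cons p L ih =>
    intro h
    obtain ⟨L1, a1, a2, a3⟩ := hd p.1 p.2 (h p (by simp))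
    obtain ⟨L2, b1, b2, b3⟩ := ih fun q hq => h q (by simp [hq])
    refine ⟨L1 ++ L2, by simp [a1, b1], ?_, fun f => by simp [a3, b3]⟩
    intro q hq
    rcases List.mem_append.mp hq with hq | hq
    exacts [a2 q hq, b2 q hq]

theorem Yields.seq {α β : Type} {c d : Prog} {b : Branch} {κ : PMF α} {κ' : α → PMF β}
    {Q : α → Branch → Prop} {Q' : β → Branch → Prop} (hc : Yields c b κ Q)
    (hd : ∀ y b', Q y b' → Yields d b' (κ' y) Q') : Yields (.seq c d) b (κ.bind κ') Q' := by
  obtain ⟨L, h1, h2, h3⟩ := hc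
  obtain ⟨L', a1, a2, a3⟩ := yields_flatMap hd L h2
  exact ⟨L', by rw [a1, h1, Prog.exec], a2, fun f => by
    rw [a3, h3 fun a => ev (κ' a) f, ev_bind]⟩

theorem exec_seq {c d : Prog} {b b' : Branch} (h : c.exec b = [b']) :
    (Prog.seq c d).exec b = d.exec b' := by
  simp [Prog.exec, h]

theorem Yields.seq_exec {α : Type} {c d : Prog} {b b' : Branch} {κ : PMF α}
    {Q : α → Branch → Prop} (hc : c.exec b = [b']) (hs : b'.state = b.state)
    (hd : Yields d b' κ Q) : Yields (.seq c d) b κ Q := by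
  obtain ⟨L, h1, h2, h3⟩ := hd
  exact ⟨L, by rw [exec_seq hc, h1], h2, fun f => by rw [h3, hs]⟩

/-- `k` steps of a Markov chain. -/
def chain {α : Type} (κ : α → PMF α) (k : ℕ) (y : α) : PMF α :=
  k.rec (PMF.pure y) fun _ μ => μ.bind κ

theorem chain_zero {α : Type} (κ : α → PMF α) (y : α) : chain κ 0 y = PMF.pure y := rfl

theorem chain_succ {α : Type} (κ : α → PMF α) (k : ℕ) (y : α) :
    chain κ (k + 1) y = (chain κ k y).bind κ := rfl

theorem exec_loop (r : ℕ) (c : Prog) (b : Branch) : (Prog.loop r c).exec b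
    = (fun l : List Branch => l.flatMap c.exec)^[b.store r] [b.evolve b.state] := rfl

/-- The invariant sees the iteration number and the current label. The kernel `κ` depends only on
the label, so the labels form a Markov chain. -/
theorem Yields.loop {α : Type} {r : ℕ} {c : Prog} {b : Branch} {κ : α → PMF α}
    (I : ℕ → α → Branch → Prop) {y : α} (h0 : I 0 y (b.evolve b.state))
    (h : ∀ i < b.store r, ∀ y b', I i y b' → Yields c b' (κ y) (I (i + 1))) :
    Yields (.loop r c) b (chain κ (b.store r) y) (I (b.store r)) := by
  have key : ∀ k ≤ b.store r, ∃ L : List (α × Branch), L.map Prod.snd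
      = (fun l : List Branch => l.flatMap c.exec)^[k] [b.evolve b.state] ∧
      (∀ p ∈ L, I k p.1 p.2) ∧ ∀ f : α → ℝ≥0∞, (L.map fun p => wt p.2.state * f p.1).sum
        = wt b.state * ev (chain κ k y) f := by
    intro k
    induction k with
    | zero =>
      exact fun _ => ⟨[(y, b.evolve b.state)], rfl, by simpa using h0, fun f => by
        simp [chain_zero, ev_pure, Branch.evolve]⟩
    | succ k ih =>
      intro hk
      obtain ⟨L, h1, h2, h3⟩ := ih (by omega)
      obtain ⟨L', a1, a2, a3⟩ := yields_flatMap (h k (by omega)) L h2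
      exact ⟨L', by rw [a1, h1, Function.iterate_succ_apply'], a2, fun f => by
        rw [a3, h3 fun a => ev (κ a) f, chain_succ, ev_bind]⟩
  exact key _ le_rfl

theorem exec_loop_eq {r k : ℕ} {c : Prog} {b : Branch} (B : ℕ → Branch) (hr : b.store r = k)
    (h0 : B 0 = b.evolve b.state) (h : ∀ i < k, c.exec (B i) = [B (i + 1)]) :
    (Prog.loop r c).exec b = [B k] := by
  have key : ∀ i ≤ k, (fun l : List Branch => l.flatMap c.exec)^[i] [b.evolve b.state]
      = [B i] := by
    intro i
    induction i with
    | zero => simp [h0]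
    | succ i ih =>
      intro hi
      rw [Function.iterate_succ_apply', ih (by omega)]
      simp [h i (by omega)]
  rw [exec_loop, hr, key k le_rfl]

theorem ev_run (c : Prog) (n : ℕ) (x : Str) (ψ : PureState) (f : (ℕ → ℕ) → ℝ≥0∞) :
    ev (c.run n x ψ) f
      = ((c.exec ⟨inputStore n x, ψ.1, 0⟩).map fun b => wt b.state * f b.store).sum := by
  rw [Prog.run, ev_map, ev, tsum_fintype]
  simp only [PMF.ofFintype_apply]
  rw [← Fin.sum_univ_fun_getElem]
  rfl

/-- The bridge from the program logic to actual output distributions: the initial weight is 1, and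
the label can be read off the final registers. -/
theorem Yields.run_map {α : Type} {c : Prog} {n : ℕ} {x : Str} {ψ : PureState} {κ : PMF α}
    {Q : α → Branch → Prop} (h : Yields c ⟨inputStore n x, ψ.1, 0⟩ κ Q)
    (g : (ℕ → ℕ) → α) (hg : ∀ y b, Q y b → g b.store = y) : (c.run n x ψ).map g = κ := by
  refine PMF_ext_ev fun f => ?_
  obtain ⟨L, h1, h2, h3⟩ := h
  have h4 := h3 f
  rw [wt_coe, one_mul] at h4
  rw [ev_map, ev_run, ← h4, ← h1, List.map_map]
  congr 1
  refine List.map_congr_left fun p hp => ?_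
  simp [hg _ _ (h2 p hp)]

/-! ## Registers that are written, sizes of the numbers, independence of the quantum state -/

/-- `c` contains an instruction that writes to register `r`. -/
def Prog.Writes : Prog → ℕ → Prop
  | .const r _, q | .add r _ _, q | .sub r _ _, q | .half r _, q | .size r _, q
  | .measure r _, q => q = r
  | .seq c d, q | .ifZero _ c d, q => c.Writes q ∨ d.Writes q
  | .loop _ c, q => c.Writes q
  | _, _ => False

theorem mem_iterate_flatMap {c : Prog} {P : Branch → Prop}
    (h : ∀ b, P b → ∀ b' ∈ c.exec b, P b') (k : ℕ) : ∀ l : List Branch, (∀ b ∈ l, P b) →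
      ∀ b' ∈ (fun l : List Branch => l.flatMap c.exec)^[k] l, P b' := by
  induction k with
  | zero => exact fun l hl => hl
  | succ k ih =>
    intro l hl
    rw [Function.iterate_succ_apply]
    refine ih _ fun b hb => ?_
    obtain ⟨a, ha, hab⟩ := List.mem_flatMap.mp hb
    exact h a (hl a ha) b hab

theorem exec_frame (c : Prog) : ∀ b, ∀ b' ∈ c.exec b, ∀ q, ¬ c.Writes q →
    b'.store q = b.store q := by
  induction c with
  | seq c d hc hd =>
    intro b b' hb' q hq
    obtain ⟨a, ha, hab⟩ := List.mem_flatMap.mp hb'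
    simp only [Prog.Writes, not_or] at hq
    rw [hd a b' hab q hq.2, hc b a ha q hq.1]
  | ifZero r c d hc hd =>
    intro b b' hb' q hq
    simp only [Prog.Writes, not_or] at hq
    rw [Prog.exec] at hb'
    split_ifs at hb'
    · exact hc _ b' hb' q hq.1
    · exact hd _ b' hb' q hq.2
  | loop r c hc =>
    intro b b' hb' q hq
    exact mem_iterate_flatMap (P := fun a => a.store q = b.store q)
      (fun a ha a' ha' => (hc a a' ha' q hq).trans ha) _ [b.evolve b.state]
      (by simp [Branch.evolve]) b' hb'
  | measure r x =>
    intro b b' hb' q hq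
    simp only [Prog.Writes] at hq
    simp only [Prog.exec, List.mem_cons, List.not_mem_nil, or_false] at hb'
    rcases hb' with rfl | rfl <;> simp [hq]
  | _ =>
    intro b b' hb' q hq
    simp only [Prog.Writes] at hq
    simp only [Prog.exec, List.mem_cons, List.not_mem_nil, or_false] at hb'
    subst hb'
    simp [Branch.evolve, Branch.write, hq]

/-- A bound for the sizes of the constants of a program. -/
def Prog.constSize : Prog → ℕ
  | .const _ k => Nat.size k
  | .seq c d | .ifZero _ c d => max c.constSize d.constSize
  | .loop _ c => c.constSize
  | _ => 0

theorem size_le_self (a : ℕ) : Nat.size a ≤ a := Nat.size_le.mpr Nat.lt_two_pow_self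

theorem size_add_le {a b m : ℕ} (ha : Nat.size a ≤ m) (hb : Nat.size b ≤ m) :
    Nat.size (a + b) ≤ m + 1 := by
  rw [Nat.size_le] at *
  rw [pow_succ]
  omega

/-- Apart from constants, a step makes the longest number at most one bit longer. This bounds the
length of keys and the time needed to multiply estimates. -/
theorem exec_size (c : Prog) {m : ℕ} (hm : c.constSize ≤ m) : ∀ b,
    (∀ r, Nat.size (b.store r) ≤ m + b.steps) → ∀ b' ∈ c.exec b, ∀ r,
      Nat.size (b'.store r) ≤ m + b'.steps := by
  have step : ∀ (b : Branch) (r v : ℕ) (ψ : QState),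
      (∀ q, Nat.size (b.store q) ≤ m + b.steps) → Nat.size v ≤ m + (b.steps + 1) → ∀ q,
      Nat.size ((⟨Function.update b.store r v, ψ, b.steps + 1⟩ : Branch).store q)
        ≤ m + (b.steps + 1) := by
    intro b r v ψ hb hv q
    have := hb q
    by_cases e : q = r
    · subst e; simpa using hv
    · simp [e]; omega
  induction c with
  | seq c d hc hd =>
    intro b hb b' hb'
    obtain ⟨a, ha, hab⟩ := List.mem_flatMap.mp hb'
    simp only [Prog.constSize] at hm
    exact hd (by omega) a (hc (by omega) b hb a ha) b' hab
  | ifZero r c d hc hd =>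
    intro b hb b' hb'
    simp only [Prog.constSize] at hm
    have hb1 : ∀ r, Nat.size ((b.evolve b.state).store r) ≤ m + (b.evolve b.state).steps :=
      fun r => (hb r).trans (by simp [Branch.evolve])
    rw [Prog.exec] at hb'
    split_ifs at hb'
    · exact hc (by omega) _ hb1 b' hb'
    · exact hd (by omega) _ hb1 b' hb'
  | loop r c hc =>
    intro b hb
    refine mem_iterate_flatMap (P := fun a => ∀ r, Nat.size (a.store r) ≤ m + a.steps)
      (hc hm) _ [b.evolve b.state] ?_
    intro a ha q
    simp only [List.mem_cons, List.not_mem_nil, or_false] at ha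
    subst ha
    exact (hb q).trans (by simp [Branch.evolve])
  | measure r x =>
    intro b hb b' hb'
    simp only [Prog.exec, List.mem_cons, List.not_mem_nil, or_false] at hb'
    rcases hb' with rfl | rfl
    · exact step b r 0 _ hb (by simp)
    · exact step b r 1 _ hb (by simp; omega)
  | const r k =>
    intro b hb b' hb'
    simp only [Prog.exec, List.mem_cons, List.not_mem_nil, or_false] at hb'
    subst hb'
    simp only [Prog.constSize] at hm
    exact step b r _ _ hb (by omega)
  | add r x y =>
    intro b hb b' hb'
    simp only [Prog.exec, List.mem_cons, List.not_mem_nil, or_false] at hb'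
    subst hb'
    exact step b r _ _ hb (size_add_le (hb x) (hb y))
  | sub r x y =>
    intro b hb b' hb'
    simp only [Prog.exec, List.mem_cons, List.not_mem_nil, or_false] at hb'
    subst hb'
    exact step b r _ _ hb (((Nat.size_le_size (Nat.sub_le _ _)).trans (hb x)).trans (by omega))
  | half r x =>
    intro b hb b' hb'
    simp only [Prog.exec, List.mem_cons, List.not_mem_nil, or_false] at hb'
    subst hb'
    exact step b r _ _ hb
      (((Nat.size_le_size (Nat.div_le_self _ _)).trans (hb x)).trans (by omega))
  | size r x =>
    intro b hb b' hb'
    simp only [Prog.exec, List.mem_cons, List.not_mem_nil, or_false] at hb'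
    subst hb'
    exact step b r _ _ hb (((Nat.size_le_size (size_le_self _)).trans (hb x)).trans (by omega))
  | _ =>
    intro b hb b' hb' q
    simp only [Prog.exec, List.mem_cons, List.not_mem_nil, or_false] at hb'
    subst hb'
    exact (hb q).trans (by simp [Branch.evolve])

theorem forall₂_flatMap {α β : Type} {R : α → β → Prop} {f : α → List α} {g : β → List β}
    (h : ∀ a b, R a b → List.Forall₂ R (f a) (g b)) {l : List α} {l' : List β}
    (hl : List.Forall₂ R l l') : List.Forall₂ R (l.flatMap f) (l'.flatMap g) :=
  List.rel_flatMap hl h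

theorem forall₂_iterate_flatMap {α β : Type} {R : α → β → Prop} {f : α → List α}
    {g : β → List β} (h : ∀ a b, R a b → List.Forall₂ R (f a) (g b)) (k : ℕ) :
    ∀ {l : List α} {l' : List β}, List.Forall₂ R l l' →
      List.Forall₂ R ((fun l => l.flatMap f)^[k] l) ((fun l => l.flatMap g)^[k] l') := by
  induction k with
  | zero => exact fun hl => hl
  | succ k ih =>
    intro l l' hl
    exact ih (forall₂_flatMap h hl)

/-- The control flow does not depend on the quantum state. -/
theorem exec_congr_state (c : Prog) : ∀ a b : Branch,
    (a.store = b.store ∧ a.steps = b.steps) →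
    List.Forall₂ (fun a b : Branch => a.store = b.store ∧ a.steps = b.steps)
      (c.exec a) (c.exec b) := by
  induction c with
  | seq c d hc hd =>
    intro a b h
    exact forall₂_flatMap hd (hc a b h)
  | ifZero r c d hc hd =>
    intro a b h
    have h' : (a.evolve a.state).store = (b.evolve b.state).store ∧
        (a.evolve a.state).steps = (b.evolve b.state).steps := by
      simp [Branch.evolve, h.1, h.2]
    rw [Prog.exec, Prog.exec, h.1]
    split_ifs
    · exact hc _ _ h'
    · exact hd _ _ h'
  | loop r c hc =>
    intro a b h
    rw [exec_loop, exec_loop, h.1]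
    exact forall₂_iterate_flatMap hc _ (by simp [Branch.evolve, h.1, h.2])
  | _ =>
    intro a b h
    simp [Prog.exec, Branch.evolve, Branch.write, h.1, h.2]

/-- All measurement branches are listed, including those of weight zero, so the step counts do not
depend on the quantum state. -/
theorem steps_le_of_state (c : Prog) {σ : ℕ → ℕ} {φ ψ : QState} {T : ℕ}
    (h : ∀ b ∈ c.exec ⟨σ, φ, 0⟩, b.steps ≤ T) : ∀ b ∈ c.exec ⟨σ, ψ, 0⟩, b.steps ≤ T := by
  have h1 := exec_congr_state c ⟨σ, ψ, 0⟩ ⟨σ, φ, 0⟩ ⟨rfl, rfl⟩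
  intro b hb
  obtain ⟨i, hi, rfl⟩ := List.getElem_of_mem hb
  have h2 := (List.forall₂_iff_get.mp h1).2 i hi (by rw [← h1.length_eq]; exact hi)
  have h3 := h _ (List.getElem_mem (by rw [← h1.length_eq]; exact hi))
  exact h2.2.trans_le h3

/-! ## Running a program on a part of the memory

Registers below `40` belong to the calling program; register `2` contains `0`, the part is given by
the registers `3` (number of parts) and `4` (index), and the registers `5` and `6` are scratch
space. -/

/-- `t := (register 3) * (register a) + (register 4)` -/
def addrProg (t a : ℕ) : Prog := .seq (.add t 4 2) (.loop 3 (.add t t a))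

theorem exec_addrProg {t a : ℕ} (b : Branch) (h0 : b.store 2 = 0) (h3 : t ≠ 3) (ha : t ≠ a) :
    (addrProg t a).exec b = [⟨Function.update b.store t (b.store 3 * b.store a + b.store 4),
      b.state, b.steps + (b.store 3 + 2)⟩] := by
  have h1 : (Prog.add t 4 2).exec b = [b.write t (b.store 4)] := by simp [Prog.exec, h0]
  rw [addrProg, exec_seq h1, exec_loop_eq (k := b.store 3) fun i =>
    ⟨Function.update b.store t (i * b.store a + b.store 4), b.state, b.steps + (i + 2)⟩]
  · simp [Branch.write, h3.symm]
  · simp [Branch.write, Branch.evolve]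
  · intro i _
    simp only [Prog.exec, Branch.write, Function.update_self, Function.update_idem,
      Function.update_of_ne ha.symm]
    simp only [List.cons.injEq, and_true, Branch.mk.injEq, true_and]
    exact ⟨by congr 1; ring, by ring⟩

/-- Run a program in the registers from `40` on and on one part of the memory. -/
def Prog.embed : Prog → Prog
  | .skip => .skip
  | .const r k => .const (r + 40) k
  | .add r a b => .add (r + 40) (a + 40) (b + 40)
  | .sub r a b => .sub (r + 40) (a + 40) (b + 40)
  | .half r a => .half (r + 40) (a + 40)
  | .size r a => .size (r + 40) (a + 40)
  | .had a => .seq (addrProg 5 (a + 40)) (.had 5)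
  | .phase a => .seq (addrProg 5 (a + 40)) (.phase 5)
  | .cnot a b => .seq (addrProg 5 (a + 40)) (.seq (addrProg 6 (b + 40)) (.cnot 5 6))
  | .measure r a => .seq (addrProg 5 (a + 40)) (.measure (r + 40) 5)
  | .seq c d => .seq c.embed d.embed
  | .ifZero r c d => .ifZero (r + 40) c.embed d.embed
  | .loop r c => .loop (r + 40) c.embed

/-- `ψ'` is the product of `ψ` on the `j`-th part and of `G` on the rest. -/
def IsTensor (N j : ℕ) (G : Finset ℕ → ℂ) (ψ ψ' : QState) : Prop :=
  ∀ x, ψ' x = ψ (part N j x) * G (rest N j x)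

section
variable {N j : ℕ} {G : Finset ℕ → ℂ} {ψ ψ' : QState}

theorem IsTensor.hGate (h : IsTensor N j G ψ ψ') (hj : j < N) (a : ℕ) :
    IsTensor N j G (hGate a ψ) (hGate (N * a + j) ψ') := by
  intro x
  simp only [hGate_apply, h x, h (flip _ x), part_flip hj, rest_flip hj, mem_part hj]
  split_ifs <;> ring

theorem IsTensor.tGate (h : IsTensor N j G ψ ψ') (hj : j < N) (a : ℕ) :
    IsTensor N j G (tGate a ψ) (tGate (N * a + j) ψ') := by
  intro x
  simp only [tGate_apply, h x, mem_part hj]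
  ring

theorem IsTensor.cnotGate (h : IsTensor N j G ψ ψ') (hj : j < N) (a b : ℕ) :
    IsTensor N j G (cnotGate a b ψ) (cnotGate (N * a + j) (N * b + j) ψ') := by
  intro x
  have hN : N ≠ 0 := by omega
  have e : (N * a + j ∈ x ∧ N * a + j ≠ N * b + j) ↔ (a ∈ part N j x ∧ a ≠ b) := by
    rw [mem_part hj]
    simp [hN]
  rw [cnotGate_apply, cnotGate_apply, h]
  by_cases h1 : a ∈ part N j x ∧ a ≠ b
  · rw [if_pos h1, if_pos (e.mpr h1), part_flip hj, rest_flip hj]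
  · rw [if_neg h1, if_neg (mt e.mp h1)]

theorem IsTensor.proj (h : IsTensor N j G ψ ψ') (hj : j < N) (a : ℕ) (v : Bool) :
    IsTensor N j G (proj a v ψ) (proj (N * a + j) v ψ') := by
  intro x
  simp only [proj_apply, h x, mem_part hj]
  split_ifs <;> ring

end

/-- The branch `b` simulates the branch `a` on a part of the memory. -/
structure Sim (σ : ℕ → ℕ) (G : Finset ℕ → ℂ) (s : ℕ) (a b : Branch) : Prop where
  high : ∀ r, b.store (r + 40) = a.store r
  low : ∀ r < 40, r ≠ 5 → r ≠ 6 → b.store r = σ r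
  state : IsTensor (σ 3) (σ 4) G a.state b.state
  steps : b.steps ≤ s + (2 * σ 3 + 5) * a.steps

theorem Sim.evolve {σ : ℕ → ℕ} {G : Finset ℕ → ℂ} {s : ℕ} {a b : Branch} (h : Sim σ G s a b) :
    Sim σ G s (a.evolve a.state) (b.evolve b.state) :=
  ⟨h.high, h.low, h.state, by
    have := h.steps
    simp only [Branch.evolve]
    linarith⟩

theorem Sim.write {σ : ℕ → ℕ} {G : Finset ℕ → ℂ} {s : ℕ} {a b : Branch} (h : Sim σ G s a b)
    (r v : ℕ) : Sim σ G s (a.write r v) (b.write (r + 40) v) := by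
  refine ⟨fun q => ?_, fun q hq h5 h6 => ?_, h.state, ?_⟩
  · have := h.high q
    by_cases e : q = r <;> simp [Branch.write, e, this]
  · simp only [Branch.write]
    rw [Function.update_of_ne (by omega)]
    exact h.low q hq h5 h6
  · have := h.steps
    simp only [Branch.write]
    linarith

theorem exec_embed_addr {σ : ℕ → ℕ} {G : Finset ℕ → ℂ} {s : ℕ} {a b : Branch}
    (h : Sim σ G s a b) (h2 : σ 2 = 0) (r t : ℕ) (ht : t = 5 ∨ t = 6) :
    (addrProg t (r + 40)).exec b = [⟨Function.update b.store t (σ 3 * a.store r + σ 4),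
      b.state, b.steps + (σ 3 + 2)⟩] := by
  rw [exec_addrProg b (by rw [h.low 2 (by omega) (by omega) (by omega), h2]) (by omega)
    (by omega), h.low 3 (by omega) (by omega) (by omega),
    h.low 4 (by omega) (by omega) (by omega), h.high]

theorem Sim.after_addr {σ : ℕ → ℕ} {G : Finset ℕ → ℂ} {s : ℕ} {a b : Branch}
    (h : Sim σ G s a b) {t : ℕ} (ht : t = 5 ∨ t = 6) (v : ℕ) {φ φ' : QState}
    (hφ : IsTensor (σ 3) (σ 4) G φ φ') {k : ℕ} (hk : k ≤ 2 * σ 3 + 5) :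
    Sim σ G s ⟨a.store, φ, a.steps + 1⟩ ⟨Function.update b.store t v, φ', b.steps + k⟩ := by
  refine ⟨fun q => ?_, fun q hq h5 h6 => ?_, hφ, ?_⟩
  · simp only
    rw [Function.update_of_ne (by omega)]
    exact h.high q
  · simp only
    rw [Function.update_of_ne (by omega)]
    exact h.low q hq h5 h6
  · have := h.steps
    simp only
    linarith

/-- Branches correspond one to one because the shifted registers hold the same numbers. With `N = σ
3`, the slowdown `2N + 5` is the cost of `cnot`: two address computations of `N + 2` steps each and
the gate. -/
theorem exec_embed {σ : ℕ → ℕ} {G : Finset ℕ → ℂ} {s : ℕ} (h2 : σ 2 = 0) (hj : σ 4 < σ 3)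
    (c : Prog) : ∀ a b, Sim σ G s a b →
      List.Forall₂ (Sim σ G s) (c.exec a) (c.embed.exec b) := by
  induction c with
  | skip => exact fun a b h => by simpa [Prog.embed, Prog.exec] using h.evolve
  | const r k => exact fun a b h => by simpa [Prog.embed, Prog.exec] using h.write r k
  | add r x y =>
    exact fun a b h => by simpa [Prog.embed, Prog.exec, h.high] using h.write r _
  | sub r x y =>
    exact fun a b h => by simpa [Prog.embed, Prog.exec, h.high] using h.write r _
  | half r x => exact fun a b h => by simpa [Prog.embed, Prog.exec, h.high] using h.write r _
  | size r x => exact fun a b h => by simpa [Prog.embed, Prog.exec, h.high] using h.write r _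
  | had x =>
    intro a b h
    rw [Prog.embed, exec_seq (exec_embed_addr h h2 x 5 (Or.inl rfl))]
    simp only [Prog.exec, Branch.evolve, Function.update_self, List.forall₂_cons,
      List.forall₂_nil_left_iff, and_true]
    exact h.after_addr (Or.inl rfl) _ (h.state.hGate hj _) (k := σ 3 + 3) (by omega)
  | phase x =>
    intro a b h
    rw [Prog.embed, exec_seq (exec_embed_addr h h2 x 5 (Or.inl rfl))]
    simp only [Prog.exec, Branch.evolve, Function.update_self, List.forall₂_cons,
      List.forall₂_nil_left_iff, and_true]
    exact h.after_addr (Or.inl rfl) _ (h.state.tGate hj _) (k := σ 3 + 3) (by omega)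
  | cnot x y =>
    intro a b h
    -- Between the two address computations the simulated branch has not moved. Its counter is reset
    -- to 0 and the offset adjusted, as only the register contents are needed here.
    have h1 : Sim σ G (b.steps + (σ 3 + 2)) ⟨a.store, a.state, 0⟩
        ⟨Function.update b.store 5 (σ 3 * a.store x + σ 4), b.state, b.steps + (σ 3 + 2)⟩ := by
      have := h.after_addr (Or.inl rfl) (σ 3 * a.store x + σ 4) h.state (k := σ 3 + 2)
        (by omega)
      exact ⟨this.high, this.low, this.state, by simp⟩
    rw [Prog.embed, exec_seq (exec_embed_addr h h2 x 5 (Or.inl rfl)),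
      exec_seq (exec_embed_addr h1 h2 y 6 (Or.inr rfl))]
    simp only [Prog.exec, Branch.evolve, Function.update_self, List.forall₂_cons,
      List.forall₂_nil_left_iff, and_true]
    rw [Function.update_of_ne (by omega), Function.update_self]
    have h3 := h.after_addr (Or.inl rfl) (σ 3 * a.store x + σ 4)
      (h.state.cnotGate hj (a.store x) (a.store y)) (k := 0) (by omega)
    refine ⟨fun q => ?_, fun q hq h5 h6 => ?_, h3.state, ?_⟩
    · simp only
      rw [Function.update_of_ne (by omega)]
      exact h3.high q
    · simp only
      rw [Function.update_of_ne (by omega)]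
      exact h3.low q hq h5 h6
    · have := h.steps
      simp only
      linarith
  | measure r x =>
    intro a b h
    rw [Prog.embed, exec_seq (exec_embed_addr h h2 x 5 (Or.inl rfl))]
    have key : ∀ (u : Bool) (v : ℕ), Sim σ G s
        ⟨Function.update a.store r v, proj (a.store x) u a.state, a.steps + 1⟩
        ⟨Function.update (Function.update b.store 5 (σ 3 * a.store x + σ 4)) (r + 40) v,
          proj (σ 3 * a.store x + σ 4) u b.state, b.steps + (σ 3 + 2) + 1⟩ := by
      intro u v
      have h3 := h.after_addr (Or.inl rfl) (σ 3 * a.store x + σ 4)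
        (h.state.proj hj (a.store x) u) (k := σ 3 + 3) (by omega)
      refine ⟨fun q => ?_, fun q hq h5 h6 => ?_, h3.state, h3.steps⟩
      · have := h3.high q
        by_cases e : q = r
        · subst e; simp
        · simp only at this ⊢
          rw [Function.update_of_ne (by omega), this, Function.update_of_ne e]
      · simp only
        rw [Function.update_of_ne (by omega)]
        exact h3.low q hq h5 h6
    simp only [Prog.exec, Function.update_self, List.forall₂_cons,
      List.forall₂_nil_left_iff, and_true]
    exact ⟨key false 0, key true 1⟩
  | seq c d hc hd => exact fun a b h => forall₂_flatMap hd (hc a b h)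
  | ifZero r c d hc hd =>
    intro a b h
    rw [Prog.embed, Prog.exec, Prog.exec, h.high]
    split_ifs
    · exact hc _ _ h.evolve
    · exact hd _ _ h.evolve
  | loop r c hc =>
    intro a b h
    rw [Prog.embed, exec_loop, exec_loop, h.high]
    exact forall₂_iterate_flatMap hc _ (by simpa using h.evolve)

/-- Set the registers `40, …, 39 + m` to `0`. -/
def clearProg : ℕ → Prog
  | 0 => .skip
  | m + 1 => .seq (clearProg m) (.const (m + 40) 0)

theorem exec_clearProg (m : ℕ) (b : Branch) : (clearProg m).exec b =
    [⟨fun r => if 40 ≤ r ∧ r < m + 40 then 0 else b.store r, b.state, b.steps + (m + 1)⟩] := by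
  induction m with
  | zero =>
    have : ∀ r, ¬ (40 ≤ r ∧ r < 0 + 40) := by omega
    simp [clearProg, Prog.exec, Branch.evolve, this]
  | succ m ih =>
    rw [clearProg, exec_seq ih]
    simp only [Prog.exec, Branch.write, List.cons.injEq, and_true, Branch.mk.injEq, true_and]
    refine ⟨funext fun r => ?_, by omega⟩
    by_cases e : r = m + 40
    · subst e; simp
    · rw [Function.update_of_ne e]
      congr 1
      rw [eq_iff_iff]
      omega

/-- Run `A` on the part of the memory given by the registers `3` and `4` with the parameter in
register `7` and the input in register `15`. -/
def callProg (m : ℕ) (A : Prog) : Prog :=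
  .seq (clearProg m) (.seq (.add 40 7 2) (.seq (.add 41 15 2) A.embed))

theorem exists_writes_lt (c : Prog) : ∃ m, ∀ q, c.Writes q → q < m := by
  induction c with
  | seq c d hc hd =>
    obtain ⟨m, hm⟩ := hc
    obtain ⟨k, hk⟩ := hd
    refine ⟨max m k, fun q hq => ?_⟩
    rcases hq with hq | hq
    · exact lt_max_of_lt_left (hm q hq)
    · exact lt_max_of_lt_right (hk q hq)
  | ifZero r c d hc hd =>
    obtain ⟨m, hm⟩ := hc
    obtain ⟨k, hk⟩ := hd
    refine ⟨max m k, fun q hq => ?_⟩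
    rcases hq with hq | hq
    · exact lt_max_of_lt_left (hm q hq)
    · exact lt_max_of_lt_right (hk q hq)
  | loop r c hc => exact hc
  | const r k => exact ⟨r + 1, fun q hq => by simp only [Prog.Writes] at hq; omega⟩
  | add r k => exact ⟨r + 1, fun q hq => by simp only [Prog.Writes] at hq; omega⟩
  | sub r k => exact ⟨r + 1, fun q hq => by simp only [Prog.Writes] at hq; omega⟩
  | half r k => exact ⟨r + 1, fun q hq => by simp only [Prog.Writes] at hq; omega⟩
  | size r k => exact ⟨r + 1, fun q hq => by simp only [Prog.Writes] at hq; omega⟩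
  | measure r k => exact ⟨r + 1, fun q hq => by simp only [Prog.Writes] at hq; omega⟩
  | _ => exact ⟨0, fun q hq => hq.elim⟩

/-- A bound for the registers that are used by a call of `A`. -/
def Prog.width (A : Prog) : ℕ := (exists_writes_lt A).choose + 2

theorem Prog.lt_width {A : Prog} {q : ℕ} (h : A.Writes q) : q < A.width :=
  ((exists_writes_lt A).choose_spec q h).trans_le (by simp [Prog.width])

/-- Turns a branchwise simulation into labels for `Yields`: each simulating branch is labelled with
the registers of the branch that it simulates, and all weights scale by the same `W`. -/
theorem exists_labels {R : Branch → Branch → Prop} {W : ℝ≥0∞}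
    (hR : ∀ a b, R a b → wt b.state = wt a.state * W) {la lb : List Branch}
    (h : List.Forall₂ R la lb) : ∃ L : List ((ℕ → ℕ) × Branch), L.map Prod.snd = lb ∧
      (∀ p ∈ L, ∃ a ∈ la, R a p.2 ∧ p.1 = a.store) ∧
      ∀ f : (ℕ → ℕ) → ℝ≥0∞, (L.map fun p => wt p.2.state * f p.1).sum
        = W * (la.map fun a => wt a.state * f a.store).sum := by
  induction h with
  | nil => exact ⟨[], by simp⟩
  | @cons a b la lb hab _ ih =>
    obtain ⟨L, h1, h2, h3⟩ := ih
    refine ⟨(a.store, b) :: L, by simp [h1], ?_, fun f => ?_⟩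
    · intro p hp
      rcases List.mem_cons.mp hp with rfl | hp
      · exact ⟨a, by simp, hab, rfl⟩
      · obtain ⟨a', ha', h⟩ := h2 p hp
        exact ⟨a', by simp [ha'], h⟩
    · simp only [List.map_cons, List.sum_cons, h3, hR a b hab]
      ring

/-- What is true after a call with result `ρ`. -/
structure AfterCall (A : Prog) (τ : PureState) (s M : ℕ) (b : Branch) (ρ : ℕ → ℕ)
    (b' : Branch) : Prop where
  high : ∀ r, b'.store (r + 40) = ρ r
  low : ∀ r < 40, r ≠ 5 → r ≠ 6 → b'.store r = b.store r
  fresh : Fresh (b.store 3) (b.store 4 + 1) τ.1 b'.state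
  steps : b'.steps ≤ b.steps + s
  clear : ∀ r, A.width ≤ r → b'.store (r + 40) = 0
  size : ∀ r, Nat.size (ρ r) ≤ M

/-- The called part holds an unused copy of `τ` in tensor product with everything else, so the
result has exactly the distribution of a run of `A` on `τ`, whatever the rest of the memory looks
like. -/
theorem yields_callProg (A : Prog) (τ : PureState) (b : Branch) {x : Str} {T : ℕ}
    (h2 : b.store 2 = 0) (hj : b.store 4 < b.store 3) (hx : b.store 15 = code x)
    (hc : ∀ r, A.width ≤ r → b.store (r + 40) = 0)
    (hf : Fresh (b.store 3) (b.store 4) τ.1 b.state)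
    (hT : ∀ a ∈ A.exec ⟨inputStore (b.store 7) x, τ.1, 0⟩, a.steps ≤ T) :
    Yields (callProg A.width A) b (A.run (b.store 7) x τ)
      (AfterCall A τ (A.width + 3 + (2 * b.store 3 + 5) * T)
        (A.constSize + Nat.size (b.store 7) + Nat.size (code x) + T) b) := by
  set n := b.store 7 with hn
  obtain ⟨G, hG, hG'⟩ := hf.split hj
  obtain ⟨b₁, hb₁⟩ : ∃ b₁ : Branch, b₁ =
      ⟨Function.update (Function.update
        (fun r => if 40 ≤ r ∧ r < A.width + 40 then 0 else b.store r) 40 n) 41 (code x),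
        b.state, b.steps + (A.width + 3)⟩ := ⟨_, rfl⟩
  have e1 : ∀ r, b₁.store r = if r = 41 then code x else if r = 40 then n else
      if 40 ≤ r ∧ r < A.width + 40 then 0 else b.store r := by
    intro r
    simp only [hb₁, Function.update_apply]
  have hexec : (callProg A.width A).exec b = A.embed.exec b₁ := by
    rw [callProg, exec_seq (exec_clearProg _ _),
      exec_seq (b' := ⟨Function.update
        (fun r => if 40 ≤ r ∧ r < A.width + 40 then 0 else b.store r) 40 n,
        b.state, b.steps + (A.width + 2)⟩) (by simp [Prog.exec, Branch.write, h2, hn, add_assoc]),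
      exec_seq (b' := b₁)]
    simp [Prog.exec, Branch.write, h2, hx, hb₁, add_assoc]
  have hlow : ∀ r < 40, b₁.store r = b.store r := by
    intro r hr
    rw [e1, if_neg (by omega), if_neg (by omega), if_neg (by omega)]
  -- Clearing removes leftovers of earlier calls below `A.width`; the registers above were never
  -- written. So `A` sees a proper initial store.
  have hsim : Sim b₁.store G b₁.steps ⟨inputStore n x, τ.1, 0⟩ b₁ := by
    refine ⟨fun r => ?_, fun _ _ _ _ => rfl, ?_, by simp⟩
    · have hr := hc r
      have : 2 ≤ A.width := by simp [Prog.width]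
      simp only [e1, inputStore]
      by_cases r0 : r = 0
      · subst r0; simp
      by_cases r1 : r = 1
      · subst r1; simp
      rw [if_neg (by omega), if_neg (by omega), if_neg r0, if_neg r1]
      split_ifs with h
      · rfl
      · exact hr (by omega)
    · rw [hlow 3 (by omega), hlow 4 (by omega), hb₁]
      exact hG
  have hall := exec_embed (by rw [hlow 2 (by omega), h2])
    (by rw [hlow 3 (by omega), hlow 4 (by omega)]; exact hj) A _ _ hsim
  have hwt : ∀ a a', Sim b₁.store G b₁.steps a a' → wt a'.state = wt a.state * wt b.state := by
    intro a a' h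
    have := h.state
    rw [hlow 3 (by omega), hlow 4 (by omega)] at this
    exact wt_product hj (wt_coe τ) hG this
  obtain ⟨L, h1, h3, h4⟩ := exists_labels hwt hall
  refine ⟨L, by rw [h1, hexec], fun p hp => ?_, fun f => by rw [h4, ev_run]⟩
  obtain ⟨a, ha, hs, hp1⟩ : ∃ a ∈ A.exec ⟨inputStore n x, τ.1, 0⟩,
      Sim b₁.store G b₁.steps a p.2 ∧ p.1 = a.store := h3 p hp
  have hTa := hT a ha
  rw [hp1]
  refine ⟨hs.high, fun r hr h5 h6 => (hs.low r hr h5 h6).trans (hlow r hr), ?_, ?_, ?_, ?_⟩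
  · have := hs.state
    rw [hlow 3 (by omega), hlow 4 (by omega)] at this
    exact hG' _ _ this
  · have h5 := hs.steps
    rw [hlow 3 (by omega)] at h5
    have h6 : b₁.steps = b.steps + (A.width + 3) := by rw [hb₁]
    have h7 : (2 * b.store 3 + 5) * a.steps ≤ (2 * b.store 3 + 5) * T := by gcongr
    omega
  · intro r hr
    rw [hs.high, exec_frame A _ a ha r fun h => by have := A.lt_width h; omega]
    have : 2 ≤ A.width := by simp [Prog.width]
    simp only [inputStore]
    rw [if_neg (by omega), if_neg (by omega)]
  · intro r
    refine (exec_size A (m := A.constSize + Nat.size n + Nat.size (code x)) (by omega) _ ?_ a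
      ha r).trans (by omega)
    intro r
    simp only [inputStore]
    split_ifs <;> simp <;> omega

/-! ## Classical subroutines

Register `2` contains `0` throughout. -/

/-- `c` changes the registers from `σ` to `σ'` in at most `t` steps without measurements and
without changing the quantum state. -/
def Det (c : Prog) (σ : ℕ → ℕ) (t : ℕ) (σ' : ℕ → ℕ) : Prop :=
  ∀ ψ s, ∃ k ≤ t, c.exec ⟨σ, ψ, s⟩ = [⟨σ', ψ, s + k⟩]

theorem Det.seq {c d : Prog} {σ σ' σ'' : ℕ → ℕ} {t t' : ℕ} (hc : Det c σ t σ')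
    (hd : Det d σ' t' σ'') : Det (.seq c d) σ (t + t') σ'' := by
  intro ψ s
  obtain ⟨k, hk, h⟩ := hc ψ s
  obtain ⟨k', hk', h'⟩ := hd ψ (s + k)
  exact ⟨k + k', by omega, by rw [exec_seq h, h', add_assoc]⟩

theorem Det.mono {c : Prog} {σ σ' : ℕ → ℕ} {t t' : ℕ} (h : Det c σ t σ') (ht : t ≤ t') :
    Det c σ t' σ' := fun ψ s => by
  obtain ⟨k, hk, h⟩ := h ψ s
  exact ⟨k, hk.trans ht, h⟩

theorem Det.frame {c : Prog} {σ σ' : ℕ → ℕ} {t : ℕ} (h : Det c σ t σ') {q : ℕ}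
    (hq : ¬ c.Writes q) : σ' q = σ q := by
  obtain ⟨k, -, h⟩ := h 0 0
  exact exec_frame c ⟨σ, 0, 0⟩ ⟨σ', 0, 0 + k⟩ (by simp [h]) q hq

theorem det_skip (σ : ℕ → ℕ) : Det .skip σ 1 σ := fun _ _ => ⟨1, le_rfl, rfl⟩

theorem det_const (r k : ℕ) (σ : ℕ → ℕ) : Det (.const r k) σ 1 (Function.update σ r k) :=
  fun _ _ => ⟨1, le_rfl, rfl⟩

theorem det_add (r x y : ℕ) (σ : ℕ → ℕ) :
    Det (.add r x y) σ 1 (Function.update σ r (σ x + σ y)) := fun _ _ => ⟨1, le_rfl, rfl⟩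

theorem det_sub (r x y : ℕ) (σ : ℕ → ℕ) :
    Det (.sub r x y) σ 1 (Function.update σ r (σ x - σ y)) := fun _ _ => ⟨1, le_rfl, rfl⟩

theorem det_half (r x : ℕ) (σ : ℕ → ℕ) :
    Det (.half r x) σ 1 (Function.update σ r (σ x / 2)) := fun _ _ => ⟨1, le_rfl, rfl⟩

theorem det_size (r x : ℕ) (σ : ℕ → ℕ) :
    Det (.size r x) σ 1 (Function.update σ r (Nat.size (σ x))) := fun _ _ => ⟨1, le_rfl, rfl⟩

theorem Det.ifZero_pos {r : ℕ} {c : Prog} (d : Prog) {σ σ' : ℕ → ℕ} {t : ℕ} (h : σ r = 0)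
    (hc : Det c σ t σ') : Det (.ifZero r c d) σ (t + 1) σ' := by
  intro ψ s
  obtain ⟨k, hk, e⟩ := hc ψ (s + 1)
  exact ⟨k + 1, by omega, by simp only [Prog.exec, h, if_true, Branch.evolve, e]; congr 2; ring⟩

theorem Det.ifZero_neg {r : ℕ} {d : Prog} (c : Prog) {σ σ' : ℕ → ℕ} {t : ℕ} (h : σ r ≠ 0)
    (hd : Det d σ t σ') : Det (.ifZero r c d) σ (t + 1) σ' := by
  intro ψ s
  obtain ⟨k, hk, e⟩ := hd ψ (s + 1)
  exact ⟨k + 1, by omega, by simp only [Prog.exec, h, if_false, Branch.evolve, e]; congr 2; ring⟩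

theorem Det.loop {r : ℕ} {c : Prog} {σ : ℕ → ℕ} {t : ℕ} (I : ℕ → (ℕ → ℕ) → Prop) (h0 : I 0 σ)
    (h : ∀ i < σ r, ∀ σ', I i σ' → ∃ σ'', Det c σ' t σ'' ∧ I (i + 1) σ'') :
    ∃ σ', Det (.loop r c) σ (t * σ r + 1) σ' ∧ I (σ r) σ' := by
  have key : ∀ k ≤ σ r, ∃ σ', I k σ' ∧ ∀ ψ s, ∃ m ≤ t * k,
      (fun l : List Branch => l.flatMap c.exec)^[k] [⟨σ, ψ, s⟩] = [⟨σ', ψ, s + m⟩] := by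
    intro k
    induction k with
    | zero => exact fun _ => ⟨σ, h0, fun ψ s => ⟨0, by simp, rfl⟩⟩
    | succ k ih =>
      intro hk
      obtain ⟨σ', h1, h2⟩ := ih (by omega)
      obtain ⟨σ'', h3, h4⟩ := h k (by omega) σ' h1
      refine ⟨σ'', h4, fun ψ s => ?_⟩
      obtain ⟨m, hm, e⟩ := h2 ψ s
      obtain ⟨m', hm', e'⟩ := h3 ψ (s + m)
      refine ⟨m + m', by rw [mul_add]; omega, ?_⟩
      rw [Function.iterate_succ_apply', e]
      simp [e', add_assoc]
  obtain ⟨σ', h1, h2⟩ := key _ le_rfl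
  refine ⟨σ', fun ψ s => ?_, h1⟩
  obtain ⟨m, hm, e⟩ := h2 ψ (s + 1)
  exact ⟨m + 1, by omega, by rw [exec_loop, Branch.evolve, e, add_assoc, add_comm 1]⟩

theorem Yields.seq_det {α : Type} {c d : Prog} {b : Branch} {κ : PMF α}
    {Q : α → Branch → Prop} {t : ℕ} {σ' : ℕ → ℕ} (hc : Det c b.store t σ')
    (hd : ∀ s ≤ b.steps + t, Yields d ⟨σ', b.state, s⟩ κ Q) : Yields (.seq c d) b κ Q := by
  obtain ⟨k, hk, e⟩ := hc b.state b.steps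
  exact Yields.seq_exec e rfl (hd _ (by omega))

theorem Yields.of_det {α : Type} {c : Prog} {b : Branch} {Q : α → Branch → Prop} {t : ℕ}
    {σ' : ℕ → ℕ} {y : α} (hc : Det c b.store t σ')
    (hQ : ∀ s ≤ b.steps + t, Q y ⟨σ', b.state, s⟩) : Yields c b (PMF.pure y) Q := by
  obtain ⟨k, hk, e⟩ := hc b.state b.steps
  exact Yields.of_exec e rfl (hQ _ (by omega))

/-- Multiply register `r` by two to the power of register `k`. -/
def doubleProg (r k : ℕ) : Prog := .loop k (.add r r r)

theorem det_doubleProg (r k : ℕ) (σ : ℕ → ℕ) :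
    Det (doubleProg r k) σ (σ k + 1) (Function.update σ r (σ r * 2 ^ σ k)) := by
  obtain ⟨σ', h, e⟩ := Det.loop (r := k) (c := .add r r r) (σ := σ) (t := 1)
    (fun i σ' => σ' = Function.update σ r (σ r * 2 ^ i)) (by simp) (by
      rintro i - σ' rfl
      refine ⟨_, det_add _ _ _ _, ?_⟩
      simp only [Function.update_self, Function.update_idem]
      congr 1
      ring)
  rw [e, one_mul] at h
  exact h

/-- Divide register `r` by two to the power of register `k`. -/
def halveProg (r k : ℕ) : Prog := .loop k (.half r r)

theorem det_halveProg (r k : ℕ) (σ : ℕ → ℕ) :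
    Det (halveProg r k) σ (σ k + 1) (Function.update σ r (σ r / 2 ^ σ k)) := by
  obtain ⟨σ', h, e⟩ := Det.loop (r := k) (c := .half r r) (σ := σ) (t := 1)
    (fun i σ' => σ' = Function.update σ r (σ r / 2 ^ i)) (by simp) (by
      rintro i - σ' rfl
      refine ⟨_, det_half _ _ _, ?_⟩
      simp only [Function.update_self, Function.update_idem]
      congr 1
      rw [Nat.div_div_eq_div_mul, pow_succ])
  rw [e, one_mul] at h
  exact h

/-- One step of the multiplication `mulProg`. -/
def mulStep : Prog :=
  .seq (.half 23 20) <| .seq (.add 24 23 23) <| .seq (.sub 25 20 24) <|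
  .seq (.ifZero 25 .skip (.add 22 22 21)) <| .seq (.add 20 23 2) (.add 21 21 21)

/-- Register `22` becomes the product of the registers `20` and `21`. -/
def mulProg : Prog := .seq (.size 26 20) <| .seq (.const 22 0) <| .loop 26 mulStep

/-- The machine has no parity test, so the last bit is computed as `a - (a/2 + a/2)`. -/
theorem det_mulStep (σ : ℕ → ℕ) (h2 : σ 2 = 0) : ∃ σ', Det mulStep σ 7 σ' ∧
    σ' 20 = σ 20 / 2 ∧ σ' 21 = 2 * σ 21 ∧ σ' 22 = σ 22 + (σ 20 % 2) * σ 21 := by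
  have e : ∀ a, a - (a / 2 + a / 2) = a % 2 := by omega
  rcases Nat.mod_two_eq_zero_or_one (σ 20) with h | h
  · refine ⟨_, Det.seq (det_half _ _ _) (Det.seq (det_add _ _ _ _) (Det.seq (det_sub _ _ _ _)
      (Det.seq (Det.ifZero_pos _ ?_ (det_skip _)) (Det.seq (det_add _ _ _ _)
      (det_add _ _ _ _))))), ?_⟩
    · simp [e, h]
    · simp [h2, h, two_mul]
  · refine ⟨_, Det.seq (det_half _ _ _) (Det.seq (det_add _ _ _ _) (Det.seq (det_sub _ _ _ _)
      (Det.seq (Det.ifZero_neg _ ?_ (det_add _ _ _ _)) (Det.seq (det_add _ _ _ _)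
      (det_add _ _ _ _))))), ?_⟩
    · simp [e, h]
    · simp [h2, h, two_mul]

/-- Shift-and-add multiplication: accumulator plus product of the remaining factors is invariant,
and the first factor is 0 after as many halvings as it has bits. -/
theorem det_mulProg (σ : ℕ → ℕ) (h2 : σ 2 = 0) : ∃ σ',
    Det mulProg σ (7 * Nat.size (σ 20) + 3) σ' ∧ σ' 22 = σ 20 * σ 21 ∧
      ∀ r, r < 20 ∨ 26 < r → σ' r = σ r := by
  set σ₁ := Function.update (Function.update σ 26 (Nat.size (σ 20))) 22 0 with hσ₁
  have e26 : σ₁ 26 = Nat.size (σ 20) := by simp [hσ₁]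
  obtain ⟨σ', h, e2, e20, e⟩ := Det.loop (r := 26) (c := mulStep) (σ := σ₁) (t := 7)
    (fun i σ' => σ' 2 = 0 ∧ σ' 20 = σ 20 / 2 ^ i ∧ σ' 22 + σ' 20 * σ' 21 = σ 20 * σ 21)
    (by simp [hσ₁, h2]) (by
      rintro i - σ' ⟨a1, a2, a3⟩
      obtain ⟨σ'', h, b1, b2, b3⟩ := det_mulStep σ' a1
      refine ⟨σ'', h, ?_, ?_, ?_⟩
      · rw [h.frame (by simp [mulStep, Prog.Writes]), a1]
      · rw [b1, a2, Nat.div_div_eq_div_mul, pow_succ]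
      · rw [b1, b2, b3, ← a3]
        conv_rhs => rw [← Nat.mod_add_div (σ' 20) 2]
        ring)
  rw [e26] at h e20
  have hdet : Det mulProg σ (7 * Nat.size (σ 20) + 3) σ' :=
    (Det.seq (det_size 26 20 σ) (Det.seq (det_const 22 0 _) h)).mono (by omega)
  refine ⟨σ', hdet, ?_, fun r hr => hdet.frame ?_⟩
  · rw [Nat.div_eq_of_lt (Nat.lt_size_self _)] at e20
    rw [e20] at e
    simpa using e
  · simp [mulProg, mulStep, Prog.Writes]
    omega

/-- Register `8` becomes the `d`-th power of register `9`. -/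
def powProg : ℕ → Prog
  | 0 => .const 8 1
  | d + 1 => .seq (powProg d) <| .seq (.const 10 0) <|
      .seq (.loop 9 (.add 10 10 8)) (.add 8 10 2)

theorem det_powProg (σ : ℕ → ℕ) (h2 : σ 2 = 0) (d : ℕ) : ∃ σ',
    Det (powProg d) σ (d * (σ 9 + 3) + 1) σ' ∧ σ' 8 = σ 9 ^ d ∧
      ∀ r, r ≠ 8 → r ≠ 10 → σ' r = σ r := by
  induction d with
  | zero =>
    exact ⟨_, (det_const 8 1 σ).mono (by omega), by simp, fun r h8 _ => by simp [h8]⟩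
  | succ d ih =>
    obtain ⟨σ₁, h1, e1, f1⟩ := ih
    set σ₂ := Function.update σ₁ 10 0 with hσ₂
    have e9 : σ₂ 9 = σ 9 := by
      rw [hσ₂, Function.update_of_ne (by omega), f1 9 (by omega) (by omega)]
    obtain ⟨σ₃, h3, e3⟩ := Det.loop (r := 9) (c := .add 10 10 8) (σ := σ₂) (t := 1)
      (fun i σ' => σ' = Function.update σ₁ 10 (i * σ₁ 8)) (by simp [hσ₂]) (by
        rintro i - σ' rfl
        refine ⟨_, det_add _ _ _ _, ?_⟩
        simp only [Function.update_self, Function.update_idem]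
        rw [Function.update_of_ne (by omega)]
        congr 1
        ring)
    rw [e9] at h3 e3
    refine ⟨_, (Det.seq h1 (Det.seq (det_const 10 0 _) (Det.seq h3
      (det_add 8 10 2 _)))).mono (by rw [add_mul]; omega), ?_, fun r h8 h10 => ?_⟩
    · simp [e3, f1 2, h2, e1, pow_succ, mul_comm]
    · simp [e3, h8, h10, f1 r h8 h10]

/-! ## Coin tosses -/

/-- A fair coin. -/
def coin : PMF ℕ := (PMF.uniformOfFintype Bool).map Bool.toNat

theorem ev_coin (f : ℕ → ℝ≥0∞) : ev coin f = 2⁻¹ * f 0 + 2⁻¹ * f 1 := by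
  rw [coin, ev_map, ev, tsum_bool]
  simp

/-- Toss a coin by means of qubit `0`; the result is in register `16`. -/
def coinProg : Prog := .seq (.measure 16 2) <| .seq (.had 2) (.measure 16 2)

theorem wt_proj_add (q : ℕ) (ψ : QState) : wt (proj q false ψ) + wt (proj q true ψ) = wt ψ := by
  rw [wt, wt, wt, ← ENNReal.ofReal_add (weight_nonneg _) (weight_nonneg _), weight_proj]

/-- Copies that are not used before an execution are not used by it. -/
def KeepsFresh (b b' : Branch) : Prop :=
  ∀ N j τ, 0 < j → Fresh N j τ b.state → Fresh N j τ b'.state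

/-- The first measurement makes qubit `0` classical, even if it is in superposition or left over
from an earlier toss; then Hadamard and a second measurement give a fair bit in each branch. -/
theorem yields_coinProg (b : Branch) (h2 : b.store 2 = 0) : Yields coinProg b coin fun y b' =>
    y ≤ 1 ∧ b'.store = Function.update b.store 16 y ∧ b'.steps = b.steps + 3 ∧
      KeepsFresh b b' := by
  have hL : coinProg.exec b = ([(false, false), (false, true), (true, false), (true, true)].map
      fun p : Bool × Bool => (⟨Function.update b.store 16 p.2.toNat,
        proj 0 p.2 (hGate 0 (proj 0 p.1 b.state)), b.steps + 3⟩ : Branch)) := by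
    simp [coinProg, Prog.exec, Branch.evolve, h2]
  refine ⟨[(false, false), (false, true), (true, false), (true, true)].map
      fun p : Bool × Bool => (p.2.toNat, (⟨Function.update b.store 16 p.2.toNat,
        proj 0 p.2 (hGate 0 (proj 0 p.1 b.state)), b.steps + 3⟩ : Branch)), ?_, ?_, fun f => ?_⟩
  · rw [hL, List.map_map]
    rfl
  · intro p hp
    obtain ⟨q, -, rfl⟩ := List.mem_map.mp hp
    refine ⟨Bool.toNat_le _, rfl, rfl, fun N j τ hj hf => ?_⟩
    -- Address 0 has residue 0 for every `N`, so the coin lies in part 0, outside all unused copies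
    -- when `0 < j`.
    have h0 : 0 % N < j := by simpa using hj
    exact ((hf.proj h0 _).hGate h0).proj h0 _
  · simp only [List.map_cons, List.map_nil, List.sum_cons, List.sum_nil, wt_proj_hGate_proj, Bool.toNat, cond_false, cond_true, add_zero]
    rw [ev_coin, ← wt_proj_add 0 b.state]
    ring

/-- A uniformly random number of `k` bits. -/
def coinNum (k : ℕ) : PMF ℕ := chain (fun i => coin.map fun c => 2 * i + c) k 0

theorem sum_range_two_mul {M : Type*} [AddCommMonoid M] (f : ℕ → M) (m : ℕ) :
    ∑ i ∈ Finset.range (2 * m), f i = ∑ i ∈ Finset.range m, (f (2 * i) + f (2 * i + 1)) := by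
  induction m with
  | zero => simp
  | succ m ih =>
    rw [Finset.sum_range_succ, ← ih, mul_add, mul_one, Finset.sum_range_succ,
      Finset.sum_range_succ, add_assoc]

/-- The chain appends fair bits at the end, so each number below `2 ^ k` arises exactly once. -/
theorem ev_coinNum (k : ℕ) (f : ℕ → ℝ≥0∞) :
    ev (coinNum k) f = (2 ^ k)⁻¹ * ∑ i ∈ Finset.range (2 ^ k), f i := by
  induction k generalizing f with
  | zero => simp [coinNum, chain_zero, ev_pure]
  | succ k ih =>
    have h : coinNum (k + 1) = (coinNum k).bind fun i => coin.map fun c => 2 * i + c := rfl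
    have h1 : ∀ i, ev (coin.map fun c => 2 * i + c) f = 2⁻¹ * (f (2 * i) + f (2 * i + 1)) := by
      intro i
      rw [ev_map, ev_coin, mul_add, add_zero]
    simp only [h, ev_bind, ih, h1]
    rw [← Finset.mul_sum, ← sum_range_two_mul, ← pow_succ' (2 : ℕ) k, ← mul_assoc,
      pow_succ (2 : ℝ≥0∞) k, ENNReal.mul_inv (Or.inl (by simp)) (Or.inl (by simp))]

/-- Register `17` becomes a random number with as many bits as register `k` says. -/
def bitsProg (k : ℕ) : Prog :=
  .seq (.const 17 0) <| .loop k <| .seq coinProg <| .seq (.add 17 17 17) (.add 17 17 16)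

theorem yields_bitsProg {k : ℕ} (hk : k ≠ 17) (b : Branch) (h2 : b.store 2 = 0) :
    Yields (bitsProg k) b (coinNum (b.store k)) fun y b' =>
      y < 2 ^ b.store k ∧ b'.store 17 = y ∧ (∀ r, r ≠ 16 → r ≠ 17 → b'.store r = b.store r) ∧
      b'.steps ≤ b.steps + (5 * b.store k + 2) ∧ KeepsFresh b b' := by
  refine Yields.seq_det (det_const _ _ _) fun s hs => ?_
  have hk' : Function.update b.store 17 0 k = b.store k := Function.update_of_ne hk _ _
  have h := Yields.loop (r := k)
    (c := .seq coinProg <| .seq (.add 17 17 17) (.add 17 17 16))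
    (b := ⟨Function.update b.store 17 0, b.state, s⟩) (y := 0)
    (κ := fun i => coin.map fun c => 2 * i + c)
    (fun i y b' => y < 2 ^ i ∧ b'.store 17 = y ∧ (∀ r, r ≠ 16 → r ≠ 17 → b'.store r = b.store r) ∧
      b'.steps ≤ b.steps + (5 * i + 2) ∧ KeepsFresh b b')
    ⟨by simp, by simp [Branch.evolve], fun r _ h17 => by simp [Branch.evolve, h17],
      by simp only [Branch.evolve]; omega, fun N j τ _ h => h⟩ (by
    rintro i - y b' ⟨hy, h17, hr, hst, hf⟩
    have hc := yields_coinProg b' (by rw [hr 2 (by omega) (by omega), h2])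
    rw [← PMF.bind_pure_comp]
    refine hc.seq fun c b'' hb'' => ?_
    obtain ⟨hc1, e, es, ef⟩ := hb''
    refine Yields.of_det (Det.seq (det_add _ _ _ _) (det_add _ _ _ _)) fun s hs => ?_
    refine ⟨by simp only [pow_succ]; omega, ?_, fun r r1 r2 => ?_, ?_, fun N j τ hj h => ef N j τ hj (hf N j τ hj h)⟩
    · simp [e, h17, two_mul]
    · simp [e, r1, r2, hr]
    · simp only
      omega)
  simp only [hk'] at h
  exact h

/-! ## Polynomial bounds -/

/-- `f` is bounded by a polynomial. -/
def PolyBdd (f : ℕ → ℕ) : Prop := ∃ P : Polynomial ℕ, ∀ m, f m ≤ P.eval m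

theorem PolyBdd.eval (P : Polynomial ℕ) : PolyBdd fun m => P.eval m := ⟨P, fun _ => le_rfl⟩

theorem PolyBdd.const (k : ℕ) : PolyBdd fun _ => k := ⟨Polynomial.C k, by simp⟩

theorem PolyBdd.id : PolyBdd fun m => m := ⟨Polynomial.X, by simp⟩

theorem PolyBdd.add {f g : ℕ → ℕ} (hf : PolyBdd f) (hg : PolyBdd g) :
    PolyBdd fun m => f m + g m := by
  obtain ⟨P, hP⟩ := hf
  obtain ⟨Q, hQ⟩ := hg
  exact ⟨P + Q, fun m => by rw [Polynomial.eval_add]; exact add_le_add (hP m) (hQ m)⟩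

theorem PolyBdd.mul {f g : ℕ → ℕ} (hf : PolyBdd f) (hg : PolyBdd g) :
    PolyBdd fun m => f m * g m := by
  obtain ⟨P, hP⟩ := hf
  obtain ⟨Q, hQ⟩ := hg
  exact ⟨P * Q, fun m => by rw [Polynomial.eval_mul]; exact Nat.mul_le_mul (hP m) (hQ m)⟩

theorem PolyBdd.pow {f : ℕ → ℕ} (hf : PolyBdd f) (k : ℕ) : PolyBdd fun m => f m ^ k := by
  obtain ⟨P, hP⟩ := hf
  exact ⟨P ^ k, fun m => by rw [Polynomial.eval_pow]; exact Nat.pow_le_pow_left (hP m) k⟩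

theorem eval_mono (P : Polynomial ℕ) : Monotone fun m => P.eval m := by
  intro a b h
  simp only [Polynomial.eval_eq_sum_range]
  gcongr

theorem PolyBdd.comp (P : Polynomial ℕ) {f : ℕ → ℕ} (hf : PolyBdd f) :
    PolyBdd fun m => P.eval (f m) := by
  obtain ⟨Q, hQ⟩ := hf
  exact ⟨P.comp Q, fun m => by rw [Polynomial.eval_comp]; exact eval_mono P (hQ m)⟩

/-- A time bound for one convenient initial state suffices, since step counts are independent of the
state. The states on which the programs are analysed are of a special form. -/
theorem PolyBdd.isQPT {c : Prog} {f : ℕ → ℕ} (hf : PolyBdd f)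
    (h : ∀ n x, ∃ ψ, ∀ b ∈ c.exec ⟨inputStore n x, ψ, 0⟩, b.steps ≤ f (n + x.length)) :
    c.IsQPT := by
  obtain ⟨P, hP⟩ := hf
  refine ⟨P, fun n x φ b hb => ?_⟩
  obtain ⟨ψ, hψ⟩ := h n x
  exact (steps_le_of_state c hψ b hb).trans (hP _)

theorem exists_eval_le_pow (P : Polynomial ℕ) : ∃ d, ∀ n, P.eval n ≤ (n + 2) ^ d := by
  induction P using Polynomial.induction_on' with
  | add P Q hP hQ =>
    obtain ⟨a, ha⟩ := hP
    obtain ⟨b, hb⟩ := hQ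
    refine ⟨max a b + 1, fun n => ?_⟩
    have h1 : (n + 2) ^ a ≤ (n + 2) ^ max a b := Nat.pow_le_pow_right (by omega) (by omega)
    have h2 : (n + 2) ^ b ≤ (n + 2) ^ max a b := Nat.pow_le_pow_right (by omega) (by omega)
    have h3 := ha n
    have h4 := hb n
    rw [Polynomial.eval_add, pow_succ, mul_add]
    have : 0 ≤ (n + 2) ^ max a b * n := Nat.zero_le _
    omega
  | monomial k c =>
    refine ⟨c + k, fun n => ?_⟩
    rw [Polynomial.eval_monomial, pow_add]
    gcongr
    · exact (Nat.lt_two_pow_self (n := c)).le.trans (Nat.pow_le_pow_left (by omega) c)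
    · omega

/-! ## The sampler -/

/-- The binary length of the number of prefix lengths. -/
def logLen (d n : ℕ) : ℕ := Nat.size ((n + 2) ^ d)

/-- The number of prefix lengths, which is also a bound for the number of bits of keys. -/
def keyLen (d n : ℕ) : ℕ := 2 ^ logLen d n

theorem lt_keyLen (d n : ℕ) : (n + 2) ^ d < keyLen d n := Nat.lt_size_self _

theorem keyLen_le (d n : ℕ) : keyLen d n ≤ 2 * (n + 2) ^ d := by
  have h : 0 < (n + 2) ^ d := by positivity
  have h1 : 0 < logLen d n := Nat.size_pos.mpr h
  have h2 : 2 ^ (logLen d n - 1) ≤ (n + 2) ^ d := Nat.lt_size.mp (by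
    rw [← logLen]; omega)
  calc keyLen d n = 2 * 2 ^ (logLen d n - 1) := by
        rw [keyLen, ← pow_succ', Nat.sub_add_cancel h1]
    _ ≤ 2 * (n + 2) ^ d := by omega

theorem logLen_le (d n : ℕ) : logLen d n ≤ keyLen d n := Nat.lt_two_pow_self.le

/-- Compute the parameters: register `7` becomes `n`, register `10` the number of prefix lengths,
register `11` two to the power of it. -/
def setupProg (d : ℕ) : Prog :=
  .seq (.add 7 0 2) <| .seq (.const 9 2) <| .seq (.add 9 9 7) <| .seq (powProg d) <|
  .seq (.size 12 8) <| .seq (.const 10 1) <| .seq (doubleProg 10 12) <|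
  .seq (.const 11 1) <| .seq (doubleProg 11 10) (.const 4 1)

theorem det_setupProg (d : ℕ) (σ : ℕ → ℕ) (h2 : σ 2 = 0) : ∃ σ',
    Det (setupProg d) σ (d * (σ 0 + 5) + 2 * keyLen d (σ 0) + 20) σ' ∧ σ' 4 = 1 ∧ σ' 7 = σ 0 ∧
      σ' 10 = keyLen d (σ 0) ∧ σ' 11 = 2 ^ keyLen d (σ 0) ∧ σ' 12 = logLen d (σ 0) ∧
      ∀ r, (r < 4 ∨ 12 < r) → σ' r = σ r := by
  set σ₁ := Function.update (Function.update (Function.update σ 7 (σ 0)) 9 2) 9 (2 + σ 0)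
    with hσ₁
  obtain ⟨σ₂, hd, h8, hr⟩ := det_powProg σ₁ (by simp [hσ₁, h2]) d
  have e9 : σ₁ 9 = σ 0 + 2 := by simp [hσ₁, add_comm]
  have e7 : σ₁ 7 = σ 0 := by simp [hσ₁]
  rw [e9] at hd h8
  have hl := logLen_le d (σ 0)
  have H : Det (setupProg d) σ _ _ :=
    Det.seq (det_add 7 0 2 σ) <| Det.seq (det_const 9 2 _) <| Det.seq (det_add 9 9 7 _) <|
    Det.seq (σ' := σ₂) (t := d * (σ 0 + 2 + 3) + 1) (by simpa [h2, hσ₁] using hd) <|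
    Det.seq (det_size 12 8 _) <|
    Det.seq (det_const 10 1 _) <| Det.seq (det_doubleProg 10 12 _) <|
    Det.seq (det_const 11 1 _) <| Det.seq (det_doubleProg 11 10 _) (det_const 4 1 _)
  refine ⟨_, H.mono ?_, ?_, ?_, ?_, ?_, ?_, fun r h => H.frame ?_⟩
  · simp only [Function.update_apply]
    simp [h8]
    rw [← logLen, ← keyLen]
    have : d * (σ 0 + 2 + 3) = d * (σ 0 + 5) := rfl
    omega
  · simp
  · simp [hr, e7]
  · simp [h8, keyLen, logLen]
  · simp [h8, keyLen, logLen]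
  · simp [h8, logLen]
  · have hp : ∀ d, ¬ (powProg d).Writes r := by
      intro d
      induction d with
      | zero => simp [powProg, Prog.Writes]; omega
      | succ d ih => simp [powProg, Prog.Writes, ih]; omega
    simp [setupProg, doubleProg, Prog.Writes, hp]
    omega

/-- The string (as a number) for a puzzle and a prefix of a key; `T` is a bound for the
prefixes. -/
def encode (T s v : ℕ) : ℕ := s * T * 2 + v

/-- Flip the last bit of a number. -/
def lastFlip (v : ℕ) : ℕ := v / 2 + v / 2 + (1 - (v - (v / 2 + v / 2)))

/-- The last part of the sampler. -/
def samplerOut : Prog :=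
  .seq (.add 18 11 41) <| .seq (halveProg 18 13) <|
  .seq (.ifZero 14 (.seq (.half 19 18) <| .seq (.add 20 19 19) <| .seq (.sub 21 18 20) <|
    .seq (.const 22 1) <| .seq (.sub 22 22 21) (.add 18 20 22)) .skip) <|
  .seq (doubleProg 40 10) <| .seq (.add 40 40 40) (.add 0 40 18)

theorem det_samplerOut (σ : ℕ → ℕ) : ∃ σ', Det samplerOut σ (σ 13 + σ 10 + 20) σ' ∧
    σ' 0 = encode (2 ^ σ 10) (σ 40) (if σ 14 = 0 then lastFlip ((σ 11 + σ 41) / 2 ^ σ 13)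
      else (σ 11 + σ 41) / 2 ^ σ 13) := by
  by_cases h : σ 14 = 0
  · have H : Det samplerOut σ _ _ :=
      Det.seq (det_add 18 11 41 σ) <| Det.seq (det_halveProg 18 13 _) <|
      Det.seq (Det.ifZero_pos _ (by simp [h]) (Det.seq (det_half _ _ _) <|
        Det.seq (det_add _ _ _ _) <| Det.seq (det_sub _ _ _ _) <| Det.seq (det_const _ _ _) <|
        Det.seq (det_sub _ _ _ _) (det_add _ _ _ _))) <|
      Det.seq (det_doubleProg _ _ _) <| Det.seq (det_add _ _ _ _) (det_add _ _ _ _)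
    refine ⟨_, H.mono ?_, ?_⟩
    · simp; omega
    · simp [h, encode, lastFlip, mul_two]
  · have H : Det samplerOut σ _ _ :=
      Det.seq (det_add 18 11 41 σ) <| Det.seq (det_halveProg 18 13 _) <|
      Det.seq (Det.ifZero_neg _ (by simp [h]) (det_skip _)) <|
      Det.seq (det_doubleProg _ _ _) <| Det.seq (det_add _ _ _ _) (det_add _ _ _ _)
    refine ⟨_, H.mono ?_, ?_⟩
    · simp; omega
    · simp [h, encode, mul_two]

/-- Sample a puzzle and a random prefix of its key, and flip the last bit of the prefix with
probability `1 / 4`. -/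
def samplerProg (d : ℕ) (c : Prog) : Prog :=
  .seq (setupProg d) <| .seq (.const 3 2) <| .seq (bitsProg 12) <| .seq (.add 13 17 2) <|
  .seq (.const 18 2) <| .seq (bitsProg 18) <| .seq (.add 14 17 2) <|
  .seq (callProg c.width c) samplerOut

/-- The distribution of the output of the sampler, as a number. -/
def samplerDist (d n : ℕ) (μ : PMF (ℕ × ℕ)) : PMF ℕ :=
  (coinNum (logLen d n)).bind fun i => (coinNum 2).bind fun f => μ.map fun sk =>
    encode (2 ^ keyLen d n) sk.1 (if f = 0 then lastFlip ((2 ^ keyLen d n + sk.2) / 2 ^ i)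
      else (2 ^ keyLen d n + sk.2) / 2 ^ i)

theorem fresh_zeroState : Fresh 2 1 zeroState.1 zeroState.1 := by
  refine ⟨fun y => if y = ∅ then 1 else 0, fun x => ?_⟩
  have hI : Finset.Ico 1 2 = {1} := rfl
  rw [hI, Finset.prod_singleton]
  by_cases hx : x = ∅
  · subst hx
    simp [zeroState, part]
  · have : ¬ ((x.filter fun a => a % 2 < 1) = ∅ ∧ part 2 1 x = ∅) := by
      rintro ⟨h1, h2⟩
      obtain ⟨a, ha⟩ := Finset.nonempty_iff_ne_empty.mpr hx
      by_cases e : a % 2 < 1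
      · exact Finset.filter_eq_empty_iff.mp h1 ha e
      · have : a / 2 ∈ part 2 1 x := by
          rw [mem_part (by omega)]
          have : 2 * (a / 2) + 1 = a := by omega
          rwa [this]
        simp [h2] at this
    rw [not_and_or] at this
    simp only [zeroState, Finsupp.single_apply, if_neg (Ne.symm hx)]
    rcases this with h | h
    · rw [if_neg h, zero_mul]
    · rw [if_neg (Ne.symm h), mul_zero]

theorem yields_samplerProg (d : ℕ) (c : Prog) (n : ℕ) (x : Str) {T : ℕ}
    (hT : ∀ a ∈ c.exec ⟨inputStore n [], zeroState.1, 0⟩, a.steps ≤ T) :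
    Yields (samplerProg d c) ⟨inputStore n x, zeroState.1, 0⟩
      (samplerDist d n ((c.run n [] zeroState).map fun ρ => (ρ 0, ρ 1))) fun y b' =>
      b'.store 0 = y ∧ b'.steps ≤ d * (n + 5) + 9 * keyLen d n + c.width + 9 * T + 70 := by
  have hl := logLen_le d n
  have i0 : inputStore n x 0 = n := rfl
  obtain ⟨σ₁, hd, s4, s7, s10, s11, s12, hr⟩ := det_setupProg d (inputStore n x) rfl
  -- The sampler uses two parts of the memory: part 0 for the coin and part 1, still all zero, for
  -- the run of `c`.
  rw [i0] at hd s7 s10 s11 s12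
  refine Yields.seq_det hd fun t₁ ht₁ => ?_
  refine Yields.seq_det (det_const 3 2 _) fun t₂ ht₂ => ?_
  have h2 : σ₁ 2 = 0 := hr 2 (by omega)
  have hb1 := yields_bitsProg (k := 12) (by omega)
    ⟨Function.update σ₁ 3 2, zeroState.1, t₂⟩ (by simp [h2])
  simp only [ne_eq, Nat.reduceEqDiff, not_false_eq_true,
    Function.update_of_ne, s12] at hb1
  refine hb1.seq fun i b₁ hb₁ => ?_
  obtain ⟨hi, e17, er, est, ef⟩ := hb₁
  refine Yields.seq_det (det_add 13 17 2 _) fun t₃ ht₃ => ?_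
  refine Yields.seq_det (det_const 18 2 _) fun t₄ ht₄ => ?_
  have hb2 := yields_bitsProg (k := 18) (by omega)
    ⟨Function.update (Function.update b₁.store 13 (b₁.store 17 + b₁.store 2)) 18 2,
      b₁.state, t₄⟩ (by simp [er, h2])
  simp only [Function.update_self] at hb2
  refine hb2.seq fun f b₂ hb₂ => ?_
  obtain ⟨-, g17, gr, gst, gf⟩ := hb₂
  refine Yields.seq_det (det_add 14 17 2 _) fun t₅ ht₅ => ?_
  have e2 : b₁.store 2 = 0 := by rw [er 2 (by omega) (by omega)]; simp [h2]
  have g2 : b₂.store 2 = 0 := by rw [gr 2 (by omega) (by omega)]; simp [e2]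
  obtain ⟨b₃, hb₃⟩ : ∃ b₃ : Branch, b₃ =
      ⟨Function.update b₂.store 14 (b₂.store 17 + b₂.store 2), b₂.state, t₅⟩ := ⟨_, rfl⟩
  have k : ∀ r, r ≠ 3 → r ≠ 13 → r ≠ 14 → r ≠ 16 → r ≠ 17 → r ≠ 18 → b₃.store r = σ₁ r := by
    intro r _ _ _ _ _ _
    simp_all
  have k3 : b₃.store 3 = 2 := by simp_all
  have k13 : b₃.store 13 = i := by simp_all
  have k14 : b₃.store 14 = f := by simp_all
  have k7 : b₃.store 7 = n := by rw [k 7] <;> simp [s7]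
  have k4 : b₃.store 4 = 1 := by rw [k 4] <;> simp [s4]
  have hcall := yields_callProg c zeroState b₃ (x := []) (T := T)
    (by rw [k 2] <;> simp [h2]) (by rw [k3, k4]; omega)
    (by rw [k 15] <;> simp [hr, inputStore, code])
    (by
      intro r _
      rw [k (r + 40)] <;> try omega
      rw [hr _ (by omega)]
      simp [inputStore])
    (by
      rw [k3, k4, hb₃]
      exact gf _ _ _ (by omega) (ef _ _ _ (by omega) fresh_zeroState))
    (by rw [k7]; exact hT)
  rw [k7, k3] at hcall
  rw [← hb₃]
  rw [PMF.map_comp, ← PMF.bind_pure_comp]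
  refine hcall.seq fun ρ b₄ hb₄ => ?_
  obtain ⟨σ', hd', h0⟩ := det_samplerOut b₄.store
  have l10 : b₄.store 10 = keyLen d n := by
    rw [hb₄.low 10 (by omega) (by omega) (by omega), k 10] <;> simp [s10]
  have l11 : b₄.store 11 = 2 ^ keyLen d n := by
    rw [hb₄.low 11 (by omega) (by omega) (by omega), k 11] <;> simp [s11]
  have l13 : b₄.store 13 = i := by rw [hb₄.low 13 (by omega) (by omega) (by omega), k13]
  have l14 : b₄.store 14 = f := by rw [hb₄.low 14 (by omega) (by omega) (by omega), k14]
  refine Yields.of_det hd' fun t₆ ht₆ => ⟨?_, ?_⟩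
  · have e0 := hb₄.high 0
    have e1 := hb₄.high 1
    simp only [zero_add, Nat.reduceAdd] at e0 e1
    simp only [h0, l10, l11, l13, l14, e0, e1, Function.comp]
  · have := hb₄.steps
    have hi' : i < keyLen d n := hi
    have t3 : b₃.steps = t₅ := by rw [hb₃]
    rw [l13, l10] at ht₆
    simp only at *
    omega

/-! ## The adversary -/

/-- The next bit of the key when the estimates `u₀ / v₀` and `u₁ / v₁` are given; `θ` is a random
number below `T`. -/
def nextBit (T u₀ v₀ u₁ v₁ θ : ℕ) : ℕ :=
  if 4 * T * (u₁ * v₀) - (2 * θ + T) * (u₀ * v₁ + u₁ * v₀) = 0 then 0 else 1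

/-- Append the bit `nextBit` to register `14`. -/
def decideProg : Prog :=
  .seq (.add 20 18 2) <| .seq (.add 21 41 2) <| .seq mulProg <| .seq (.add 28 22 2) <|
  .seq (.add 20 40 2) <| .seq (.add 21 19 2) <| .seq mulProg <| .seq (.add 29 22 2) <|
  .seq (.add 20 17 17) <| .seq (.add 20 20 11) <| .seq (.add 21 28 29) <| .seq mulProg <|
  .seq (.add 28 22 2) <| .seq (doubleProg 29 10) <| .seq (.add 29 29 29) <|
  .seq (.add 29 29 29) <| .seq (.sub 29 29 28) <| .seq (.add 14 14 14)
  (.ifZero 29 .skip (.add 14 14 27))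

/-- `nextBit` is cross-multiplied, so three integer multiplications suffice. Their time depends only
on the sizes of the first factors, registers `18` and `40` and the shifted random number. -/
theorem det_decideProg (σ : ℕ → ℕ) (h2 : σ 2 = 0) (h27 : σ 27 = 1) : ∃ σ',
    Det decideProg σ (7 * (Nat.size (σ 18) + Nat.size (σ 40) + Nat.size (2 * σ 17 + σ 11))
      + σ 10 + 40) σ' ∧
    (σ 11 = 2 ^ σ 10 → σ' 14 = 2 * σ 14 + nextBit (σ 11) (σ 18) (σ 19) (σ 40) (σ 41) (σ 17)) ∧
    ∀ r, r < 14 ∨ 29 < r → σ' r = σ r := by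
  obtain ⟨σ₁, d1, e1, f1⟩ := det_mulProg
    (Function.update (Function.update σ 20 (σ 18)) 21 (σ 41)) (by simp [h2])
  simp only [ne_eq, Nat.reduceEqDiff, not_false_eq_true, Function.update_of_ne,
    Function.update_self] at d1 e1
  have g1 : ∀ r, r < 20 ∨ 26 < r → σ₁ r = σ r := by
    intro r hr
    rw [f1 r hr, Function.update_of_ne (by omega), Function.update_of_ne (by omega)]
  obtain ⟨σ₂, hσ₂⟩ : ∃ σ₂, σ₂ = Function.update σ₁ 28 (σ₁ 22) := ⟨_, rfl⟩
  obtain ⟨σ₃, d3, e3, f3⟩ := det_mulProg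
    (Function.update (Function.update σ₂ 20 (σ 40)) 21 (σ 19)) (by simp [hσ₂, g1, h2])
  simp only [ne_eq, Nat.reduceEqDiff, not_false_eq_true, Function.update_of_ne,
    Function.update_self] at d3 e3
  have g3 : ∀ r, r < 20 ∨ 28 < r ∨ r = 27 → σ₃ r = σ r := by
    intro r hr
    rw [f3 r (by omega), Function.update_of_ne (by omega), Function.update_of_ne (by omega),
      hσ₂, Function.update_of_ne (by omega), g1 r (by omega)]
  have g28 : σ₃ 28 = σ 18 * σ 41 := by
    rw [f3 28 (by omega)]
    simp [hσ₂, e1]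
  obtain ⟨σ₄, hσ₄⟩ : ∃ σ₄, σ₄ = Function.update σ₃ 29 (σ₃ 22) := ⟨_, rfl⟩
  obtain ⟨σ₅, d5, e5, f5⟩ := det_mulProg
    (Function.update (Function.update σ₄ 20 (2 * σ 17 + σ 11)) 21 (σ 18 * σ 41 + σ 40 * σ 19))
    (by simp [hσ₄, g3, h2])
  simp only [ne_eq, Nat.reduceEqDiff, not_false_eq_true, Function.update_of_ne,
    Function.update_self] at d5 e5
  have g5 : ∀ r, r < 20 ∨ 29 < r ∨ r = 27 → σ₅ r = σ r := by
    intro r hr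
    rw [f5 r (by omega), Function.update_of_ne (by omega), Function.update_of_ne (by omega),
      hσ₄, Function.update_of_ne (by omega), g3 r (by omega)]
  have g29 : σ₅ 29 = σ 40 * σ 19 := by
    rw [f5 29 (by omega)]
    simp [hσ₄, e3]
  obtain ⟨σ₆, hσ₆⟩ : ∃ σ₆, σ₆ = Function.update (Function.update (Function.update σ₅ 28 (σ₅ 22))
    29 (4 * 2 ^ σ 10 * (σ 40 * σ 19) - σ₅ 22)) 14 (2 * σ 14) := ⟨_, rfl⟩
  have D6 : ∀ {t σ'}, Det (.ifZero 29 .skip (.add 14 14 27)) σ₆ t σ' →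
      Det decideProg σ _ σ' := fun h =>
    Det.seq (det_add 20 18 2 σ) <| Det.seq (det_add 21 41 2 _) <|
    Det.seq (σ' := σ₁) (t := 7 * Nat.size (σ 18) + 3) (by simpa [h2] using d1) <|
    Det.seq (det_add 28 22 2 _) <| Det.seq (det_add 20 40 2 _) <| Det.seq (det_add 21 19 2 _) <|
    Det.seq (σ' := σ₃) (t := 7 * Nat.size (σ 40) + 3)
      (by simpa [g1, h2, hσ₂] using d3) <|
    Det.seq (det_add 29 22 2 _) <| Det.seq (det_add 20 17 17 _) <|
    Det.seq (det_add 20 20 11 _) <| Det.seq (det_add 21 28 29 _) <|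
    Det.seq (σ' := σ₅) (t := 7 * Nat.size (2 * σ 17 + σ 11) + 3)
      (by simpa [g3, h2, hσ₄, g28, e3, two_mul] using d5) <|
    Det.seq (det_add 28 22 2 _) <| Det.seq (t := σ 10 + 1)
      (by simpa [g5, h2] using det_doubleProg 29 10 (Function.update σ₅ 28 (σ₅ 22))) <|
    Det.seq (det_add 29 29 29 _) <|
    Det.seq (det_add 29 29 29 _) <| Det.seq (det_sub 29 29 28 _) <|
    Det.seq (t := 1) (σ' := σ₆) (by
      rw [hσ₆]
      have h4 : σ 40 * σ 19 * 2 ^ σ 10 + σ 40 * σ 19 * 2 ^ σ 10 +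
          (σ 40 * σ 19 * 2 ^ σ 10 + σ 40 * σ 19 * 2 ^ σ 10)
            = 4 * 2 ^ σ 10 * (σ 40 * σ 19) := by ring
      simpa [g5, g29, two_mul, h4] using det_add 14 14 14 (Function.update (Function.update
        σ₅ 28 (σ₅ 22)) 29 (4 * 2 ^ σ 10 * (σ 40 * σ 19) - σ₅ 22))) h
  have k29 : σ₆ 29 = 4 * 2 ^ σ 10 * (σ 40 * σ 19)
      - (2 * σ 17 + σ 11) * (σ 18 * σ 41 + σ 40 * σ 19) := by
    simp [hσ₆, e5]
  have k14 : σ₆ 14 = 2 * σ 14 := by simp [hσ₆]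
  have k27 : σ₆ 27 = 1 := by simp [hσ₆, g5, h27]
  have hfr : ∀ r, r < 14 ∨ 29 < r → ¬ decideProg.Writes r := by
    intro r hr
    simp [decideProg, mulProg, mulStep, doubleProg, Prog.Writes]
    omega
  by_cases h : σ₆ 29 = 0
  · have H := D6 (Det.ifZero_pos _ h (det_skip _))
    refine ⟨_, H.mono (by omega), fun hT => ?_, fun r hr => H.frame (hfr r hr)⟩
    rw [nextBit, hT, if_pos (by rw [← hT, hT] at k29; rw [← k29, h]), k14, add_zero]
  · have H := D6 (Det.ifZero_neg _ h (det_add _ _ _ _))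
    refine ⟨_, H.mono (by omega), fun hT => ?_, fun r hr => H.frame (hfr r hr)⟩
    rw [nextBit, hT, if_neg (by rw [← hT, hT] at k29; rw [← k29]; exact h)]
    simp [k14, k27]

/-- Determine the next bit of the key. -/
def advStepProg (A : Prog) : Prog :=
  .seq (.add 15 13 14) <| .seq (.add 15 15 14) <| .seq (callProg A.width A) <|
  .seq (.add 18 40 2) <| .seq (.add 19 41 2) <| .seq (.const 27 1) <| .seq (.add 4 4 27) <|
  .seq (.add 15 15 27) <| .seq (callProg A.width A) <| .seq (.add 4 4 27) <|
  .seq (bitsProg 10) decideProg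

/-- The distribution of the prefix of the key with one more bit. -/
def advStep (A : Prog) (τ : PureState) (n R s w : ℕ) : PMF ℕ :=
  (A.run n (decode (encode (2 ^ R) s (2 * w))) τ).bind fun ρ₀ =>
  (A.run n (decode (encode (2 ^ R) s (2 * w + 1))) τ).bind fun ρ₁ =>
  (coinNum R).map fun θ => 2 * w + nextBit (2 ^ R) (ρ₀ 0) (ρ₀ 1) (ρ₁ 0) (ρ₁ 1) θ

/-- The adversary: sample a key for a given puzzle bit by bit. -/
def advProg (d : ℕ) (A : Prog) : Prog :=
  .seq (setupProg d) <| .seq (.add 3 10 10) <| .seq (.add 3 3 4) <| .seq (.add 13 1 2) <|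
  .seq (doubleProg 13 10) <| .seq (.add 13 13 13) <| .seq (.const 14 1) <|
  .seq (.loop 10 (advStepProg A)) (.sub 0 14 11)

/-- What is true when `i` bits of the key have been determined. -/
structure AdvInv (A : Prog) (τ : PureState) (n R s t₀ t i w : ℕ) (b : Branch) : Prop where
  s2 : b.store 2 = 0
  s3 : b.store 3 = 2 * R + 1
  s4 : b.store 4 = 2 * i + 1
  s7 : b.store 7 = n
  s10 : b.store 10 = R
  s11 : b.store 11 = 2 ^ R
  s13 : b.store 13 = s * 2 ^ R * 2
  s14 : b.store 14 = w
  lt : w < 2 ^ (i + 1)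
  clear : ∀ r, A.width ≤ r → b.store (r + 40) = 0
  fresh : Fresh (2 * R + 1) (2 * i + 1) τ.1 b.state
  steps : b.steps ≤ t₀ + t * i

/-- A time bound for `advStepProg`. -/
def advStepTime (A : Prog) (n R L T : ℕ) : ℕ :=
  2 * (A.width + 3 + (2 * (2 * R + 1) + 5) * T) + 14 * (A.constSize + n + L + T) + 13 * R + 100

theorem nextBit_le (T u₀ v₀ u₁ v₁ θ : ℕ) : nextBit T u₀ v₀ u₁ v₁ θ ≤ 1 := by
  unfold nextBit
  split_ifs <;> omega

/-- Step `i` spends the copies in parts `2i + 1` and `2i + 2`, one for each of the two estimates. -/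
theorem yields_advStepProg {A : Prog} {τ : PureState} {n R s t₀ L T i w : ℕ} {b : Branch}
    (hi : i < R)
    (hT : ∀ k < 2 ^ (R + 1), ∀ a ∈ A.exec
      ⟨inputStore n (decode (encode (2 ^ R) s k)), τ.1, 0⟩, a.steps ≤ T)
    (hL : ∀ k < 2 ^ (R + 1), Nat.size (encode (2 ^ R) s k) ≤ L)
    (h : AdvInv A τ n R s t₀ (advStepTime A n R L T) i w b) :
    Yields (advStepProg A) b (advStep A τ n R s w)
      (AdvInv A τ n R s t₀ (advStepTime A n R L T) (i + 1)) := by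
  have hn := size_le_self n
  have hw : 2 * w + 1 < 2 ^ (R + 1) := by
    have h1 := h.lt
    have h2 : 2 ^ (i + 1 + 1) ≤ 2 ^ (R + 1) := Nat.pow_le_pow_right (by omega) (by omega)
    rw [pow_succ] at h2
    omega
  refine Yields.seq_det (det_add 15 13 14 _) fun t₁ ht₁ => ?_
  refine Yields.seq_det (det_add 15 15 14 _) fun t₂ ht₂ => ?_
  obtain ⟨b₁, hb₁⟩ : ∃ b₁ : Branch, b₁ = ⟨Function.update b.store 15
    (encode (2 ^ R) s (2 * w)), b.state, t₂⟩ := ⟨_, rfl⟩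
  have hst : (⟨Function.update (Function.update b.store 15 (b.store 13 + b.store 14)) 15
      (Function.update b.store 15 (b.store 13 + b.store 14) 15 +
        Function.update b.store 15 (b.store 13 + b.store 14) 14), b.state, t₂⟩ : Branch)
      = b₁ := by
    simp [hb₁, h.s13, h.s14, encode, two_mul, add_assoc]
  dsimp only
  rw [hst]
  have k : ∀ r, r ≠ 15 → b₁.store r = b.store r := fun r hr => by simp [hb₁, hr]
  have k15 : b₁.store 15 = encode (2 ^ R) s (2 * w) := by simp [hb₁]
  have hcall := yields_callProg A τ b₁ (x := decode (encode (2 ^ R) s (2 * w))) (T := T)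
    (by rw [k 2 (by omega), h.s2]) (by rw [k 3 (by omega), k 4 (by omega), h.s3, h.s4]; omega)
    (by rw [k15, code_decode]) (fun r hr => by rw [k _ (by omega), h.clear r hr])
    (by rw [k 3 (by omega), k 4 (by omega), h.s3, h.s4, hb₁]; exact h.fresh)
    (by rw [k 7 (by omega), h.s7]; exact hT _ (by omega))
  rw [k 7 (by omega), h.s7, k 3 (by omega), h.s3, code_decode] at hcall
  refine hcall.seq fun ρ₀ b₂ hb₂ => ?_
  have l : ∀ r < 40, r ≠ 5 → r ≠ 6 → r ≠ 15 → b₂.store r = b.store r :=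
    fun r h1 h5 h6 h15 => by rw [hb₂.low r h1 h5 h6, k r h15]
  have l15 : b₂.store 15 = encode (2 ^ R) s (2 * w) := by
    rw [hb₂.low 15 (by omega) (by omega) (by omega), k15]
  have l40 : b₂.store 40 = ρ₀ 0 := hb₂.high 0
  have l41 : b₂.store 41 = ρ₀ 1 := hb₂.high 1
  have l2 : b₂.store 2 = 0 := by rw [l 2 (by omega) (by omega) (by omega) (by omega), h.s2]
  have l4 : b₂.store 4 = 2 * i + 1 := by
    rw [l 4 (by omega) (by omega) (by omega) (by omega), h.s4]
  refine Yields.seq_det (det_add 18 40 2 _) fun t₃ ht₃ => ?_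
  refine Yields.seq_det (det_add 19 41 2 _) fun t₄ ht₄ => ?_
  refine Yields.seq_det (det_const 27 1 _) fun t₅ ht₅ => ?_
  refine Yields.seq_det (det_add 4 4 27 _) fun t₆ ht₆ => ?_
  refine Yields.seq_det (det_add 15 15 27 _) fun t₇ ht₇ => ?_
  obtain ⟨b₃, hb₃⟩ : ∃ b₃ : Branch, b₃ = ⟨Function.update (Function.update (Function.update
    (Function.update (Function.update b₂.store 18 (ρ₀ 0)) 19 (ρ₀ 1)) 27 1) 4 (2 * i + 2)) 15
    (encode (2 ^ R) s (2 * w + 1)), b₂.state, t₇⟩ := ⟨_, rfl⟩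
  dsimp only
  have hst' : encode (2 ^ R) s (2 * w) + 1 = encode (2 ^ R) s (2 * w + 1) := by
    simp [encode, add_assoc]
  simp only [ne_eq, Nat.reduceEqDiff, not_false_eq_true, Function.update_of_ne,
    Function.update_self, l40, l41, l2, l4, l15, add_zero, hst', add_assoc, Nat.reduceAdd]
  rw [← hb₃]
  have m : ∀ r, r ≠ 4 → r ≠ 5 → r ≠ 6 → r ≠ 15 → r ≠ 18 → r ≠ 19 → r ≠ 27 → r < 40 →
      b₃.store r = b.store r := by
    intro r h4 h5 h6 h15 h18 h19 h27 h40
    simp [hb₃, h4, h15, h18, h19, h27, l r h40 h5 h6 h15]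
  have m4 : b₃.store 4 = 2 * i + 2 := by simp [hb₃]
  have m15 : b₃.store 15 = encode (2 ^ R) s (2 * w + 1) := by simp [hb₃]
  have m18 : b₃.store 18 = ρ₀ 0 := by simp [hb₃]
  have m19 : b₃.store 19 = ρ₀ 1 := by simp [hb₃]
  have m27 : b₃.store 27 = 1 := by simp [hb₃]
  have m2 : b₃.store 2 = 0 := by rw [m 2, h.s2] <;> simp
  have m3 : b₃.store 3 = 2 * R + 1 := by rw [m 3, h.s3] <;> simp
  have m7 : b₃.store 7 = n := by rw [m 7, h.s7] <;> simp
  have m10 : b₃.store 10 = R := by rw [m 10, h.s10] <;> simp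
  have m11 : b₃.store 11 = 2 ^ R := by rw [m 11, h.s11] <;> simp
  have m13 : b₃.store 13 = s * 2 ^ R * 2 := by rw [m 13, h.s13] <;> simp
  have m14 : b₃.store 14 = w := by rw [m 14, h.s14] <;> simp
  have hfr := hb₂.fresh
  rw [k 3 (by omega), k 4 (by omega), h.s3, h.s4] at hfr
  have hcall' := yields_callProg A τ b₃ (x := decode (encode (2 ^ R) s (2 * w + 1))) (T := T)
    m2 (by rw [m3, m4]; omega) (by rw [m15, code_decode])
    (fun r hr => by simp [hb₃, hb₂.clear r hr])
    (by rw [m3, m4, hb₃]; exact hfr)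
    (by rw [m7]; exact hT _ hw)
  rw [m7, m3, code_decode] at hcall'
  refine hcall'.seq fun ρ₁ b₄ hb₄ => ?_
  have q : ∀ r < 40, r ≠ 5 → r ≠ 6 → b₄.store r = b₃.store r := hb₄.low
  have hfr' := hb₄.fresh
  rw [m3, m4] at hfr'
  refine Yields.seq_det (det_add 4 4 27 _) fun t₈ ht₈ => ?_
  obtain ⟨b₅, hb₅⟩ : ∃ b₅ : Branch, b₅ = ⟨Function.update b₄.store 4
    (b₄.store 4 + b₄.store 27), b₄.state, t₈⟩ := ⟨_, rfl⟩
  rw [← hb₅]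
  have p : ∀ r < 40, r ≠ 4 → r ≠ 5 → r ≠ 6 → b₅.store r = b₃.store r := by
    intro r h1 h4 h5 h6
    simp [hb₅, h4, q r h1 h5 h6]
  have p4 : b₅.store 4 = 2 * (i + 1) + 1 := by
    simp [hb₅, q, m4, m27]
    ring
  have hbits := yields_bitsProg (k := 10) (by omega) b₅ (by rw [p 2, m2] <;> simp)
  rw [p 10 (by omega) (by omega) (by omega) (by omega), m10] at hbits
  rw [← PMF.bind_pure_comp]
  refine hbits.seq fun θ b₆ hb₆ => ?_
  obtain ⟨hθ, c17, cr, cst, cf⟩ := hb₆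
  have c : ∀ r < 40, r ≠ 4 → r ≠ 5 → r ≠ 6 → r ≠ 16 → r ≠ 17 → b₆.store r = b₃.store r := by
    intro r h1 h4 h5 h6 h16 h17
    rw [cr r h16 h17, p r h1 h4 h5 h6]
  have c4 : b₆.store 4 = 2 * (i + 1) + 1 := by rw [cr 4 (by omega) (by omega), p4]
  have chigh : ∀ r, b₆.store (r + 40) = b₄.store (r + 40) := by
    intro r
    rw [cr _ (by omega) (by omega), hb₅]
    simp
  have c40 : b₆.store 40 = ρ₁ 0 := (chigh 0).trans (hb₄.high 0)
  have c41 : b₆.store 41 = ρ₁ 1 := (chigh 1).trans (hb₄.high 1)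
  have c2 : b₆.store 2 = 0 := by rw [c 2, m2] <;> simp
  have c3 : b₆.store 3 = 2 * R + 1 := by rw [c 3, m3] <;> simp
  have c7 : b₆.store 7 = n := by rw [c 7, m7] <;> simp
  have c10 : b₆.store 10 = R := by rw [c 10, m10] <;> simp
  have c11 : b₆.store 11 = 2 ^ R := by rw [c 11, m11] <;> simp
  have c13 : b₆.store 13 = s * 2 ^ R * 2 := by rw [c 13, m13] <;> simp
  have c14 : b₆.store 14 = w := by rw [c 14, m14] <;> simp
  have c18 : b₆.store 18 = ρ₀ 0 := by rw [c 18, m18] <;> simp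
  have c19 : b₆.store 19 = ρ₀ 1 := by rw [c 19, m19] <;> simp
  have c27 : b₆.store 27 = 1 := by rw [c 27, m27] <;> simp
  obtain ⟨σ', hd, e14, fr⟩ := det_decideProg b₆.store c2 c27
  rw [c18, c40, c17, c11, c10] at hd
  rw [c11, c10, c14, c18, c19, c40, c41, c17] at e14
  refine Yields.of_det hd fun t₉ ht₉ => ?_
  have hbit := nextBit_le (2 ^ R) (ρ₀ 0) (ρ₀ 1) (ρ₁ 0) (ρ₁ 1) θ
  refine ⟨by rw [← c2]; exact fr 2 (by omega), by rw [← c3]; exact fr 3 (by omega),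
    by rw [← c4]; exact fr 4 (by omega), by rw [← c7]; exact fr 7 (by omega),
    by rw [← c10]; exact fr 10 (by omega), by rw [← c11]; exact fr 11 (by omega),
    by rw [← c13]; exact fr 13 (by omega), e14 rfl, ?_, ?_, ?_, ?_⟩
  · have := h.lt
    dsimp only
    rw [pow_succ]
    omega
  · intro r hr
    have : σ' (r + 40) = 0 := by rw [fr _ (by omega), chigh, hb₄.clear r hr]
    exact this
  · refine cf _ _ _ (by omega) ?_
    rw [hb₅]
    exact hfr'
  · have z0 := hb₂.size 0
    have z1 := hb₄.size 0
    have y0 := hL (2 * w) (by omega)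
    have y1 := hL _ hw
    have x0 := hb₂.steps
    have x1 := hb₄.steps
    -- The third multiplication has first factor `2θ + 2 ^ R < 3 * 2 ^ R`.
    have zθ : Nat.size (2 * θ + 2 ^ R) ≤ R + 2 := by
      rw [Nat.size_le, pow_add]
      omega
    have w1 : b₁.steps = t₂ := by rw [hb₁]
    have w3 : b₃.steps = t₇ := by rw [hb₃]
    have w5 : b₅.steps = t₈ := by rw [hb₅]
    have hs := h.steps
    simp only at *
    unfold advStepTime at *
    rw [mul_add, mul_one]
    omega

/-! ### Lengths of strings and sizes of their codes -/

theorem code_add_two_le (l : Str) : code l + 2 ≤ 2 ^ (l.length + 1) := by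
  induction l with
  | nil => simp [code]
  | cons b l ih =>
    rw [List.length_cons, pow_succ, code]
    split_ifs <;> omega

theorem pow_length_le (l : Str) : 2 ^ l.length ≤ code l + 1 := by
  induction l with
  | nil => simp [code]
  | cons b l ih =>
    rw [List.length_cons, pow_succ, code]
    split_ifs <;> omega

theorem length_decode_le (k : ℕ) : (decode k).length ≤ Nat.size k := by
  have h := pow_length_le (decode k)
  rw [code_decode] at h
  by_contra hc
  push Not at hc
  have h1 := Nat.lt_size_self k
  have h2 : 2 ^ (Nat.size k + 1) ≤ 2 ^ (decode k).length :=
    Nat.pow_le_pow_right (by omega) hc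
  rw [pow_succ] at h2
  have := Nat.one_le_two_pow (n := Nat.size k)
  have h3 : Nat.size k ≠ 0 := by
    intro h0
    rw [Nat.size_eq_zero] at h0
    subst h0
    simp [decode] at hc
  have := Nat.one_lt_two_pow h3
  omega

theorem size_encode_le (R : ℕ) (x : Str) {k : ℕ} (hk : k < 2 ^ (R + 1)) :
    Nat.size (encode (2 ^ R) (code x) k) ≤ x.length + R + 2 := by
  rw [Nat.size_le, encode]
  have h := code_add_two_le x
  calc code x * 2 ^ R * 2 + k < code x * 2 ^ R * 2 + 2 ^ (R + 1) := by omega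
    _ = (code x + 1) * 2 ^ (R + 1) := by ring
    _ ≤ 2 ^ (x.length + 1) * 2 ^ (R + 1) := by gcongr; omega
    _ = 2 ^ (x.length + R + 2) := by ring

/-- The prefix starts as 1, the leading marker, and the final subtraction of `2 ^ R` removes the
marker again. -/
theorem yields_advProg (d : ℕ) (A : Prog) (n : ℕ) (x : Str) (τ Ψ : PureState) {T : ℕ}
    (hΨ : Fresh (2 * keyLen d n + 1) 1 τ.1 Ψ.1)
    (hT : ∀ y : Str, y.length ≤ x.length + keyLen d n + 2 →
      ∀ a ∈ A.exec ⟨inputStore n y, τ.1, 0⟩, a.steps ≤ T) :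
    Yields (advProg d A) ⟨inputStore n x, Ψ.1, 0⟩
      ((chain (advStep A τ n (keyLen d n) (code x)) (keyLen d n) 1).map
        fun w => w - 2 ^ keyLen d n) fun y b' =>
      b'.store 0 = y ∧ b'.steps ≤ d * (n + 5) + 3 * keyLen d n + 40
        + advStepTime A n (keyLen d n) (x.length + keyLen d n + 2) T * keyLen d n := by
  have i0 : inputStore n x 0 = n := rfl
  obtain ⟨σ₁, hd, s4, s7, s10, s11, s12, hr⟩ := det_setupProg d (inputStore n x) rfl
  rw [i0] at hd s7 s10 s11 s12
  set R := keyLen d n with hR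
  have s1 : σ₁ 1 = code x := hr 1 (by omega)
  have s2 : σ₁ 2 = 0 := hr 2 (by omega)
  have sh : ∀ r, σ₁ (r + 40) = 0 := fun r => hr (r + 40) (by omega)
  refine Yields.seq_det hd fun t₁ ht₁ => ?_
  refine Yields.seq_det (det_add 3 10 10 _) fun t₂ ht₂ => ?_
  refine Yields.seq_det (det_add 3 3 4 _) fun t₃ ht₃ => ?_
  refine Yields.seq_det (det_add 13 1 2 _) fun t₄ ht₄ => ?_
  refine Yields.seq_det (det_doubleProg 13 10 _) fun t₅ ht₅ => ?_
  refine Yields.seq_det (det_add 13 13 13 _) fun t₆ ht₆ => ?_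
  refine Yields.seq_det (det_const 14 1 _) fun t₇ ht₇ => ?_
  have hloop : ∀ b : Branch, b.store 10 = R → AdvInv A τ n R (code x)
      (d * (n + 5) + 3 * R + 38) (advStepTime A n R (x.length + R + 2) T) 0 1
      (b.evolve b.state) → Yields (.loop 10 (advStepProg A)) b _ _ := fun b hb h => by
    have := Yields.loop (r := 10) (c := advStepProg A) (κ := advStep A τ n R (code x))
      (fun i w b => AdvInv A τ n R (code x) (d * (n + 5) + 3 * R + 38)
        (advStepTime A n R (x.length + R + 2) T) i w b) h fun i hi w b' hb' =>
        yields_advStepProg (by rw [hb] at hi; exact hi)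
          (fun k hk => hT _ ((length_decode_le _).trans (size_encode_le R x hk)))
          (fun k hk => size_encode_le R x hk) hb'
    rwa [hb] at this
  rw [← PMF.bind_pure_comp]
  refine (hloop _ (by simp [s10]) ?_).seq fun w b hb => ?_
  · simp only [Function.update_apply, Nat.reduceEqDiff, if_true, if_false, s10] at ht₅
    refine ⟨by simp [Branch.evolve, s2], by simp [Branch.evolve, s10, s4, two_mul],
      by simp [Branch.evolve, s4], by simp [Branch.evolve, s7], by simp [Branch.evolve, s10],
      by simp [Branch.evolve, s11], by simp [Branch.evolve, s1, s2, s10, mul_two],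
      by simp [Branch.evolve], by norm_num, fun r _ => by simp [Branch.evolve, sh], hΨ, ?_⟩
    simp only [Branch.evolve] at *
    omega
  · refine Yields.of_det (det_sub 0 14 11 _) fun t₈ ht₈ => ⟨?_, ?_⟩
    · simp [hb.s14, hb.s11]
    · have := hb.steps
      simp only at *
      omega

/-! ## One-sided total variation -/

/-- The total variation distance of two distributions. -/
def tv {α : Type} (p q : PMF α) : ℝ≥0∞ := ∑' a, (p a - q a)

theorem tv_self {α : Type} (p : PMF α) : tv p p = 0 := by simp [tv]

theorem tv_triangle {α : Type} (p q r : PMF α) : tv p r ≤ tv p q + tv q r := by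
  rw [tv, tv, tv, ← ENNReal.tsum_add]
  exact ENNReal.tsum_le_tsum fun a => tsub_le_tsub_add_tsub

/-- Data processing: the positive part of a sum is at most the sum of the positive parts, and each
`f a` has mass 1. -/
theorem tv_bind_le {α β : Type} (p q : PMF α) (f : α → PMF β) :
    tv (p.bind f) (q.bind f) ≤ tv p q := by
  have h : ∀ b, p.bind f b - q.bind f b ≤ ∑' a, (p a - q a) * f a b := by
    intro b
    rw [tsub_le_iff_right, PMF.bind_apply, PMF.bind_apply, ← ENNReal.tsum_add]
    refine ENNReal.tsum_le_tsum fun a => ?_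
    rw [← add_mul]
    gcongr
    exact le_tsub_add
  refine (ENNReal.tsum_le_tsum h).trans ?_
  rw [ENNReal.tsum_comm, tv]
  refine ENNReal.tsum_le_tsum fun a => ?_
  rw [ENNReal.tsum_mul_left, PMF.tsum_coe, mul_one]

theorem tv_map_le {α β : Type} (p q : PMF α) (f : α → β) : tv (p.map f) (q.map f) ≤ tv p q := by
  rw [← PMF.bind_pure_comp, ← PMF.bind_pure_comp]
  exact tv_bind_le _ _ _

theorem tv_le_one {α : Type} (p q : PMF α) : tv p q ≤ 1 :=
  (ENNReal.tsum_le_tsum fun _ => tsub_le_self).trans_eq p.tsum_coe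

theorem summable_toReal {α : Type} (p : PMF α) : Summable fun a => (p a).toReal :=
  ENNReal.summable_toReal (by rw [p.tsum_coe]; exact ENNReal.one_ne_top)

theorem tsum_toReal {α : Type} (p : PMF α) : ∑' a, (p a).toReal = 1 := by
  rw [← ENNReal.tsum_toReal_eq p.apply_ne_top, p.tsum_coe, ENNReal.toReal_one]

/-- Use `|a - b| = 2 (a - b)⁺ - (a - b)`; the second term sums to 0 because both masses are 1. -/
theorem statDist_le_tv {α : Type} (p q : PMF α) : statDist p q ≤ (tv p q).toReal := by
  have hne : ∀ a, p a - q a ≠ ∞ := fun a => ENNReal.sub_ne_top (p.apply_ne_top a)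
  have htv : (∑' a, (p a - q a)) ≠ ∞ := ((tv_le_one p q).trans_lt ENNReal.one_lt_top).ne
  have hs : Summable fun a => (p a - q a).toReal := ENNReal.summable_toReal htv
  have h : ∀ a, |(p a).toReal - (q a).toReal|
      = 2 * (p a - q a).toReal - ((p a).toReal - (q a).toReal) := by
    intro a
    rcases le_total (q a) (p a) with h | h
    · have h1 : (q a).toReal ≤ (p a).toReal := ENNReal.toReal_mono (p.apply_ne_top a) h
      rw [ENNReal.toReal_sub_of_le h (p.apply_ne_top a), abs_of_nonneg (by linarith)]
      ring
    · have h1 : (p a).toReal ≤ (q a).toReal := ENNReal.toReal_mono (q.apply_ne_top a) h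
      rw [tsub_eq_zero_of_le h, abs_of_nonpos (by linarith)]
      simp
  rw [statDist, tsum_congr h, (hs.mul_left 2).tsum_sub ((summable_toReal p).sub
    (summable_toReal q)), (summable_toReal p).tsum_sub (summable_toReal q), tsum_toReal,
    tsum_toReal, tsum_mul_left, tv, ENNReal.tsum_toReal_eq hne]
  linarith

/-- The hybrid argument: the error made in one step is not increased by later steps, so the errors
add up. -/
theorem tv_chain_le {α : Type} (F : α → PMF α) (μ : ℕ → PMF α) {δ : ℝ≥0∞} {k : ℕ}
    (h : ∀ j < k, tv (μ (j + 1)) ((μ j).bind F) ≤ δ) :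
    tv (μ k) ((μ 0).bind (chain F k)) ≤ k * δ := by
  induction k with
  | zero =>
    have : (μ 0).bind (chain F 0) = μ 0 := PMF.bind_pure _
    simp [this, tv_self]
  | succ k ih =>
    have e : (μ 0).bind (chain F (k + 1)) = ((μ 0).bind (chain F k)).bind F := by
      rw [PMF.bind_bind]
      rfl
    rw [e]
    refine (tv_triangle _ ((μ k).bind F) _).trans ?_
    have h1 := (tv_bind_le _ _ F).trans (ih fun j hj => h j (by omega))
    refine (add_le_add (h k (by omega)) h1).trans_eq ?_
    push_cast
    ring

/-! ## The probabilities of the sampled strings -/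

theorem lastFlip_lt {v T : ℕ} (h : v < 2 * T) : lastFlip v < 2 * T := by
  unfold lastFlip
  omega

theorem lastFlip_eq_iff {v w b : ℕ} (hb : b ≤ 1) :
    lastFlip v = 2 * w + b ↔ v = 2 * w + (1 - b) := by
  unfold lastFlip
  omega

theorem encode_inj {T s s' v v' : ℕ} (hv : v < 2 * T) (hv' : v' < 2 * T) :
    encode T s v = encode T s' v' ↔ s = s' ∧ v = v' := by
  constructor
  · intro h
    have hT : 0 < 2 * T := by omega
    have e : ∀ s v, encode T s v = v + 2 * T * s := fun s v => by rw [encode]; ring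
    rw [e, e] at h
    have h1 : v = v' := by
      have := congrArg (· % (2 * T)) h
      simpa [Nat.add_mul_mod_self_left, Nat.mod_eq_of_lt hv, Nat.mod_eq_of_lt hv'] using this
    subst h1
    have h2 : 2 * T * s = 2 * T * s' := by omega
    exact ⟨Nat.eq_of_mul_eq_mul_left hT h2, rfl⟩
  · rintro ⟨rfl, rfl⟩
    rfl

/-- The distribution of the puzzle and the first `j` bits of the key. -/
def prefixDist (R : ℕ) (P : PMF (ℕ × ℕ)) (j : ℕ) : PMF (ℕ × ℕ) :=
  P.map fun sk => (sk.1, (2 ^ R + sk.2) / 2 ^ (R - j))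

section
variable {R : ℕ} {P : PMF (ℕ × ℕ)}

theorem prefixDist_apply (j s v : ℕ) : prefixDist R P j (s, v)
    = ev P fun sk => if sk.1 = s ∧ (2 ^ R + sk.2) / 2 ^ (R - j) = v then 1 else 0 := by
  rw [← ev_single, prefixDist, ev_map]
  simp only [Prod.mk.injEq]

theorem prefix_bounds {k i : ℕ} (hk : k < 2 ^ R) (hi : i ≤ R) :
    2 ^ (R - i) ≤ (2 ^ R + k) / 2 ^ i ∧ (2 ^ R + k) / 2 ^ i < 2 ^ (R - i + 1) := by
  have h : 2 ^ R = 2 ^ (R - i) * 2 ^ i := by rw [← pow_add, Nat.sub_add_cancel hi]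
  constructor
  · rw [Nat.le_div_iff_mul_le (by positivity), ← h]
    omega
  · rw [Nat.div_lt_iff_lt_mul (by positivity), pow_succ]
    calc 2 ^ R + k < 2 ^ R * 2 := by omega
      _ = 2 ^ (R - i) * 2 * 2 ^ i := by rw [h]; ring

/-- A prefix of `j` bits is half of the prefix of `j + 1` bits, rounded down, so its event is the
disjoint union of the events of its two extensions. -/
theorem prefixDist_split {j : ℕ} (hj : j < R) (s w : ℕ) :
    prefixDist R P j (s, w)
      = prefixDist R P (j + 1) (s, 2 * w) + prefixDist R P (j + 1) (s, 2 * w + 1) := by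
  rw [prefixDist_apply, prefixDist_apply, prefixDist_apply, ← ev_add]
  congr 1
  funext sk
  have h : (2 ^ R + sk.2) / 2 ^ (R - j) = (2 ^ R + sk.2) / 2 ^ (R - (j + 1)) / 2 := by
    rw [Nat.div_div_eq_div_mul, ← pow_succ]
    congr 2
    omega
  rw [h]
  by_cases h1 : sk.1 = s
  · simp only [h1, true_and]
    by_cases h2 : (2 ^ R + sk.2) / 2 ^ (R - (j + 1)) = 2 * w
    · rw [if_pos (by omega), if_pos h2, if_neg (by omega), add_zero]
    · by_cases h3 : (2 ^ R + sk.2) / 2 ^ (R - (j + 1)) = 2 * w + 1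
      · rw [if_pos (by omega), if_neg h2, if_pos h3, zero_add]
      · rw [if_neg (by omega), if_neg h2, if_neg h3, zero_add]
  · simp [h1]

theorem prefixDist_support (hP : ∀ sk, P sk ≠ 0 → sk.2 < 2 ^ R) {j s v : ℕ} (hj : j ≤ R) (h : prefixDist R P j (s, v) ≠ 0) :
    2 ^ j ≤ v ∧ v < 2 ^ (j + 1) := by
  by_contra hv
  refine h ?_
  have h0 : ev P (fun _ => 0) = 0 := ev_const P 0
  rw [prefixDist_apply]
  refine (ev_congr P fun sk hsk => if_neg ?_).trans h0
  rintro ⟨-, rfl⟩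
  have := prefix_bounds (hP sk hsk) (Nat.sub_le R j)
  rw [Nat.sub_sub_self hj] at this
  exact hv this

/-- The marker bit of `w` determines the prefix length, whence the factor `1/R`. The string then
arises from itself with weight 3/4 or from its sibling by a flip with weight 1/4. -/
theorem samplerDist_apply (hP : ∀ sk, P sk ≠ 0 → sk.2 < 2 ^ R) {d n j s w b : ℕ}
    (hR : R = keyLen d n) (hj : j < R) (hb : b ≤ 1)
    (hw : 2 ^ j ≤ w ∧ w < 2 ^ (j + 1)) : samplerDist d n P (encode (2 ^ R) s (2 * w + b))
      = (R : ℝ≥0∞)⁻¹ * (4⁻¹ * (prefixDist R P (j + 1) (s, 2 * w + (1 - b))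
        + 3 * prefixDist R P (j + 1) (s, 2 * w + b))) := by
  have hpow : 2 ^ (j + 2) ≤ 2 * 2 ^ R := by
    rw [← pow_succ']
    exact Nat.pow_le_pow_right (by omega) (by omega)
  have hpw : 2 ^ (j + 2) = 2 * 2 ^ (j + 1) := by rw [← pow_succ']
  have hpw' : 2 ^ (j + 1) = 2 * 2 ^ j := by rw [← pow_succ']
  have hlt : 2 * w + b < 2 * 2 ^ R := by omega
  set h : ℕ → ℕ → ℝ≥0∞ := fun i v => ev P fun sk =>
    if sk.1 = s ∧ (2 ^ R + sk.2) / 2 ^ i = v then 1 else 0 with hh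
  -- A prefix with `i` bits removed lies in `[2 ^ (R - i), 2 ^ (R - i + 1))`, while `2w + c` lies in
  -- `[2 ^ (j + 1), 2 ^ (j + 2))`; these intervals are disjoint unless `R - i = j + 1`.
  have hi0 : ∀ i < R, i ≠ R - (j + 1) → ∀ c ≤ 1, h i (2 * w + c) = 0 := by
    intro i hi hne c hc
    have h0 : ev P (fun _ => 0) = 0 := ev_const P 0
    refine (ev_congr P fun sk hsk => if_neg ?_).trans h0
    rintro ⟨-, e⟩
    obtain ⟨h1, h2⟩ := prefix_bounds (hP sk hsk) hi.le
    rw [e] at h1 h2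
    have h3 : R - i < j + 2 := (Nat.pow_lt_pow_iff_right (a := 2) (by omega)).mp
      (by omega : 2 ^ (R - i) < 2 ^ (j + 2))
    have h4 : j + 1 < R - i + 1 := (Nat.pow_lt_pow_iff_right (a := 2) (by omega)).mp
      (by omega : 2 ^ (j + 1) < 2 ^ (R - i + 1))
    omega
  have key : ∀ i < R, ∀ f, ev P (fun sk => if encode (2 ^ R) sk.1 (if f = 0 then
      lastFlip ((2 ^ R + sk.2) / 2 ^ i) else (2 ^ R + sk.2) / 2 ^ i)
        = encode (2 ^ R) s (2 * w + b) then 1 else 0)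
      = if f = 0 then h i (2 * w + (1 - b)) else h i (2 * w + b) := by
    intro i hi f
    rw [hh]
    split_ifs with hf
    · refine ev_congr P fun sk hsk => ?_
      have h1 := (prefix_bounds (hP sk hsk) hi.le).2
      have h2 : 2 ^ (R - i + 1) ≤ 2 * 2 ^ R := by
        rw [← pow_succ']
        exact Nat.pow_le_pow_right (by omega) (by omega)
      simp only [encode_inj (lastFlip_lt (h1.trans_le h2)) hlt, lastFlip_eq_iff hb]
    · refine ev_congr P fun sk hsk => ?_
      have h1 := (prefix_bounds (hP sk hsk) hi.le).2
      have h2 : 2 ^ (R - i + 1) ≤ 2 * 2 ^ R := by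
        rw [← pow_succ']
        exact Nat.pow_le_pow_right (by omega) (by omega)
      simp only [encode_inj (h1.trans_le h2) hlt]
  rw [← ev_single, samplerDist, ev_bind, ev_coinNum]
  simp only [ev_bind, ev_coinNum, ev_map, ← hR]
  have hRl : 2 ^ logLen d n = R := by rw [hR]; rfl
  rw [hRl, Finset.sum_eq_single (R - (j + 1))]
  · have e : (2 : ℝ≥0∞) ^ logLen d n = R := by
      rw [← hRl]
      push_cast
      rfl
    have e4 : ((2 : ℝ≥0∞) ^ 2) = 4 := by norm_num
    rw [e, e4, prefixDist_apply, prefixDist_apply]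
    congr 2
    simp only [key _ (show R - (j + 1) < R by omega)]
    simp [Finset.sum_range_succ, hh]
    ring
  · intro i hi hne
    rw [Finset.mem_range] at hi
    simp only [key i hi, hi0 i hi hne _ hb, hi0 i hi hne (1 - b) (by omega)]
    simp
  · intro h
    exact absurd (Finset.mem_range.mpr (by omega)) h

end

/-! ## The error in one step of the adversary -/

theorem card_filter_lt (T : ℕ) (y : ℝ) :
    ((Finset.range T).filter fun θ : ℕ => (θ : ℝ) < y).card = min T ⌈y⌉₊ := by
  have : ((Finset.range T).filter fun θ : ℕ => (θ : ℝ) < y) = Finset.range (min T ⌈y⌉₊) := by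
    ext θ
    simp [Nat.lt_ceil]
  rw [this, Finset.card_range]

/-- Positive quotients rule out zero denominators, for which division returns 0. The threshold `2r -
1/2` inverts the noise `r = 1/4 + x/2`. -/
theorem nextBit_eq_one_iff {T u₀ v₀ u₁ v₁ θ : ℕ} (h₀ : 0 < (u₀ / v₀ : ℝ))
    (h₁ : 0 < (u₁ / v₁ : ℝ)) : nextBit T u₀ v₀ u₁ v₁ θ = 1 ↔
      (θ : ℝ) < T * (2 * ((u₁ / v₁ : ℝ) / (u₀ / v₀ + u₁ / v₁)) - 1 / 2) := by
  have hv₀ : 0 < (v₀ : ℝ) := by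
    rcases Nat.eq_zero_or_pos v₀ with h | h
    · simp [h] at h₀
    · exact_mod_cast h
  have hv₁ : 0 < (v₁ : ℝ) := by
    rcases Nat.eq_zero_or_pos v₁ with h | h
    · simp [h] at h₁
    · exact_mod_cast h
  have e : nextBit T u₀ v₀ u₁ v₁ θ = 1 ↔
      (2 * θ + T) * (u₀ * v₁ + u₁ * v₀) < 4 * T * (u₁ * v₀) := by
    simp only [nextBit, Nat.sub_eq_zero_iff_le, ← not_lt]
    split_ifs with h <;> simpa using h
  rw [e, ← Nat.cast_lt (α := ℝ)]
  push_cast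
  have e0 : (u₀ : ℝ) = u₀ / v₀ * v₀ := by field_simp
  have e1 : (u₁ : ℝ) = u₁ / v₁ * v₁ := by field_simp
  set a := (u₀ / v₀ : ℝ)
  set b := (u₁ / v₁ : ℝ)
  rw [e0, e1]
  have hv : 0 < (v₀ : ℝ) * v₁ := by positivity
  have hab : 0 < a + b := by positivity
  have l : (2 * (θ : ℝ) + T) * (a * v₀ * v₁ + b * v₁ * v₀)
      = (2 * θ + T) * (a + b) * (v₀ * v₁) := by ring
  have r : 4 * (T : ℝ) * (b * v₁ * v₀) = 4 * T * b * (v₀ * v₁) := by ring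
  rw [l, r, mul_lt_mul_iff_left₀ hv, ← lt_div_iff₀ hab, mul_div_assoc]
  constructor <;> intro h <;> linarith

/-- Over the common denominator the error has numerator at most `2 D₀ D₁ / p`. As `p ≥ 2`, the
denominator is at least `(D₀ + D₁)² / 2 ≥ 2 D₀ D₁`. -/
theorem abs_ratio_sub_le {a₀ a₁ D₀ D₁ p : ℝ} (h₀ : 0 < D₀) (h₁ : 0 < D₁) (hp : 2 ≤ p)
    (g₀ : |a₀ - D₀| ≤ D₀ / p) (g₁ : |a₁ - D₁| ≤ D₁ / p) :
    0 < a₀ ∧ 0 < a₁ ∧ |a₁ / (a₀ + a₁) - D₁ / (D₀ + D₁)| ≤ 1 / p := by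
  have hp0 : 0 < p := by linarith
  have q₀ : D₀ / p ≤ D₀ / 2 := by gcongr
  have q₁ : D₁ / p ≤ D₁ / 2 := by gcongr
  have l₀ := (abs_le.mp (g₀.trans q₀)).1
  have l₁ := (abs_le.mp (g₁.trans q₁)).1
  have p₀ : 0 < a₀ := by linarith
  have p₁ : 0 < a₁ := by linarith
  refine ⟨p₀, p₁, ?_⟩
  have hs : 0 < a₀ + a₁ := by positivity
  have hD : 0 < D₀ + D₁ := by positivity
  have e : a₁ / (a₀ + a₁) - D₁ / (D₀ + D₁)
      = ((a₁ - D₁) * D₀ - (a₀ - D₀) * D₁) / ((a₀ + a₁) * (D₀ + D₁)) := by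
    field_simp
    ring
  rw [e, abs_div, abs_of_pos (by positivity : 0 < (a₀ + a₁) * (D₀ + D₁)),
    div_le_div_iff₀ (by positivity) hp0, one_mul]
  have hn : |(a₁ - D₁) * D₀ - (a₀ - D₀) * D₁| ≤ D₁ / p * D₀ + D₀ / p * D₁ := by
    refine (abs_sub _ _).trans ?_
    rw [abs_mul, abs_mul, abs_of_pos h₀, abs_of_pos h₁]
    gcongr
  calc |(a₁ - D₁) * D₀ - (a₀ - D₀) * D₁| * p ≤ (D₁ / p * D₀ + D₀ / p * D₁) * p := by gcongr
    _ = 2 * (D₀ * D₁) := by field_simp; ring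
    _ ≤ (D₀ + D₁) / 2 * (D₀ + D₁) := by nlinarith [sq_nonneg (D₀ - D₁)]
    _ ≤ (a₀ + a₁) * (D₀ + D₁) := by gcongr; linarith

/-- When both estimates are good, the next bit has nearly the right conditional distribution: `2/p`
is the error of the ratio, doubled by undoing the noise, and `1/T` comes from rounding the
threshold. -/
theorem le_mul_card_nextBit {T u₀ v₀ u₁ v₁ : ℕ} (hT : 0 < T) {r₀ r₁ c p : ℝ} (h₀ : 0 ≤ r₀)
    (h₁ : 0 ≤ r₁) (hr : 0 < r₀ + r₁) (hc : 0 < c) (hp : 2 ≤ p)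
    (g₀ : |(u₀ / v₀ : ℝ) - c * (r₁ + 3 * r₀)| ≤ c * (r₁ + 3 * r₀) / p)
    (g₁ : |(u₁ / v₁ : ℝ) - c * (r₀ + 3 * r₁)| ≤ c * (r₀ + 3 * r₁) / p) {b : ℕ} (hb : b ≤ 1) :
    (if b = 0 then r₀ else r₁) ≤ (r₀ + r₁) *
      ((((Finset.range T).filter fun θ => nextBit T u₀ v₀ u₁ v₁ θ = b).card : ℝ) / T
        + (2 / p + 1 / T)) := by
  obtain ⟨p₀, p₁, hd⟩ := abs_ratio_sub_le (D₀ := c * (r₁ + 3 * r₀)) (D₁ := c * (r₀ + 3 * r₁))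
    (mul_pos hc (by linarith)) (mul_pos hc (by linarith)) hp g₀ g₁
  have hT' : 0 < (T : ℝ) := by exact_mod_cast hT
  set x := r₁ / (r₀ + r₁) with hx
  have hx0 : 0 ≤ x := by positivity
  have hx1 : x ≤ 1 := by rw [hx, div_le_one hr]; linarith
  have e : c * (r₀ + 3 * r₁) / (c * (r₁ + 3 * r₀) + c * (r₀ + 3 * r₁)) = 1 / 4 + x / 2 := by
    have : c * (r₁ + 3 * r₀) + c * (r₀ + 3 * r₁) = c * (4 * (r₀ + r₁)) := by ring
    rw [this, mul_div_mul_left _ _ hc.ne', hx]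
    field_simp
    ring
  rw [e] at hd
  set y := 2 * ((u₁ / v₁ : ℝ) / (u₀ / v₀ + u₁ / v₁)) - 1 / 2 with hy
  have hyx : |y - x| ≤ 2 / p := by
    have e2 : y - x = 2 * ((u₁ / v₁ : ℝ) / (u₀ / v₀ + u₁ / v₁) - (1 / 4 + x / 2)) := by
      rw [hy]; ring
    rw [e2, abs_mul, abs_two]
    calc 2 * _ ≤ 2 * (1 / p) := by gcongr
      _ = 2 / p := by ring
  obtain ⟨hy1, hy2⟩ := abs_le.mp hyx
  have hp' : 0 < 2 / p := by positivity
  have hTi : 0 < 1 / (T : ℝ) := by positivity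
  set k := min T ⌈T * y⌉₊ with hk
  have c1 : ((Finset.range T).filter fun θ => nextBit T u₀ v₀ u₁ v₁ θ = 1).card = k := by
    rw [hk, ← card_filter_lt]
    congr 1
    ext θ
    simp only [Finset.mem_filter, nextBit_eq_one_iff p₀ p₁, hy]
  -- The approximation `y` of `x` may lie outside `[0, 1]`; truncation to the range of `θ` does no
  -- harm because `x` itself lies in `[0, 1]`.
  have lo : x ≤ (k : ℝ) / T + 2 / p := by
    have : min 1 y ≤ (k : ℝ) / T := by
      rw [le_div_iff₀ hT', hk, Nat.cast_min, min_mul_of_nonneg _ _ hT'.le, one_mul, mul_comm y]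
      exact min_le_min le_rfl (Nat.le_ceil _)
    rcases min_choice 1 y with h | h <;> rw [h] at this <;> linarith
  have hi : (k : ℝ) / T ≤ x + 2 / p + 1 / T := by
    by_cases hy0 : 0 ≤ y
    · have : (k : ℝ) / T ≤ y + 1 / T := by
        rw [div_le_iff₀ hT', add_mul, one_div_mul_cancel hT'.ne', mul_comm y]
        calc (k : ℝ) ≤ (⌈T * y⌉₊ : ℝ) := by
              rw [hk]
              exact_mod_cast min_le_right _ _
          _ ≤ T * y + 1 := (Nat.ceil_lt_add_one (by positivity)).le
      linarith
    · have hc0 : ⌈T * y⌉₊ = 0 := by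
        rw [Nat.ceil_eq_zero]
        exact mul_nonpos_of_nonneg_of_nonpos hT'.le (by linarith)
      have : k = 0 := by rw [hk, hc0]; simp
      rw [this]
      simp only [Nat.cast_zero, zero_div]
      positivity
  have e1 : r₁ = (r₀ + r₁) * x := by rw [hx]; field_simp
  obtain rfl | rfl : b = 0 ∨ b = 1 := by omega
  · have c0 : ((Finset.range T).filter fun θ => nextBit T u₀ v₀ u₁ v₁ θ = 0).card = T - k := by
      have := Finset.card_filter_add_card_filter_not (s := Finset.range T)
        (fun θ => nextBit T u₀ v₀ u₁ v₁ θ = 1)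
      rw [c1, Finset.card_range] at this
      have h2 : ((Finset.range T).filter fun θ => ¬ nextBit T u₀ v₀ u₁ v₁ θ = 1)
          = (Finset.range T).filter fun θ => nextBit T u₀ v₀ u₁ v₁ θ = 0 := by
        refine Finset.filter_congr fun θ _ => ?_
        have := nextBit_le T u₀ v₀ u₁ v₁ θ
        omega
      rw [h2] at this
      omega
    rw [if_pos rfl, c0, Nat.cast_sub (min_le_left _ _), sub_div, div_self hT'.ne']
    have e0 : r₀ = (r₀ + r₁) * (1 - x) := by rw [mul_sub, ← e1]; ring
    calc r₀ = (r₀ + r₁) * (1 - x) := e0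
      _ ≤ _ := by gcongr; linarith
  · rw [if_neg one_ne_zero, c1]
    calc r₁ = (r₀ + r₁) * x := e1
      _ ≤ _ := by gcongr; linarith

/-- The result `ρ` of an estimation of the probability of `z` is good. -/
def GoodEstimate (D : PMF ℕ) (p : ℝ) (z : ℕ) (ρ : ℕ → ℕ) : Prop :=
  |(ρ 0 / ρ 1 : ℝ) - (D z).toReal| ≤ (D z).toReal / p

open Classical in
/-- The probability that the estimate for `z` is bad. -/
def badProb (A : Prog) (τ : PureState) (n : ℕ) (D : PMF ℕ) (p : ℝ) (z : ℕ) : ℝ≥0∞ :=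
  ev (A.run n (decode z) τ) fun ρ => if GoodEstimate D p z ρ then 0 else 1

theorem ev_ev_mul_add {α β : Type} (κ : PMF α) (κ' : PMF β) (m η : ℝ≥0∞)
    (g : α → β → ℝ≥0∞) (x : α → ℝ≥0∞) (y : β → ℝ≥0∞) :
    ev κ (fun a => ev κ' fun b => m * (g a b + η + x a + y b))
      = m * (ev κ (fun a => ev κ' (g a)) + η + ev κ x + ev κ' y) := by
  have h : ∀ a, ev κ' (fun b => m * (g a b + η + x a + y b))
      = m * (ev κ' (g a) + η + x a + ev κ' y) := by
    intro a
    rw [ev_mul_left, ev_add, ev_add, ev_add, ev_const, ev_const]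
  rw [funext h, ev_mul_left, ev_add, ev_add, ev_add, ev_const, ev_const]

section
variable {d n : ℕ} {P : PMF (ℕ × ℕ)} {A : Prog} {τ : PureState}

theorem advStep_apply (R s w b : ℕ) : advStep A τ n R s w (2 * w + b)
    = ev (A.run n (decode (encode (2 ^ R) s (2 * w))) τ) fun ρ₀ =>
      ev (A.run n (decode (encode (2 ^ R) s (2 * w + 1))) τ) fun ρ₁ =>
      (2 ^ R)⁻¹ * (((Finset.range (2 ^ R)).filter fun θ =>
        nextBit (2 ^ R) (ρ₀ 0) (ρ₀ 1) (ρ₁ 0) (ρ₁ 1) θ = b).card : ℝ≥0∞) := by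
  rw [← ev_single, advStep, ev_bind]
  simp only [ev_bind, ev_map, ev_coinNum, add_right_inj, Finset.sum_boole]

/-- A bound for each fixed pair of estimation results, averaged over the two independent runs. If an
estimate is bad, its indicator 1 makes the bound trivial. -/
theorem prefixDist_le_advStep {R : ℕ} (hP : ∀ sk, P sk ≠ 0 → sk.2 < 2 ^ R) (hR : R = keyLen d n)
    {p : ℝ} (hp : 2 ≤ p) {j s w b : ℕ} (hj : j < R) (hb : b ≤ 1)
    (hw : 2 ^ j ≤ w ∧ w < 2 ^ (j + 1)) :
    prefixDist R P (j + 1) (s, 2 * w + b) ≤ prefixDist R P j (s, w) *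
      (advStep A τ n R s w (2 * w + b) + ENNReal.ofReal (2 / p + 1 / 2 ^ R)
        + badProb A τ n (samplerDist d n P) p (encode (2 ^ R) s (2 * w))
        + badProb A τ n (samplerDist d n P) p (encode (2 ^ R) s (2 * w + 1))) := by
  classical
  set D := samplerDist d n P with hD
  set m₀ := prefixDist R P (j + 1) (s, 2 * w) with hm₀
  set m₁ := prefixDist R P (j + 1) (s, 2 * w + 1) with hm₁
  have hR0 : 0 < (R : ℝ) := by exact_mod_cast (by omega : 0 < R)
  have D₀ : (D (encode (2 ^ R) s (2 * w))).toReal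
      = (R : ℝ)⁻¹ * 4⁻¹ * (m₁.toReal + 3 * m₀.toReal) := by
    have := samplerDist_apply hP hR hj (b := 0) (by omega) hw (s := s)
    simp only [add_zero, tsub_zero] at this
    rw [hD, this, ENNReal.toReal_mul, ENNReal.toReal_mul, ENNReal.toReal_add
      (PMF.apply_ne_top _ _) (ENNReal.mul_ne_top (by simp) (PMF.apply_ne_top _ _)),
      ENNReal.toReal_mul]
    simp [mul_assoc, hm₀, hm₁]
  have D₁ : (D (encode (2 ^ R) s (2 * w + 1))).toReal
      = (R : ℝ)⁻¹ * 4⁻¹ * (m₀.toReal + 3 * m₁.toReal) := by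
    have := samplerDist_apply hP hR hj (b := 1) (by omega) hw (s := s)
    simp only [add_zero, tsub_self] at this
    rw [hD, this, ENNReal.toReal_mul, ENNReal.toReal_mul, ENNReal.toReal_add
      (PMF.apply_ne_top _ _) (ENNReal.mul_ne_top (by simp) (PMF.apply_ne_top _ _)),
      ENNReal.toReal_mul]
    simp [mul_assoc, hm₀, hm₁]
  have hm : prefixDist R P j (s, w) = m₀ + m₁ := prefixDist_split hj s w
  have hmb : prefixDist R P (j + 1) (s, 2 * w + b) = if b = 0 then m₀ else m₁ := by
    obtain rfl | rfl : b = 0 ∨ b = 1 := by omega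
    · rfl
    · rfl
  have hle : (if b = 0 then m₀ else m₁) ≤ m₀ + m₁ := by
    split_ifs
    exacts [le_self_add, le_add_self]
  have t₀ : m₀ ≠ ∞ := PMF.apply_ne_top _ _
  have t₁ : m₁ ≠ ∞ := PMF.apply_ne_top _ _
  have point : ∀ ρ₀ ρ₁ : ℕ → ℕ, (if b = 0 then m₀ else m₁) ≤ (m₀ + m₁) *
      ((2 ^ R)⁻¹ * (((Finset.range (2 ^ R)).filter fun θ =>
        nextBit (2 ^ R) (ρ₀ 0) (ρ₀ 1) (ρ₁ 0) (ρ₁ 1) θ = b).card : ℝ≥0∞)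
      + ENNReal.ofReal (2 / p + 1 / 2 ^ R)
      + (if GoodEstimate D p (encode (2 ^ R) s (2 * w)) ρ₀ then 0 else 1)
      + (if GoodEstimate D p (encode (2 ^ R) s (2 * w + 1)) ρ₁ then 0 else 1)) := by
    intro ρ₀ ρ₁
    by_cases g₀ : GoodEstimate D p (encode (2 ^ R) s (2 * w)) ρ₀
    · by_cases g₁ : GoodEstimate D p (encode (2 ^ R) s (2 * w + 1)) ρ₁
      · rw [if_pos g₀, if_pos g₁, add_zero, add_zero]
        -- A prefix of probability zero has no conditional distribution for its next bit, but then
        -- both sides vanish.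
        by_cases h0 : m₀ + m₁ = 0
        · rw [h0] at hle ⊢
          simpa using hle
        rw [GoodEstimate, D₀] at g₀
        rw [GoodEstimate, D₁] at g₁
        have hpos : 0 < m₀.toReal + m₁.toReal := by
          rw [← ENNReal.toReal_add t₀ t₁]
          exact ENNReal.toReal_pos h0 (ENNReal.add_ne_top.mpr ⟨t₀, t₁⟩)
        have h := le_mul_card_nextBit (T := 2 ^ R) (by positivity) ENNReal.toReal_nonneg
          ENNReal.toReal_nonneg hpos (by positivity) hp g₀ g₁ hb
        have e1 : (if b = 0 then m₀ else m₁)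
            = ENNReal.ofReal (if b = 0 then m₀.toReal else m₁.toReal) := by
          split_ifs
          exacts [(ENNReal.ofReal_toReal t₀).symm, (ENNReal.ofReal_toReal t₁).symm]
        rw [e1]
        refine (ENNReal.ofReal_le_ofReal h).trans_eq ?_
        have hp' : 0 ≤ 2 / p + 1 / 2 ^ R := by positivity
        rw [ENNReal.ofReal_mul hpos.le, ENNReal.ofReal_add ENNReal.toReal_nonneg
          ENNReal.toReal_nonneg, ENNReal.ofReal_toReal t₀, ENNReal.ofReal_toReal t₁,
          Nat.cast_pow, Nat.cast_ofNat, ENNReal.ofReal_add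
            (div_nonneg (Nat.cast_nonneg _) (pow_nonneg zero_le_two _)) hp',
          ENNReal.ofReal_div_of_pos (pow_pos two_pos _), ENNReal.ofReal_natCast,
          ENNReal.ofReal_pow (by norm_num), ENNReal.ofReal_ofNat, ENNReal.div_eq_inv_mul]
      · rw [if_neg g₁]
        exact hle.trans (le_mul_of_one_le_right' le_add_self)
    · rw [if_neg g₀]
      exact hle.trans (le_mul_of_one_le_right' (le_add_right le_add_self))
  rw [hmb, hm]
  calc (if b = 0 then m₀ else m₁) = ev (A.run n (decode (encode (2 ^ R) s (2 * w))) τ)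
        fun _ => ev (A.run n (decode (encode (2 ^ R) s (2 * w + 1))) τ)
        fun _ => if b = 0 then m₀ else m₁ := by rw [ev_const, ev_const]
    _ ≤ _ := ev_mono _ fun ρ₀ => ev_mono _ fun ρ₁ => point ρ₀ ρ₁
    _ = _ := by
      rw [ev_ev_mul_add, advStep_apply, badProb, badProb]

end

/-! ## The total error of the adversary -/

theorem tsum_nat_even_odd (f : ℕ → ℝ≥0∞) : ∑' v, f v = ∑' w, (f (2 * w) + f (2 * w + 1)) := by
  rw [ENNReal.tsum_add]
  exact (tsum_even_add_odd ENNReal.summable ENNReal.summable).symm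

theorem map_apply_of_injective {α β : Type} (κ : PMF α) {g : α → β} (hg : Function.Injective g)
    (a : α) : κ.map g (g a) = κ a := by
  classical
  rw [← ev_single (κ.map g), ev_map, ← ev_single κ a]
  simp only [hg.eq_iff]

/-- `encode T` is injective on pairs with `v < 2 * T`, and the cutoff restricts the sum to these. -/
theorem tsum_encode_le (T : ℕ) (f : ℕ → ℝ≥0∞) :
    ∑' s, ∑' v, (if v < 2 * T then f (encode T s v) else 0) ≤ ∑' z, f z := by
  let S : Set (ℕ × ℕ) := {p | p.2 < 2 * T}
  rw [← ENNReal.tsum_prod (f := fun s v => if v < 2 * T then f (encode T s v) else 0)]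
  have h : ∀ p : ℕ × ℕ, (if p.2 < 2 * T then f (encode T p.1 p.2) else 0)
      = S.indicator (fun p => f (encode T p.1 p.2)) p := by
    intro p
    simp [Set.indicator_apply, S]
  rw [tsum_congr h, ← tsum_subtype S fun p => f (encode T p.1 p.2)]
  refine ENNReal.tsum_comp_le_tsum_of_injective
    (f := fun p : S => encode T p.1.1 p.1.2) (fun p q e => ?_) f
  obtain ⟨h1, h2⟩ := (encode_inj p.2 q.2).mp e
  exact Subtype.ext (Prod.ext h1 h2)

section
variable {d n R : ℕ} {P : PMF (ℕ × ℕ)} {A : Prog} {τ : PureState}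

/-- One step of the adversary, as a Markov chain on puzzles and prefixes. -/
def advPairStep (A : Prog) (τ : PureState) (n R : ℕ) (sw : ℕ × ℕ) : PMF (ℕ × ℕ) :=
  (advStep A τ n R sw.1 sw.2).map fun v => (sw.1, v)

/-- The purpose of the noise: even an extension that never occurs as a true prefix is sampled with a
fair share of the probability of its parent, since `m₀ + m₁` is at most `m_{1-b} + 3 m_b`. -/
theorem prefixDist_le_samplerDist (hP : ∀ sk, P sk ≠ 0 → sk.2 < 2 ^ R) (hR : R = keyLen d n)
    {j s w b : ℕ} (hj : j < R) (hb : b ≤ 1) (hw : 2 ^ j ≤ w ∧ w < 2 ^ (j + 1)) :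
    prefixDist R P j (s, w) ≤ 4 * R * samplerDist d n P (encode (2 ^ R) s (2 * w + b)) := by
  have hR0 : (R : ℝ≥0∞) ≠ 0 := by
    simp only [ne_eq, Nat.cast_eq_zero]
    omega
  have e : ∀ X : ℝ≥0∞, 4 * R * ((R : ℝ≥0∞)⁻¹ * (4⁻¹ * X)) = X := by
    intro X
    calc 4 * R * ((R : ℝ≥0∞)⁻¹ * (4⁻¹ * X)) = (4 * 4⁻¹) * (R * (R : ℝ≥0∞)⁻¹) * X := by ring
      _ = X := by
        rw [ENNReal.mul_inv_cancel (by norm_num) (by norm_num),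
          ENNReal.mul_inv_cancel hR0 (ENNReal.natCast_ne_top R), one_mul, one_mul]
  rw [samplerDist_apply hP hR hj hb hw, e, prefixDist_split hj]
  have h3 : ∀ x : ℝ≥0∞, x ≤ 3 * x := fun x => le_mul_of_one_le_left' (by norm_num)
  obtain rfl | rfl : b = 0 ∨ b = 1 := by omega
  · rw [add_comm]
    exact add_le_add le_rfl (h3 _)
  · exact add_le_add le_rfl (h3 _)

/-- The deficit at an extension of `w` is bounded by a quantity that depends only on `w`; the outer
factor 2 counts the two extensions. The failure terms of the estimates, moved from `prefixDist` to
the sampled distribution at the price `4R`, sum to at most the average failure probability. -/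
theorem tv_prefixDist_succ_le (hP : ∀ sk, P sk ≠ 0 → sk.2 < 2 ^ R) (hR : R = keyLen d n)
    {p : ℝ} (hp : 2 ≤ p) {j : ℕ} (hj : j < R) :
    tv (prefixDist R P (j + 1)) ((prefixDist R P j).bind (advPairStep A τ n R))
      ≤ 2 * (ENNReal.ofReal (2 / p + 1 / 2 ^ R)
        + 4 * R * ev (samplerDist d n P) (badProb A τ n (samplerDist d n P) p)) := by
  set η := ENNReal.ofReal (2 / p + 1 / 2 ^ R) with hη
  set D := samplerDist d n P with hD
  set bad := badProb A τ n D p with hbad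
  set g : ℕ → ℕ → ℝ≥0∞ := fun s v => if v < 2 * 2 ^ R then
    D (encode (2 ^ R) s v) * bad (encode (2 ^ R) s v) else 0 with hg
  set f : ℕ → ℕ → ℝ≥0∞ := fun s w => prefixDist R P j (s, w) * η
    + 4 * R * (g s (2 * w) + g s (2 * w + 1)) with hf
  have point : ∀ s v, prefixDist R P (j + 1) (s, v)
      - (prefixDist R P j).bind (advPairStep A τ n R) (s, v) ≤ f s (v / 2) := by
    intro s v
    by_cases h0 : prefixDist R P (j + 1) (s, v) = 0
    · simp [h0]
    have hv := prefixDist_support hP (by omega) h0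
    rw [pow_succ, pow_succ] at hv
    obtain ⟨w, b, hb, rfl⟩ : ∃ w b, b ≤ 1 ∧ v = 2 * w + b := ⟨v / 2, v % 2, by omega, by omega⟩
    have hw : 2 ^ j ≤ w ∧ w < 2 ^ (j + 1) := by
      rw [pow_succ]
      omega
    have hpow : 2 ^ (j + 2) ≤ 2 * 2 ^ R := by
      rw [← pow_succ']
      exact Nat.pow_le_pow_right (by omega) (by omega)
    have hw2 : 2 * w + 1 < 2 * 2 ^ R := by
      rw [pow_succ, pow_succ] at hpow
      omega
    have e : (2 * w + b) / 2 = w := by omega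
    have hbind : prefixDist R P j (s, w) * advStep A τ n R s w (2 * w + b)
        ≤ (prefixDist R P j).bind (advPairStep A τ n R) (s, 2 * w + b) := by
      rw [PMF.bind_apply]
      refine le_trans (le_of_eq ?_) (ENNReal.le_tsum (s, w))
      rw [advPairStep, map_apply_of_injective _ (Prod.mk_right_injective s)]
    have hg' : ∀ b ≤ 1, prefixDist R P j (s, w) * bad (encode (2 ^ R) s (2 * w + b))
        ≤ 4 * R * g s (2 * w + b) := by
      intro b hb
      rw [hg]
      simp only
      rw [if_pos (by omega), ← mul_assoc]
      gcongr
      exact prefixDist_le_samplerDist hP hR hj hb hw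
    rw [tsub_le_iff_right, e, hf]
    refine (prefixDist_le_advStep (A := A) (τ := τ) hP hR hp hj hb hw).trans ?_
    calc _ = prefixDist R P j (s, w) * η
          + (prefixDist R P j (s, w) * bad (encode (2 ^ R) s (2 * w + 0))
            + prefixDist R P j (s, w) * bad (encode (2 ^ R) s (2 * w + 1)))
          + prefixDist R P j (s, w) * advStep A τ n R s w (2 * w + b) := by
            rw [add_zero]
            ring
      _ ≤ prefixDist R P j (s, w) * η
          + (4 * R * g s (2 * w + 0) + 4 * R * g s (2 * w + 1))
          + (prefixDist R P j).bind (advPairStep A τ n R) (s, 2 * w + b) := by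
            exact add_le_add (add_le_add le_rfl (add_le_add (hg' 0 (by omega)) (hg' 1 le_rfl)))
              hbind
      _ = _ := by
            dsimp only
            rw [add_zero, mul_add]
  calc tv (prefixDist R P (j + 1)) ((prefixDist R P j).bind (advPairStep A τ n R))
      ≤ ∑' sv : ℕ × ℕ, f sv.1 (sv.2 / 2) := ENNReal.tsum_le_tsum fun sv => point sv.1 sv.2
    _ = ∑' s, ∑' v, f s (v / 2) := ENNReal.tsum_prod (f := fun s v => f s (v / 2))
    _ = ∑' s, ∑' w, 2 * f s w := by
        refine tsum_congr fun s => ?_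
        rw [tsum_nat_even_odd]
        refine tsum_congr fun w => ?_
        rw [show 2 * w / 2 = w by omega, show (2 * w + 1) / 2 = w by omega, two_mul]
    _ = 2 * ((∑' s, ∑' w, prefixDist R P j (s, w)) * η
        + 4 * R * ∑' s, ∑' v, g s v) := by
        simp only [hf, ENNReal.tsum_mul_left, ENNReal.tsum_add, ENNReal.tsum_mul_right]
        simp only [← ENNReal.tsum_add, ← tsum_nat_even_odd]
    _ ≤ 2 * (1 * η + 4 * R * ev D bad) := by
        gcongr
        · rw [← ENNReal.tsum_prod (f := fun s w => prefixDist R P j (s, w))]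
          exact (PMF.tsum_coe _).le
        · exact tsum_encode_le (2 ^ R) fun z => D z * bad z
    _ = _ := by rw [one_mul]

theorem chain_advPairStep (k s w : ℕ) : chain (advPairStep A τ n R) k (s, w)
    = (chain (advStep A τ n R s) k w).map fun v => (s, v) := by
  induction k with
  | zero => rw [chain_zero, chain_zero, PMF.pure_map]
  | succ k ih =>
    rw [chain_succ, chain_succ, ih, PMF.bind_map, PMF.map_bind]
    rfl

/-- The distribution of keys that the adversary outputs (as numbers). -/
def advDist (A : Prog) (τ : PureState) (n R s : ℕ) : PMF ℕ :=
  (chain (advStep A τ n R s) R 1).map fun w => w - 2 ^ R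

/-- Hybrids between the empty prefix, from which the adversary starts, and the full key. Removing
the marker by `g` can only decrease the distance. -/
theorem tv_advDist_le (hP : ∀ sk, P sk ≠ 0 → sk.2 < 2 ^ R) (hR : R = keyLen d n)
    {p : ℝ} (hp : 2 ≤ p) :
    tv P (P.bind fun sk => (advDist A τ n R sk.1).map fun k => (sk.1, k))
      ≤ R * (2 * (ENNReal.ofReal (2 / p + 1 / 2 ^ R)
        + 4 * R * ev (samplerDist d n P) (badProb A τ n (samplerDist d n P) p))) := by
  let g : ℕ × ℕ → ℕ × ℕ := fun sw => (sw.1, sw.2 - 2 ^ R)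
  have h1 : (prefixDist R P R).map g = P := by
    rw [prefixDist, PMF.map_comp]
    refine (congrArg (fun h => P.map h) (funext fun sk => ?_)).trans P.map_id
    simp [g]
  have h2 : ((prefixDist R P 0).bind (chain (advPairStep A τ n R) R)).map g
      = P.bind fun sk => (advDist A τ n R sk.1).map fun k => (sk.1, k) := by
    -- The empty prefix is just the marker: `2 ^ R ≤ 2 ^ R + k < 2 * 2 ^ R`.
    have h0 : prefixDist R P 0 = P.map fun sk => (sk.1, 1) := by
      refine PMF_ext_ev fun f => ?_
      rw [prefixDist, ev_map, ev_map]
      refine ev_congr P fun sk hsk => ?_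
      have := hP sk hsk
      congr 2
      rw [Nat.sub_zero]
      exact Nat.div_eq_of_lt_le (by omega) (by omega)
    rw [h0, PMF.bind_map, PMF.map_bind]
    congr 1
    funext sk
    rw [Function.comp, chain_advPairStep, advDist, PMF.map_comp, PMF.map_comp]
    rfl
  rw [← h2]
  nth_rewrite 1 [← h1]
  exact (tv_map_le _ _ g).trans
    (tv_chain_le _ _ fun j hj => tv_prefixDist_succ_le hP hR hp hj)

end

/-! ## The main theorem -/

theorem decode_injective : Function.Injective decode :=
  Function.LeftInverse.injective code_decode

theorem exists_branch_of_run_ne_zero {c : Prog} {n : ℕ} {x : Str} {ψ : PureState} {ρ : ℕ → ℕ}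
    (h : c.run n x ψ ρ ≠ 0) : ∃ b ∈ c.exec ⟨inputStore n x, ψ.1, 0⟩, b.store = ρ := by
  rw [Prog.run, ← PMF.mem_support_iff, PMF.mem_support_map_iff] at h
  obtain ⟨i, -, rfl⟩ := h
  exact ⟨_, List.getElem_mem _, rfl⟩

/-- A key (as a number) is small. -/
theorem run_lt {c : Prog} {n T : ℕ}
    (hT : ∀ b ∈ c.exec ⟨inputStore n [], zeroState.1, 0⟩, b.steps ≤ T) (sk : ℕ × ℕ)
    (h : ((c.run n [] zeroState).map fun ρ => (ρ 0, ρ 1)) sk ≠ 0) :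
    sk.2 < 2 ^ (c.constSize + n + T) := by
  rw [← PMF.mem_support_iff, PMF.mem_support_map_iff] at h
  obtain ⟨ρ, hρ, rfl⟩ := h
  obtain ⟨b, hb, rfl⟩ := exists_branch_of_run_ne_zero ((PMF.mem_support_iff _ _).mp hρ)
  have h1 := exec_size c (m := c.constSize + n) (by omega) _ (fun r => ?_) b hb 1
  · rw [← Nat.size_le]
    exact h1.trans (Nat.add_le_add_left (hT b hb) _)
  · have := size_le_self n
    simp only [inputStore, code]
    split_ifs <;> simp
    omega

theorem samplerProg_isQPT (d : ℕ) {c : Prog} (hc : c.IsQPT) : (samplerProg d c).IsQPT := by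
  obtain ⟨P, hP⟩ := hc
  refine PolyBdd.isQPT (f := fun m => d * (m + 5) + 9 * (2 * (m + 2) ^ d) + c.width
    + 9 * P.eval m + 70) ?_ fun n x => ⟨zeroState.1, fun b hb => ?_⟩
  · exact (((((PolyBdd.const d).mul (PolyBdd.id.add (.const 5))).add
      ((PolyBdd.const 9).mul ((PolyBdd.const 2).mul ((PolyBdd.id.add (.const 2)).pow d)))).add
      (.const _)).add ((PolyBdd.const 9).mul (.eval P))).add (.const 70)
  · obtain ⟨y, -, hy⟩ := (yields_samplerProg d c n x fun a ha => hP n [] zeroState a ha).forall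
      b hb
    refine hy.trans ?_
    have h1 := keyLen_le d n
    have h2 : (n + 2) ^ d ≤ (n + x.length + 2) ^ d := Nat.pow_le_pow_left (by omega) d
    have h3 := eval_mono P (show n + ([] : Str).length ≤ n + x.length by simp)
    have h4 : d * (n + 5) ≤ d * (n + x.length + 5) := Nat.mul_le_mul_left _ (by omega)
    dsimp only at h3 ⊢
    omega

theorem advProg_isQPT (d : ℕ) {A : Prog} (hA : A.IsQPT) : (advProg d A).IsQPT := by
  obtain ⟨P, hP⟩ := hA
  let r : ℕ → ℕ := fun m => 2 * (m + 2) ^ d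
  have hr : PolyBdd r := (PolyBdd.const 2).mul ((PolyBdd.id.add (.const 2)).pow d)
  have hL : PolyBdd fun m => m + r m + 2 := (PolyBdd.id.add hr).add (.const 2)
  have hT : PolyBdd fun m => P.eval (m + r m + 2) := PolyBdd.comp P hL
  refine PolyBdd.isQPT (f := fun m => d * (m + 5) + 3 * r m + 40
    + advStepTime A m (r m) (m + r m + 2) (P.eval (m + r m + 2)) * r m) ?_ fun n x => ?_
  · unfold advStepTime
    exact ((((PolyBdd.const d).mul (PolyBdd.id.add (.const 5))).add
      ((PolyBdd.const 3).mul hr)).add (.const 40)).add (((((PolyBdd.const 2).mul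
      ((PolyBdd.const (A.width + 3)).add ((((PolyBdd.const 2).mul (((PolyBdd.const 2).mul hr).add
      (.const 1))).add (.const 5)).mul hT))).add ((PolyBdd.const 14).mul
      ((((PolyBdd.const A.constSize).add .id).add hL).add hT))).add
      ((PolyBdd.const 13).mul hr)).add (.const 100) |>.mul hr)
  · have hR : keyLen d n ≤ r (n + x.length) := (keyLen_le d n).trans
      (Nat.mul_le_mul_left 2 (Nat.pow_le_pow_left (by omega) d))
    -- The analysis of the adversary presupposes copies of some state; for the time bound, copies of
    -- the zero state serve.
    obtain ⟨Ψ, hΨ, -⟩ := exists_copies (2 * keyLen d n + 1) (by omega) zeroState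
    refine ⟨Ψ.1, fun b hb => ?_⟩
    obtain ⟨y, -, hy⟩ := (yields_advProg d A n x zeroState Ψ
      (T := P.eval (n + x.length + r (n + x.length) + 2)) hΨ fun y hy a ha =>
        (hP n y zeroState a ha).trans (eval_mono P (by omega))).forall b hb
    refine hy.trans ?_
    unfold advStepTime
    gcongr <;> omega

theorem outNum_eq (A : Prog) (n : ℕ) (x : Str) (ψ : PureState) :
    A.outNum n x ψ = (A.run n x ψ).map fun σ => (σ 0 : ℚ) / (σ 1 : ℚ) := rfl

theorem toOuterMeasure_eq_ev {α : Type} (κ : PMF α) (S : Set α) [DecidablePred (· ∈ S)] :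
    κ.toOuterMeasure S = ev κ fun a => if a ∈ S then 1 else 0 := by
  rw [PMF.toOuterMeasure_apply]
  refine tsum_congr fun a => ?_
  by_cases h : a ∈ S <;> simp [h]

/-- If approximation succeeds with large probability, bad estimates are rare. -/
theorem ev_badProb_le {D : ℕ → PMF Str} {n : ℕ} {D' : PMF ℕ} (hD : D n = D'.map decode)
    {A : Prog} {τ : PureState} {t : ℝ} (h : 1 - 1 / t < approxProb D A τ n t) :
    ev D' (badProb A τ n D' t) ≤ ENNReal.ofReal (1 / t) := by
  classical
  set G := ev D' fun z => ev (A.run n (decode z) τ) fun ρ =>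
    if GoodEstimate D' t z ρ then 1 else 0 with hG
  have e1 : approxProb D A τ n t = G.toReal := by
    rw [approxProb, toOuterMeasure_eq_ev]
    congr 1
    rw [ev_bind, hD, ev_map, hG]
    congr 1
    funext z
    rw [ev_map, outNum_eq, ev_map]
    congr 1
    funext ρ
    simp only [Set.mem_ofPred_eq, map_apply_of_injective D' decode_injective, GoodEstimate]
    push_cast
    rfl
  have e2 : G + ev D' (badProb A τ n D' t) = 1 := by
    have hz : ∀ z, ev (A.run n (decode z) τ)
        (fun ρ => if GoodEstimate D' t z ρ then (1 : ℝ≥0∞) else 0) + badProb A τ n D' t z = 1 := by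
      intro z
      rw [badProb, ← ev_add]
      refine (congrArg (ev _) (funext fun ρ => ?_)).trans (ev_const _ 1)
      split_ifs <;> simp
    rw [hG, ← ev_add]
    exact (congrArg (ev D') (funext hz)).trans (ev_const D' 1)
  have hB : ev D' (badProb A τ n D' t) ≠ ∞ := by
    intro h
    rw [h] at e2
    simp at e2
  have hG' : G ≠ ∞ := by
    intro h
    rw [h] at e2
    simp at e2
  have e3 := congrArg ENNReal.toReal e2
  rw [ENNReal.toReal_add hG' hB, ENNReal.toReal_one] at e3
  rw [e1] at h
  refine (ENNReal.le_ofReal_iff_toReal_le hB ?_).mpr (by linarith)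
  have := ENNReal.toReal_nonneg (a := ev D' (badProb A τ n D' t))
  linarith

theorem eval_pos {q : Polynomial ℕ} (hq : q ≠ 0) {n : ℕ} (hn : 1 ≤ n) : 0 < q.eval n := by
  rw [Polynomial.eval_eq_sum_range]
  have h1 : q.coeff q.natDegree * n ^ q.natDegree
      ≤ ∑ i ∈ Finset.range (q.natDegree + 1), q.coeff i * n ^ i :=
    Finset.single_le_sum (f := fun i => q.coeff i * n ^ i) (fun _ _ => Nat.zero_le _)
      (Finset.mem_range.mpr (Nat.lt_succ_self _))
  have h2 : 0 < q.coeff q.natDegree :=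
    Nat.pos_of_ne_zero (Polynomial.leadingCoeff_ne_zero.mpr hq)
  exact (Nat.mul_pos h2 (by positivity)).trans_le h1

theorem four_mul_sq_le_two_pow {R : ℕ} (hR : 8 ≤ R) : 4 * R ^ 2 ≤ 2 ^ R := by
  induction R, hR using Nat.le_induction with
  | base => norm_num
  | succ R hR ih =>
    rw [pow_succ 2 R]
    nlinarith

/-- The total error of the adversary is small. -/
theorem error_lt {R q : ℕ} {t : ℝ} (hR : 8 ≤ R) (hq0 : 0 < q) (hq : q < R)
    (ht : 24 * (R : ℝ) ^ 3 ≤ t) :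
    (R : ℝ) * (2 * (2 / t + 1 / 2 ^ R + 4 * R * (1 / t))) < 1 / q := by
  have hR' : (8 : ℝ) ≤ R := by exact_mod_cast hR
  have hR0 : (0 : ℝ) < R := by linarith
  have hq' : (q : ℝ) < R := by exact_mod_cast hq
  have hq0' : (0 : ℝ) < q := by exact_mod_cast hq0
  have ht0 : 0 < t := lt_of_lt_of_le (by positivity) ht
  have h2 : (4 * R ^ 2 : ℝ) ≤ 2 ^ R := by exact_mod_cast four_mul_sq_le_two_pow hR
  have a1 : 1 / t ≤ 1 / (24 * (R : ℝ) ^ 3) := by gcongr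
  have a2 : 1 / (2 : ℝ) ^ R ≤ 1 / (4 * R ^ 2) := by gcongr
  calc (R : ℝ) * (2 * (2 / t + 1 / 2 ^ R + 4 * R * (1 / t)))
      = R * (2 * ((2 + 4 * R) * (1 / t) + 1 / 2 ^ R)) := by ring
    -- Both summands in the bracket equal `1 / (4 R²)`, which makes the total exactly `1 / R`; this
    -- is where the constant 24 comes from.
    _ ≤ R * (2 * ((6 * R) * (1 / (24 * (R : ℝ) ^ 3)) + 1 / (4 * R ^ 2))) := by
        gcongr
        linarith
    _ = 1 / R := by
        field_simp
        norm_num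
    _ < 1 / q := by gcongr

end QuantumPuzzle
end

theorem mainTheorem2
    (h : ∃ q : Polynomial ℕ, q ≠ 0 ∧ ∃ Samp : ℕ → PMF (QuantumPuzzle.Str × QuantumPuzzle.Str),
      QuantumPuzzle.IsDistributionalOneWayPuzzle (fun n => 1 / ((q.eval n : ℕ) : ℝ)) Samp) :
    ∃ D : ℕ → PMF QuantumPuzzle.Str, QuantumPuzzle.NativeApproximationHard D := by
  open QuantumPuzzle in
  obtain ⟨q, hq, Samp, ⟨c, hc, hSamp⟩, hard⟩ := h
  obtain ⟨Pc, hPc⟩ := id hc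
  -- One exponent for several needs: the key (at most `constSize + n + Pc` bits) must fit into `R`
  -- bits and `q` must be below `R`. The extra 3 in `d` ensures `8 ≤ R`.
  obtain ⟨d₁, hd₁⟩ := exists_eval_le_pow (Polynomial.C c.constSize + Polynomial.X + Pc + q)
  set d := d₁ + 3 with hd
  have hpow : ∀ n, (n + 2) ^ d₁ ≤ (n + 2) ^ d := fun n =>
    Nat.pow_le_pow_right (by omega) (by omega)
  have hR : ∀ n, c.constSize + n + Pc.eval n + q.eval n < keyLen d n := fun n => by
    have := hd₁ n
    simp only [Polynomial.eval_add, Polynomial.eval_C, Polynomial.eval_X] at this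
    exact (this.trans (hpow n)).trans_lt (lt_keyLen d n)
  have hR8 : ∀ n, 8 ≤ keyLen d n := fun n => by
    refine le_trans ?_ (lt_keyLen d n).le
    calc 8 = 2 ^ 3 := by norm_num
      _ ≤ (n + 2) ^ 3 := Nat.pow_le_pow_left (by omega) 3
      _ ≤ (n + 2) ^ d := Nat.pow_le_pow_right (by omega) (by omega)
  set P : ℕ → PMF (ℕ × ℕ) := fun n => (c.run n [] zeroState).map fun ρ => (ρ 0, ρ 1) with hPdef
  have hP : ∀ n sk, P n sk ≠ 0 → sk.2 < 2 ^ keyLen d n := fun n sk hsk =>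
    (run_lt (fun b hb => by simpa using hPc n [] zeroState b hb) sk hsk).trans_le
      (Nat.pow_le_pow_right (by omega) (by have := hR n; omega))
  set D : ℕ → PMF Str := fun n => (samplerProg d c).outStr n [] zeroState with hDdef
  have hD : ∀ n, D n = (samplerDist d n (P n)).map decode := by
    intro n
    have h1 := (yields_samplerProg d c n [] fun a ha => hPc n [] zeroState a ha).run_map
      (fun σ => σ 0) fun y b hb => hb.1
    rw [hDdef, ← h1, PMF.map_comp]
    rfl
  refine ⟨D, ⟨_, samplerProg_isQPT d hc, fun n => rfl⟩,
    -- `R ≤ 2 (n + 2) ^ d` gives `24 R³ ≤ 192 (n + 2) ^ (3d)`, the precision required by `error_lt`.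
    Polynomial.C 192 * (Polynomial.X + Polynomial.C 2) ^ (3 * d), ?_, fun A hA τ hτ => ?_⟩
  · intro h0
    have := congrArg (Polynomial.eval 0) h0
    simp at this
  choose Ψ hΨ hΨsupp using fun n => exists_copies (2 * keyLen d n + 1) (by omega) (τ n)
  have hadv : IsAdvice Ψ := by
    obtain ⟨m, hm⟩ := hτ
    refine ⟨(Polynomial.C 4 * (Polynomial.X + Polynomial.C 2) ^ d + Polynomial.C 1) * m,
      fun n x hx a ha => (hΨsupp n _ (hm n) x hx a ha).trans_le ?_⟩
    simp only [Polynomial.eval_mul, Polynomial.eval_add, Polynomial.eval_pow, Polynomial.eval_C,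
      Polynomial.eval_X]
    have := keyLen_le d n
    exact Nat.mul_le_mul_right _ (by omega)
  have hB := hard (advProg d A) (advProg_isQPT d hA) Ψ hadv
  obtain ⟨PA, hPA⟩ := hA
  -- The adversary and its advice do not depend on `n`'s being good, so the argument is carried out
  -- at each single `n` at which it fails to break the puzzle; `1 ≤ n` makes `q.eval n` positive.
  filter_upwards [hB, Filter.eventually_ge_atTop 1] with n hn hn1
  by_contra hcon
  rw [not_le] at hcon
  set t : ℝ := (((Polynomial.C 192 * (Polynomial.X + Polynomial.C 2) ^ (3 * d) :
    Polynomial ℕ).eval n : ℕ) : ℝ) with ht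
  have htR : 24 * (keyLen d n : ℝ) ^ 3 ≤ t := by
    rw [ht]
    have h1 : 24 * keyLen d n ^ 3 ≤ 24 * (2 * (n + 2) ^ d) ^ 3 := by
      gcongr
      exact keyLen_le d n
    simp only [Polynomial.eval_mul, Polynomial.eval_add, Polynomial.eval_pow, Polynomial.eval_C,
      Polynomial.eval_X]
    have h2 : 24 * (2 * (n + 2) ^ d) ^ 3 = 192 * (n + 2) ^ (3 * d) := by
      rw [mul_pow, ← pow_mul, mul_comm d 3]
      ring
    rw [h2] at h1
    exact_mod_cast h1
  have hR8' : (8 : ℝ) ≤ keyLen d n := by exact_mod_cast hR8 n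
  have ht2 : 2 ≤ t := by
    refine le_trans ?_ htR
    have : (1 : ℝ) ≤ (keyLen d n : ℝ) ^ 3 := one_le_pow₀ (by linarith)
    linarith
  have hbad := ev_badProb_le (hD n) hcon
  have htv := tv_advDist_le (A := A) (τ := τ n) (hP n) rfl ht2
  -- The analysis was done for numbers. Both distributions are images of it under `decode`, which
  -- does not increase the distance.
  have hSampn : Samp n = (P n).map fun sk => (decode sk.1, decode sk.2) := by
    rw [hSamp n, hPdef, PMF.map_comp]
    rfl
  have hout : ∀ s : ℕ, (advProg d A).outStr n (decode s) (Ψ n)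
      = (advDist A (τ n) n (keyLen d n) s).map decode := by
    intro s
    have h1 := (yields_advProg d A n (decode s) (τ n) (Ψ n)
      (T := PA.eval (n + ((decode s).length + keyLen d n + 2))) (hΨ n) fun y hy a ha =>
        (hPA n y (τ n) a ha).trans (eval_mono PA (by omega))).run_map
      (fun σ => σ 0) fun y b hb => hb.1
    rw [code_decode] at h1
    rw [advDist, ← h1, PMF.map_comp]
    rfl
  have hother : ((Samp n).bind fun sk =>
      ((advProg d A).outStr n sk.1 (Ψ n)).map fun k => (sk.1, k))
      = ((P n).bind fun sk => (advDist A (τ n) n (keyLen d n) sk.1).map fun k => (sk.1, k)).map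
        fun sk => (decode sk.1, decode sk.2) := by
    rw [hSampn, PMF.bind_map, PMF.map_bind]
    congr 1
    funext sk
    rw [Function.comp, hout, PMF.map_comp, PMF.map_comp]
    rfl
  have hreal : statDist (Samp n) ((Samp n).bind fun sk =>
      ((advProg d A).outStr n sk.1 (Ψ n)).map fun k => (sk.1, k))
      ≤ (keyLen d n : ℝ) * (2 * (2 / t + 1 / 2 ^ keyLen d n + 4 * keyLen d n * (1 / t))) := by
    refine (statDist_le_tv _ _).trans ?_
    refine ENNReal.toReal_le_of_le_ofReal (by positivity) ?_
    rw [hother]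
    nth_rewrite 1 [hSampn]
    refine (tv_map_le _ _ _).trans (htv.trans ?_)
    rw [ENNReal.ofReal_mul (by positivity), ENNReal.ofReal_mul (by positivity),
      ENNReal.ofReal_add (p := 2 / t + 1 / 2 ^ keyLen d n) (q := 4 * (keyLen d n : ℝ) * (1 / t))
        (by positivity) (by positivity),
      ENNReal.ofReal_mul (p := 4 * (keyLen d n : ℝ)) (by positivity),
      ENNReal.ofReal_mul (p := (4 : ℝ)) (by positivity)]
    simp only [ENNReal.ofReal_natCast, ENNReal.ofReal_ofNat]
    gcongr
  have hlt := error_lt (hR8 n) (eval_pos hq hn1) (by have := hR n; omega) htR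
  exact absurd (hn.trans hreal) (not_le.mpr hlt)
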